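/- Let $n\ge 3$, let $a_1,\dots,a_n$ be positive integers and let $0<\theta_1<\dots<\theta_n<\pi$. Put $v_i=(\cos\theta_i,\sin\theta_i)\in\mathbb R^2$, let $C=\prod_{i=1}^n[0,a_i]\subset\mathbb R^n$ with its standard cubical structure (unit cubes with integer vertices), let $\pi:C\to\mathbb R^2$, $\pi(x)=\sum_i x_iv_i$, and let $P=\pi(C)$. A *tiling* is a two-dimensional subcomplex $T\subset C$ such that $\pi|_T:T\to P$ is a homeomorphism; its 2-cells are called its rhombi. For a 3-cube $c=\{I+xe_j+ye_k+ze_\ell : x,y,z\in[0,1]\}\subset C$ with $j<k<\ell$, the three facets of $c$ containing $I+e_k$ are its bottom faces and the three facets containing $I+e_j+e_\ell$ its top faces. Two tilings $T,T'$ are related by a *flip* at $c$ if one of them contains the bottom faces of $c$ and the other is obtained from it by replacing these bottom faces by the top faces of $c$. Let $\mathbb X_1$ be the graph whose vertices are the tilings and whose edges are the flips. Let $\mathbb X_2$ be the two-dimensional cell complex obtained from $\mathbb X_1$ by gluing the following 2-cells: (i) a square along each 4-cycle $T,T',T''',T''$ in $\mathbb X_1$, where $T'$ and $T''$ are obtained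 from $T$ by flips involving disjoint sets of rhombi of $T$, and $T'''$ is obtained from $T$ by performing both flips; (ii) an octagon along each 8-cycle in $\mathbb X_1$ of the following kind: for some four-dimensional cell $\sigma$ of $C$, the cycle consists of eight distinct tilings, each of which contains a tiling of the octagon $\pi(\sigma)$ (a set of 2-faces of $\sigma$ whose union is mapped by $\pi$ homeomorphically onto $\pi(\sigma)$), and consecutive tilings are related by flips at 3-faces of $\sigma$. Then $\mathbb X_2$ is simply connected (in particular non-empty and path connected). -/

import Mathlib

namespace Zonogon

/-- A cell of the standard cubical structure on the positive orthant of `ℝⁿ`: the cube with lowest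
vertex `base` spanned by the unit vectors `e_i`, `i ∈ dirs`. Its dimension is `dirs.card`. -/
@[ext]
structure Cell (n : ℕ) where
  base : Fin n → ℕ
  dirs : Finset (Fin n)

/-- The set of points `base + ∑_{i ∈ dirs} t_i e_i` with `t_i ∈ [0,1]`. -/
def Cell.carrier {n : ℕ} (c : Cell n) : Set (Fin n → ℝ) :=
  {x | ∀ i, (c.base i : ℝ) ≤ x i ∧ x i ≤ (c.base i : ℝ) + (if i ∈ c.dirs then 1 else 0)}

/-- The box `C = ∏ [0, a_i]`. -/
def box {n : ℕ} (a : Fin n → ℕ) : Set (Fin n → ℝ) :=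
  {x | ∀ i, 0 ≤ x i ∧ x i ≤ (a i : ℝ)}

/-- The projection `π(x) = ∑ x_i v_i` with `v_i = (cos θ_i, sin θ_i)`. -/
noncomputable def proj {n : ℕ} (θ : Fin n → ℝ) (x : Fin n → ℝ) : ℝ × ℝ :=
  (∑ i, x i * Real.cos (θ i), ∑ i, x i * Real.sin (θ i))

/-- The union of a set of cells. -/
def union {n : ℕ} (F : Set (Cell n)) : Set (Fin n → ℝ) :=
  {x | ∃ f ∈ F, x ∈ f.carrier}

/-- The cells in `F` are two-dimensional, and the projection restricts to a homeomorphism from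
their union onto `R`. -/
def Tiles {n : ℕ} (θ : Fin n → ℝ) (F : Set (Cell n)) (R : Set (ℝ × ℝ)) : Prop :=
  (∀ f ∈ F, f.dirs.card = 2) ∧ ∃ h : union F ≃ₜ R, ∀ x : union F, (h x : ℝ × ℝ) = proj θ x

/-- A tiling of the zonogon `P = π(C)`: a two-dimensional subcomplex of the cubical complex `C`
which `π` maps homeomorphically onto `P`. Such a subcomplex is the union of its two-dimensional
cells (a maximal edge or vertex would have a nonempty relatively open subset whose image is open
in `P`), so it is recorded by the set of these cells, the rhombi of the tiling. -/
@[ext]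
structure Tiling {n : ℕ} (a : Fin n → ℕ) (θ : Fin n → ℝ) where
  rhombi : Set (Cell n)
  subset_box : ∀ f ∈ rhombi, f.carrier ⊆ box a
  tiles : Tiles θ rhombi (proj θ '' box a)

/-- A 3-cube `I + [0,1] e_j + [0,1] e_k + [0,1] e_l` with `j < k < l`. -/
structure Cube (n : ℕ) where
  base : Fin n → ℕ
  j : Fin n
  k : Fin n
  l : Fin n
  hjk : j < k
  hkl : k < l

/-- The 3-cube as a cell. -/
def Cube.cell {n : ℕ} (c : Cube n) : Cell n := ⟨c.base, {c.j, c.k, c.l}⟩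

/-- The two-dimensional faces of the cube that contain the point `v`. -/
def Cube.facesAt {n : ℕ} (c : Cube n) (v : Fin n → ℝ) : Set (Cell n) :=
  {f | f.dirs.card = 2 ∧ f.carrier ⊆ c.cell.carrier ∧ v ∈ f.carrier}

/-- The bottom faces: the three facets containing `I + e_k`. -/
def Cube.bottom {n : ℕ} (c : Cube n) : Set (Cell n) :=
  c.facesAt (fun i => (c.base i : ℝ) + Pi.single (M := fun _ => ℝ) c.k 1 i)

/-- The top faces: the three facets containing `I + e_j + e_l`. -/
def Cube.top {n : ℕ} (c : Cube n) : Set (Cell n) :=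
  c.facesAt (fun i => (c.base i : ℝ) + Pi.single (M := fun _ => ℝ) c.j 1 i
    + Pi.single (M := fun _ => ℝ) c.l 1 i)

/-- `T'` is obtained from `T` by the upward flip at the cube `c ⊆ C`: `T` contains the bottom faces
of `c`, and `T'` results from replacing them by the top faces. -/
def UpFlip {n : ℕ} {a : Fin n → ℕ} {θ : Fin n → ℝ} (c : Cube n) (T T' : Tiling a θ) : Prop :=
  c.cell.carrier ⊆ box a ∧ c.bottom ⊆ T.rhombi ∧ T'.rhombi = (T.rhombi \ c.bottom) ∪ c.top

/-- `T` and `T'` are related by a (upward or downward) flip at the cube `c`. -/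
def FlipAt {n : ℕ} {a : Fin n → ℕ} {θ : Fin n → ℝ} (c : Cube n) (T T' : Tiling a θ) : Prop :=
  UpFlip c T T' ∨ UpFlip c T' T

theorem Cube.exists_bottom_not_top {n : ℕ} (c : Cube n) : ∃ f ∈ c.bottom, f ∉ c.top := by
  obtain ⟨b, j, k, l, hjk, hkl⟩ := c
  have hjl : j < l := hjk.trans hkl
  refine ⟨⟨b, {j, k}⟩, ⟨Finset.card_pair hjk.ne, ?_, ?_⟩, ?_⟩
  · intro x hx i
    refine ⟨(hx i).1, (hx i).2.trans ?_⟩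
    simp only [Cube.cell, Finset.mem_insert, Finset.mem_singleton]
    split_ifs with h1 h2 <;> first | linarith | (exfalso; tauto)
  · intro i
    by_cases h : i = k
    · subst h; simp
    · simp [h]
      split_ifs <;> norm_num
  · rintro ⟨-, -, h⟩
    have := (h l).2
    simp [hjl.ne', hkl.ne'] at this
    linarith

theorem UpFlip.ne {n : ℕ} {a : Fin n → ℕ} {θ : Fin n → ℝ} {c : Cube n} {T T' : Tiling a θ}
    (h : UpFlip c T T') : T ≠ T' := by
  rintro rfl
  obtain ⟨f, hf, hf'⟩ := c.exists_bottom_not_top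
  have := h.2.1 hf
  rw [h.2.2] at this
  rcases this with h1 | h1
  · exact h1.2 hf
  · exact hf' h1

/-- The graph `𝕏₁` whose vertices are the tilings and whose edges are the flips. -/
def flipGraph {n : ℕ} (a : Fin n → ℕ) (θ : Fin n → ℝ) : SimpleGraph (Tiling a θ) where
  Adj T T' := ∃ c : Cube n, FlipAt c T T'
  symm := ⟨fun _ _ ⟨c, h⟩ => ⟨c, h.symm⟩⟩
  loopless := ⟨fun _ ⟨_, h⟩ => h.elim (fun h => h.ne rfl) (fun h => h.ne rfl)⟩

/-- A 4-cycle obtained from two flips `w 0 ⇝ w 1` and `w 0 ⇝ w 3` involving disjoint sets of rhombi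
of `w 0`; the tiling `w 2` results from performing both of them. -/
def IsSquareCycle {n : ℕ} {a : Fin n → ℕ} {θ : Fin n → ℝ} (w : ZMod 4 → Tiling a θ) : Prop :=
  ∃ c d : Cube n, FlipAt c (w 0) (w 1) ∧ FlipAt d (w 0) (w 3) ∧
    Disjoint ((w 0).rhombi \ (w 1).rhombi) ((w 0).rhombi \ (w 3).rhombi) ∧
    FlipAt d (w 1) (w 2) ∧ FlipAt c (w 3) (w 2)

/-- `T` contains, as a set of rhombi, a tiling of the projection of the cell `σ`. -/
def ContainsTilingOf {n : ℕ} {a : Fin n → ℕ} {θ : Fin n → ℝ} (T : Tiling a θ) (σ : Cell n) :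
    Prop :=
  ∃ F ⊆ T.rhombi, (∀ f ∈ F, f.carrier ⊆ σ.carrier) ∧ Tiles θ F (proj θ '' σ.carrier)

/-- A cycle of eight distinct tilings, each of which contains a tiling of the octagon `π(σ)`, where
`σ` is a four-cell of `C`, and each of which is obtained from the preceding one by a flip
inside `σ`. -/
def IsOctagonCycle {n : ℕ} {a : Fin n → ℕ} {θ : Fin n → ℝ} (w : ZMod 8 → Tiling a θ) : Prop :=
  Function.Injective w ∧ ∃ σ : Cell n, σ.dirs.card = 4 ∧ σ.carrier ⊆ box a ∧
    ∀ j, ContainsTilingOf (w j) σ ∧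
      ∃ c : Cube n, c.cell.carrier ⊆ σ.carrier ∧ FlipAt c (w j) (w (j + 1))

/-- Combinatorial data for a two-dimensional cell complex: a graph together with a family of
polygons to be glued to it along closed edge paths. The polygon `f` has corners labelled by
`ZMod (sides f)` in cyclic order, and the corner `j` is glued to the vertex `corner f j`. -/
structure PolygonalComplex (V : Type) where
  graph : SimpleGraph V
  Face : Type
  sides : Face → ℕ
  sides_pos : ∀ f, 0 < sides f
  corner : ∀ f, ZMod (sides f) → V
  adj : ∀ f j, graph.Adj (corner f j) (corner f (j + 1))

namespace PolygonalComplex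

variable {V : Type}

/-- The disjoint union of points (one for each vertex), unit intervals (one for each oriented edge)
and closed discs (one for each polygon). -/
def Pieces (X : PolygonalComplex V) : Type :=
  (Σ _ : V, Unit) ⊕ (Σ _ : X.graph.Dart, unitInterval) ⊕
    (Σ _ : X.Face, Metric.closedBall (0 : ℂ) 1)

noncomputable instance (X : PolygonalComplex V) : TopologicalSpace X.Pieces :=
  inferInstanceAs (TopologicalSpace ((Σ _ : V, Unit) ⊕ (Σ _ : X.graph.Dart, unitInterval) ⊕
    (Σ _ : X.Face, Metric.closedBall (0 : ℂ) 1)))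

/-- The point of a vertex. -/
def pt (X : PolygonalComplex V) (v : V) : X.Pieces := Sum.inl ⟨v, ()⟩

/-- The point with parameter `t` on an oriented edge. -/
def edgePt (X : PolygonalComplex V) (d : X.graph.Dart) (t : unitInterval) : X.Pieces :=
  Sum.inr (Sum.inl ⟨d, t⟩)

/-- The point `z` of the disc that represents the polygon `f`. -/
def facePt (X : PolygonalComplex V) (f : X.Face) (z : Metric.closedBall (0 : ℂ) 1) : X.Pieces :=
  Sum.inr (Sum.inr ⟨f, z⟩)

/-- The gluing relation. The boundary circle of the disc of a `k`-gon is divided into `k` equal arcs,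
its sides; the `j`-th side, from the corner `j` to the corner `j + 1`, is glued to the edge from
`corner f j` to `corner f (j + 1)`. -/
inductive Glue (X : PolygonalComplex V) : X.Pieces → X.Pieces → Prop
  | source (d : X.graph.Dart) : Glue X (X.edgePt d 0) (X.pt d.fst)
  | reverse (d : X.graph.Dart) (t : unitInterval) :
      Glue X (X.edgePt d t) (X.edgePt d.symm (unitInterval.symm t))
  | side (f : X.Face) (j : ZMod (X.sides f)) (t : unitInterval) (z : Metric.closedBall (0 : ℂ) 1)
      (hz : (z : ℂ) = Complex.exp
        (2 * Real.pi * Complex.I * (((j.val : ℂ) + ((t : ℝ) : ℂ)) / (X.sides f : ℂ)))) :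
      Glue X (X.facePt f z) (X.edgePt ⟨(X.corner f j, X.corner f (j + 1)), X.adj f j⟩ t)

/-- The topological space of the complex: the quotient of the pieces by the equivalence relation
generated by the gluing, with the quotient topology. -/
def Realization (X : PolygonalComplex V) : Type := Quot X.Glue

noncomputable instance (X : PolygonalComplex V) : TopologicalSpace X.Realization :=
  inferInstanceAs (TopologicalSpace (Quot X.Glue))

end PolygonalComplex

/-- The set of edges of a cyclic sequence of vertices. -/
def cycleEdges {V : Type} {k : ℕ} (w : ZMod k → V) : Set (Sym2 V) :=
  Set.range fun j => s(w j, w (j + 1))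

theorem IsSquareCycle.adj {n : ℕ} {a : Fin n → ℕ} {θ : Fin n → ℝ} {w : ZMod 4 → Tiling a θ}
    (h : IsSquareCycle w) (j : ZMod 4) : (flipGraph a θ).Adj (w j) (w (j + 1)) := by
  obtain ⟨c, d, h1, h2, -, h3, h4⟩ := h
  fin_cases j
  · exact ⟨c, h1⟩
  · exact ⟨d, h3⟩
  · exact ⟨c, h4.symm⟩
  · exact ⟨d, h2.symm⟩

theorem IsOctagonCycle.adj {n : ℕ} {a : Fin n → ℕ} {θ : Fin n → ℝ} {w : ZMod 8 → Tiling a θ}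
    (h : IsOctagonCycle w) (j : ZMod 8) : (flipGraph a θ).Adj (w j) (w (j + 1)) := by
  obtain ⟨-, σ, -, -, h⟩ := h
  obtain ⟨-, c, -, hc⟩ := h j
  exact ⟨c, hc⟩

/-- The complex `𝕏₂`: to the graph of flips one glues a square along each 4-cycle coming from two
disjoint flips and an octagon along each 8-cycle coming from a four-cell of `C`. There is one
polygon for each such cycle, a cycle being given by its set of edges; the edges of a cycle
determine its cyclic labelling up to rotation and reflection, and the choice of the labelling
does not matter for the space. -/
noncomputable def flipComplex {n : ℕ} (a : Fin n → ℕ) (θ : Fin n → ℝ) :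
    PolygonalComplex (Tiling a θ) where
  graph := flipGraph a θ
  Face := {E : Set (Sym2 (Tiling a θ)) // ∃ w : ZMod 4 → Tiling a θ,
      IsSquareCycle w ∧ cycleEdges w = E} ⊕
    {E : Set (Sym2 (Tiling a θ)) // ∃ w : ZMod 8 → Tiling a θ,
      IsOctagonCycle w ∧ cycleEdges w = E}
  sides
    | Sum.inl _ => 4
    | Sum.inr _ => 8
  sides_pos
    | Sum.inl _ => by norm_num
    | Sum.inr _ => by norm_num
  corner
    | Sum.inl E => E.2.choose
    | Sum.inr E => E.2.choose
  adj
    | Sum.inl E => E.2.choose_spec.1.adj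
    | Sum.inr E => E.2.choose_spec.1.adj

end Zonogon

/-! Simple connectivity is reduced to a vanishing statement in nonabelian cohomology. Choose a path
class from a base point to every vertex of the connected complex. Closing up each edge with these
classes gives a cochain on the edges with values in the fundamental group, and its product around
every glued polygon is trivial. If this cochain is a coboundary, the chosen classes can be corrected
so that they are compatible with all edges. Compatible classes extend over edges and discs, and then
any two paths with the same ends are homotopic (`simplyConnectedSpace_of_potential`,
`simplyConnectedSpace_of_cohomology`). It remains to show that the flip graph is non-empty and
connected, and that every group-valued cochain without holonomy around squares and octagons has a
potential.

Tilings are built by sweeping a lattice path from the right boundary of the zonogon to the left one.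
A path is a word in the directions, and replacing an ascent `j m`, `j < m`, by `m j` passes one
rhombus. A complete sweep passes the rhombi of a tiling (`Sweep.tiles`). Conversely, inside a given
tiling every path other than the left boundary has an ascent whose rhombus belongs to the tiling
(`Tiling.hasAscentRhombus`). Hence every tiling that contains the rhombi `L` of a partial sweep
arises by completing that sweep (`Tiling.exists_sweep`).

The core is an induction over partial sweeps, ending at the word `w`
(`isConn_and_exists_isPotential`): the tilings containing `L` form a connected set on which the
cochain has a potential. This set is covered by pieces, one for each ascent of `w`, consisting of
the tilings that contain also the rhombus there; the induction hypothesis applies to each piece. The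
pieces of two separated ascents meet in a connected set, and every edge between them has an end in
this set. The pieces of two overlapping ascents `j k l` are disjoint, and the edges between them are
the flips at one cube; the squares show that all these flips compare the two potentials by the same
constant (`exists_isLink_of_cube`). For three ascents the comparison constants must multiply. If the
ascents form a chain `p < q < r < s`, this is the relation given by an octagon
(`isCocycle_of_octagon`); otherwise one tiling or one flip compares all three pieces at once. So the
potentials glue. -/

section

/-! ### Simple connectivity from compatible path classes -/

open scoped unitInterval
-- Both sides are images under `F` of paths from one corner of the unit square to the opposite one,
-- and such paths are homotopic because the square is contractible.
open Path.Homotopic in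
theorem Path.Homotopic.mk_square {X : Type*} [TopologicalSpace X] (F : C(I × I, X)) {a b c d : X}
    (bot : Path a b) (right : Path b d) (left : Path a c) (top : Path c d)
    (hbot : ∀ s, F (s, 0) = bot s) (hright : ∀ t, F (1, t) = right t)
    (hleft : ∀ t, F (0, t) = left t) (htop : ∀ s, F (s, 1) = top s) :
    (Path.Homotopic.Quotient.mk bot).trans (Path.Homotopic.Quotient.mk right) = (Path.Homotopic.Quotient.mk left).trans (Path.Homotopic.Quotient.mk top) := by
  have ha : a = F (0, 0) := by rw [hbot]; simp
  have hb : b = F (1, 0) := by rw [hbot]; simp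
  have hc : c = F (0, 1) := by rw [htop]; simp
  have hd : d = F (1, 1) := by rw [htop]; simp
  subst ha hb hc hd
  let b' : Path ((0, 0) : I × I) (1, 0) := ⟨⟨fun s => (s, 0), by fun_prop⟩, rfl, rfl⟩
  let r' : Path ((1, 0) : I × I) (1, 1) := ⟨⟨fun s => (1, s), by fun_prop⟩, rfl, rfl⟩
  let l' : Path ((0, 0) : I × I) (0, 1) := ⟨⟨fun s => (0, s), by fun_prop⟩, rfl, rfl⟩
  let t' : Path ((0, 1) : I × I) (1, 1) := ⟨⟨fun s => (s, 1), by fun_prop⟩, rfl, rfl⟩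
  have : ContractibleSpace I :=
    (convex_Icc (0 : ℝ) 1).contractibleSpace ⟨0, by simp⟩
  have key : (b'.trans r').Homotopic (l'.trans t') := SimplyConnectedSpace.paths_homotopic _ _
  have key2 := key.map F
  rw [Path.map_trans, Path.map_trans] at key2
  have e1 : b'.map F.continuous = bot := by ext s; exact hbot s
  have e2 : r'.map F.continuous = right := by ext s; exact hright s
  have e3 : l'.map F.continuous = left := by ext s; exact hleft s
  have e4 : t'.map F.continuous = top := by ext s; exact htop s
  rw [e1, e2, e3, e4] at key2
  rw [← Path.Homotopic.Quotient.mk_trans, ← Path.Homotopic.Quotient.mk_trans]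
  exact Path.Homotopic.Quotient.eq.2 key2

/-- A choice of path classes from a base point to all points is compatible with the path `γ`. -/
def PathCompatible {X : Type*} [TopologicalSpace X] {x₀ : X}
    (p : ∀ x, Path.Homotopic.Quotient x₀ x) {y z : X} (γ : Path y z) : Prop :=
  (p y).trans (Path.Homotopic.Quotient.mk γ) = p z

namespace PathCompatible

open Path.Homotopic

variable {X : Type*} [TopologicalSpace X] {x₀ : X} {p : ∀ x, Path.Homotopic.Quotient x₀ x}

theorem trans_iff {x y z : X} {γ : Path x y} {δ : Path y z} (h : PathCompatible p γ) :
    PathCompatible p (γ.trans δ) ↔ PathCompatible p δ := by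
  unfold PathCompatible at *
  rw [Path.Homotopic.Quotient.mk_trans, ← Path.Homotopic.Quotient.trans_assoc, h]

theorem of_homotopic {y z : X} {γ δ : Path y z} (h : PathCompatible p γ) (e : γ.Homotopic δ) :
    PathCompatible p δ := by
  unfold PathCompatible at *
  have e' := Path.Homotopic.Quotient.eq.2 e
  rw [e'] at h
  exact h

theorem cast_iff {y z y' z' : X} {γ : Path y z} (hy : y' = y) (hz : z' = z) :
    PathCompatible p (γ.cast hy hz) ↔ PathCompatible p γ := by
  subst hy hz; rfl

theorem refl (x : X) : PathCompatible p (Path.refl x) := by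
  unfold PathCompatible
  exact Path.Homotopic.Quotient.trans_refl _

/-- Local compatibility implies compatibility. -/
theorem of_open_cover {ι : Type*} {U : ι → Set X} (hU : ∀ i, IsOpen (U i)) (hc : ∀ x, ∃ i, x ∈ U i)
    (h : ∀ i (y z : X) (γ : Path y z), (∀ t, γ t ∈ U i) → PathCompatible p γ) {y z : X}
    (γ : Path y z) : PathCompatible p γ := by
  -- The path is cut into finitely many pieces, each inside one set of the cover; compatibility is
  -- then propagated along the initial segments.
  obtain ⟨t, ht0, htm, ⟨m, hm⟩, ht⟩ := exists_monotone_Icc_subset_open_cover_unitInterval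
    (c := fun i => γ ⁻¹' U i) (fun i => (hU i).preimage γ.continuous) (by
      intro s _
      obtain ⟨i, hi⟩ := hc (γ s)
      exact Set.mem_iUnion.2 ⟨i, hi⟩)
  have main : ∀ k, PathCompatible p (γ.subpath 0 (t k)) := by
    intro k
    induction k with
    | zero => rw [ht0, Path.subpath_self]; exact refl _
    | succ k ih =>
      obtain ⟨i, hi⟩ := ht k
      have h1 : PathCompatible p (γ.subpath (t k) (t (k + 1))) := by
        refine h i _ _ _ fun s => ?_
        have : γ.subpath (t k) (t (k + 1)) s ∈ γ '' Set.Icc (t k) (t (k + 1)) := by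
          rw [← Path.range_subpath_of_le _ _ _ (htm (Nat.le_succ k))]
          exact ⟨s, rfl⟩
        obtain ⟨s', hs', e⟩ := this
        rw [← e]
        exact hi hs'
      exact of_homotopic ((trans_iff ih).2 h1) ⟨Path.Homotopy.subpathTransSubpath γ _ _ _⟩
  have := main m
  rw [hm m le_rfl, Path.subpath_zero_one] at this
  exact (cast_iff _ _).1 this

/-- Compatibility on a set contracted by the tracks `τ`. -/
theorem of_contraction {U : Set X} {τ : X → C(I, X)} {c : X} (hτ : ContinuousOn τ U)
    (h0 : ∀ y ∈ U, τ y 0 = y) (h1 : ∀ y ∈ U, τ y 1 = c)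
    (hp : ∀ y (hy : y ∈ U), PathCompatible p (⟨τ y, h0 y hy, h1 y hy⟩ : Path y c)) {y z : X}
    (γ : Path y z) (hγ : ∀ t, γ t ∈ U) : PathCompatible p γ := by
  have hy : y ∈ U := by simpa using hγ 0
  have hz : z ∈ U := by simpa using hγ 1
  have hcont : Continuous fun s => τ (γ s) := hτ.comp_continuous γ.continuous hγ
  -- The tracks of the points of `γ` fill a square whose vertical sides are the tracks of `y` and
  -- `z` and whose top side is constant at `c`.
  let F : C(I × I, X) := ContinuousMap.uncurry ⟨_, hcont⟩
  have sq := mk_square F γ (⟨τ z, h0 z hz, h1 z hz⟩ : Path z c) (⟨τ y, h0 y hy, h1 y hy⟩ : Path y c)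
    (Path.refl c) (fun s => h0 _ (hγ s)) (fun t => by simp [F]) (fun t => by simp [F])
    (fun s => h1 _ (hγ s))
  have hy' := hp y hy
  have hz' := hp z hz
  unfold PathCompatible at *
  rw [Path.Homotopic.Quotient.mk_refl, Path.Homotopic.Quotient.trans_refl] at sq
  have e : ((p y).trans (Path.Homotopic.Quotient.mk γ)).trans (Path.Homotopic.Quotient.mk (⟨τ z, h0 z hz, h1 z hz⟩ : Path z c))
      = (p z).trans (Path.Homotopic.Quotient.mk (⟨τ z, h0 z hz, h1 z hz⟩ : Path z c)) := by
    rw [Path.Homotopic.Quotient.trans_assoc, sq, hy', hz']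
  have e2 := congrArg (fun q => q.trans
    (Path.Homotopic.Quotient.mk (⟨τ z, h0 z hz, h1 z hz⟩ : Path z c)).symm) e
  simpa only [Path.Homotopic.Quotient.trans_assoc, Path.Homotopic.Quotient.trans_symm, Path.Homotopic.Quotient.trans_refl] using e2

/-- A compatible path from `x` to `y` has the class `(p x)⁻¹ · p y`, which does not depend on the
path. -/
theorem simplyConnectedSpace (h : ∀ (y z : X) (γ : Path y z), PathCompatible p γ) :
    SimplyConnectedSpace X := by
  have hpc : PathConnectedSpace X :=
    { nonempty := ⟨x₀⟩
      joined := fun x y => by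
        obtain ⟨a, -⟩ := Path.Homotopic.Quotient.mk_surjective (p x)
        obtain ⟨b, -⟩ := Path.Homotopic.Quotient.mk_surjective (p y)
        exact ⟨a.symm.trans b⟩ }
  refine simply_connected_iff_paths_homotopic.2 ⟨hpc, fun x y => ⟨fun a b => ?_⟩⟩
  induction a, b using Path.Homotopic.Quotient.ind₂ with | mk a b =>
  have ha := h _ _ a
  have hb := h _ _ b
  unfold PathCompatible at ha hb
  have e := congrArg (fun q => (p x).symm.trans q) (ha.trans hb.symm)
  simpa only [← Path.Homotopic.Quotient.trans_assoc, Path.Homotopic.Quotient.symm_trans, Path.Homotopic.Quotient.refl_trans] using e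

/-- A space covered by open sets that can be contracted to points `c i` is simply connected if there
are compatible path classes from a base point to the points `c i`. -/
theorem simplyConnectedSpace_of_contractions {ι : Type*} {U : ι → Set X}
    (hU : ∀ i, IsOpen (U i)) (hcover : ∀ x, ∃ i, x ∈ U i) {τ : ι → X → C(I, X)} {c : ι → X}
    (hτ : ∀ i, ContinuousOn (τ i) (U i)) (h0 : ∀ i, ∀ y ∈ U i, τ i y 0 = y)
    (h1 : ∀ i, ∀ y ∈ U i, τ i y 1 = c i) (hcU : ∀ i, c i ∈ U i) (hcc : ∀ i t, τ i (c i) t = c i)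
    (P : ∀ i, Path.Homotopic.Quotient x₀ (c i))
    (hQ : ∀ y, ∃ Q : Path.Homotopic.Quotient x₀ y, ∀ i (hy : y ∈ U i),
      (P i).trans (Path.Homotopic.Quotient.mk (⟨τ i y, h0 i y hy, h1 i y hy⟩ : Path y (c i))).symm
        = Q) : SimplyConnectedSpace X := by
  choose Q hQ using hQ
  -- The track of the point `c i` is constant, so the class assigned to it is `P i` itself.
  have hQc : ∀ i, Q (c i) = P i := by
    intro i
    rw [← hQ (c i) i (hcU i)]
    have : (⟨τ i (c i), h0 i _ (hcU i), h1 i _ (hcU i)⟩ : Path (c i) (c i)) = Path.refl (c i) := by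
      ext t; exact hcc i t
    rw [this, ← Path.Homotopic.Quotient.mk_symm, Path.refl_symm, Path.Homotopic.Quotient.mk_refl,
      Path.Homotopic.Quotient.trans_refl]
  refine simplyConnectedSpace (p := Q) fun y z γ => of_open_cover hU hcover (fun i y z γ hγ => ?_) γ
  refine of_contraction (hτ i) (h0 i) (h1 i) (fun y hy => ?_) γ hγ
  unfold PathCompatible
  rw [hQc, ← hQ y i hy, Path.Homotopic.Quotient.trans_assoc, Path.Homotopic.Quotient.symm_trans,
    Path.Homotopic.Quotient.trans_refl]

end PathCompatible

end

/-! ### Arcs and sectors of a regular polygon inscribed in the disc -/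

section

open scoped unitInterval
namespace Zonogon

/-- The closed unit disc. -/
abbrev Disc : Type := Metric.closedBall (0 : ℂ) 1

/-- The point of the unit circle at the fraction `s / k` of a full turn. -/
noncomputable def arc (k : ℕ) (s : ℝ) : Disc :=
  ⟨Complex.exp (2 * Real.pi * Complex.I * ((s : ℂ) / (k : ℂ))), by
    have : (2 * Real.pi * Complex.I * ((s : ℂ) / (k : ℂ))) = ((2 * Real.pi * (s / k) : ℝ) : ℂ) *
      Complex.I := by push_cast; ring
    rw [mem_closedBall_zero_iff, this, Complex.norm_exp_ofReal_mul_I]⟩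

theorem arc_coe (k : ℕ) (s : ℝ) :
    (arc k s : ℂ) = Complex.exp (((2 * Real.pi * (s / k) : ℝ) : ℂ) * Complex.I) := by
  simp only [arc]; congr 1; push_cast; ring

theorem norm_arc (k : ℕ) (s : ℝ) : ‖(arc k s : ℂ)‖ = 1 := by
  rw [arc_coe, Complex.norm_exp_ofReal_mul_I]

theorem arc_ne_zero (k : ℕ) (s : ℝ) : (arc k s : ℂ) ≠ 0 := Complex.exp_ne_zero _

theorem arc_add (k : ℕ) (s t : ℝ) : (arc k (s + t) : ℂ) = arc k s * arc k t := by
  rw [arc_coe, arc_coe, arc_coe, ← Complex.exp_add]; congr 1; push_cast; ring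

theorem continuous_arc (k : ℕ) : Continuous (arc k) := by
  unfold arc; fun_prop

theorem arc_eq_iff {k : ℕ} (hk : 0 < k) {s t : ℝ} :
    arc k s = arc k t ↔ ∃ m : ℤ, s = t + m * k := by
  have hk' : (k : ℝ) ≠ 0 := by positivity
  rw [Subtype.ext_iff, arc_coe, arc_coe, Complex.exp_eq_exp_iff_exists_int]
  refine exists_congr fun m => ?_
  have h2 : (2 * Real.pi * Complex.I : ℂ) ≠ 0 := Complex.two_pi_I_ne_zero
  have e : ((2 * Real.pi * (s / k) : ℝ) : ℂ) * Complex.I =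
      (2 * Real.pi * Complex.I) * ((s / k : ℝ) : ℂ) := by push_cast; ring
  have e' : ((2 * Real.pi * (t / k) : ℝ) : ℂ) * Complex.I + m * (2 * Real.pi * Complex.I) =
      (2 * Real.pi * Complex.I) * ((t / k + m : ℝ) : ℂ) := by push_cast; ring
  rw [e, e', mul_right_inj' h2, Complex.ofReal_inj]
  constructor
  · intro h; field_simp at h; linarith
  · intro h; rw [h]; field_simp

theorem arc_val_natCast {k : ℕ} (hk : 0 < k) (m : ℕ) (t : ℝ) :
    arc k (((m : ZMod k).val : ℝ) + t) = arc k (m + t) := by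
  rw [arc_eq_iff hk]
  refine ⟨-(m / k : ℕ), ?_⟩
  rw [ZMod.val_natCast]
  have : ((k * (m / k) + m % k : ℕ) : ℝ) = m := by rw [Nat.div_add_mod]
  push_cast at this
  rw [Int.cast_neg, Int.cast_natCast]
  linarith

/-- The open sector of points whose angle is closer than `2π / k` to that of the corner `j` of the
regular `k`-gon. -/
def sector (k : ℕ) (j : ZMod k) : Set ℂ :=
  {z | z ≠ 0 ∧ |Complex.arg (z / arc k j.val)| < 2 * Real.pi / k}

/-- Since `k ≥ 2`, the angle `2πx / k` lies strictly between `-π` and `π`, where the argument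
recovers it exactly. -/
theorem arg_div_arc {k : ℕ} (hk : 2 ≤ k) {r : ℝ} (hr : 0 < r) {a x : ℝ} (hx : |x| < 1) :
    Complex.arg (r * arc k (a + x) / arc k a) = 2 * Real.pi * (x / k) := by
  have hk' : (2 : ℝ) ≤ k := by exact_mod_cast hk
  have e : r * (arc k (a + x) : ℂ) / arc k a = r * (Complex.exp (((2 * Real.pi * (x / k) : ℝ) : ℂ) *
      Complex.I)) := by
    have := arc_ne_zero k a
    rw [arc_add, arc_coe k x]; field_simp
  rw [e, Complex.exp_mul_I]
  have : |x / k| < 1 / 2 := by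
    rw [abs_div, abs_of_pos (by linarith : (0 : ℝ) < k)]
    exact (div_lt_div_of_pos_right hx (by linarith)).trans_le
      (by apply one_div_le_one_div_of_le <;> linarith)
  rw [abs_lt] at this
  exact Complex.arg_mul_cos_add_sin_mul_I hr ⟨by nlinarith [Real.pi_pos], by nlinarith [Real.pi_pos]⟩

theorem mem_sector_iff {k : ℕ} (hk : 2 ≤ k) {j : ZMod k} {z : ℂ} :
    z ∈ sector k j ↔ z ≠ 0 ∧ ∃ x : ℝ, |x| < 1 ∧ z = ‖z‖ * arc k (j.val + x) := by
  have hk' : (0 : ℝ) < k := by positivity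
  constructor
  · rintro ⟨hz, h⟩
    refine ⟨hz, k * Complex.arg (z / arc k j.val) / (2 * Real.pi), ?_, ?_⟩
    · rw [abs_div, abs_mul, abs_of_pos hk', abs_of_pos Real.two_pi_pos, div_lt_one Real.two_pi_pos]
      rw [lt_div_iff₀ hk'] at h
      linarith
    · have e : (2 * Real.pi * (k * Complex.arg (z / arc k j.val) / (2 * Real.pi) / k) : ℝ) =
        Complex.arg (z / arc k j.val) := by field_simp
      have e2 := Complex.norm_mul_exp_arg_mul_I (z / arc k j.val)
      rw [arc_add, arc_coe k (_ / _), e]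
      rw [norm_div, norm_arc, div_one] at e2
      have := arc_ne_zero k j.val
      rw [mul_left_comm, e2]
      field_simp
  · rintro ⟨hz, x, hx, h⟩
    refine ⟨hz, ?_⟩
    rw [h, arg_div_arc hk (norm_pos_iff.2 hz) hx, abs_mul, abs_div, abs_of_pos Real.two_pi_pos,
      abs_of_pos hk', ← mul_div_assoc]
    apply div_lt_div_of_pos_right _ hk'
    nlinarith [Real.pi_pos]

theorem isOpen_sector {k : ℕ} (hk : 2 ≤ k) (j : ZMod k) : IsOpen (sector k j) := by
  rw [isOpen_iff_mem_nhds]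
  rintro z hz
  obtain ⟨hz0, hz1⟩ := hz
  have hk' : (2 : ℝ) ≤ k := by exact_mod_cast hk
  have hs : z / arc k j.val ∈ Complex.slitPlane := by
    rw [Complex.mem_slitPlane_iff_arg]
    refine ⟨fun h => ?_, div_ne_zero hz0 (arc_ne_zero _ _)⟩
    rw [h, abs_of_pos Real.pi_pos, lt_div_iff₀ (by linarith)] at hz1
    nlinarith [Real.pi_pos]
  have hc : ContinuousAt (fun w : ℂ => |Complex.arg (w / arc k j.val)|) z :=
    ((Complex.continuousAt_arg hs).comp (f := fun w : ℂ => w / arc k j.val)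
      (continuousAt_id.div_const _)).abs
  exact Filter.inter_mem (isOpen_ne.mem_nhds hz0) (hc.preimage_mem_nhds (isOpen_Iio.mem_nhds hz1))

/-- In units of `2π / k` both corners are at angular distance less than `1` from `z`, so they differ
modulo `k` by an integer of absolute value at most `1`. -/
theorem sector_inter {k : ℕ} (hk : 2 ≤ k) {i j : ZMod k} {z : ℂ} (hi : z ∈ sector k i)
    (hj : z ∈ sector k j) : i = j ∨ i = j + 1 ∨ j = i + 1 := by
  have hk0 : 0 < k := by omega
  have : NeZero k := ⟨by omega⟩
  rw [mem_sector_iff hk] at hi hj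
  obtain ⟨hz, x, hx, ex⟩ := hi
  obtain ⟨-, y, hy, ey⟩ := hj
  have e : arc k (i.val + x) = arc k (j.val + y) := by
    rw [Subtype.ext_iff]
    have : (‖z‖ : ℂ) ≠ 0 := by simpa using hz
    exact mul_left_cancel₀ this (ex.symm.trans ey)
  obtain ⟨m, hm⟩ := (arc_eq_iff hk0).1 e
  rw [abs_lt] at hx hy
  have h1 : ((i.val : ℤ) - j.val - m * k : ℤ) < 2 := by
    have : (((i.val : ℤ) - j.val - m * k : ℤ) : ℝ) < 2 := by push_cast; linarith
    exact_mod_cast this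
  have h2 : (-2 : ℤ) < ((i.val : ℤ) - j.val - m * k : ℤ) := by
    have : (-2 : ℝ) < (((i.val : ℤ) - j.val - m * k : ℤ) : ℝ) := by push_cast; linarith
    exact_mod_cast this
  have key : ((((i.val : ℤ) - j.val - m * k : ℤ)) : ZMod k) = i - j := by
    push_cast; simp
  have h3 : ((i.val : ℤ) - j.val - m * k : ℤ) = -1 ∨ ((i.val : ℤ) - j.val - m * k : ℤ) = 0 ∨
    ((i.val : ℤ) - j.val - m * k : ℤ) = 1 := by omega
  rcases h3 with h | h | h <;> rw [h] at key <;> push_cast at key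
  · right; right; rw [eq_sub_iff_add_eq] at key; rw [← key]; ring
  · left; exact (sub_eq_zero.1 key.symm)
  · right; left; rw [eq_sub_iff_add_eq] at key; rw [← key]; ring

theorem exists_mem_sector {k : ℕ} (hk : 2 ≤ k) {z : ℂ} (hz : z ≠ 0) : ∃ j, z ∈ sector k j := by
  have hk0 : 0 < k := by omega
  have hk' : (0 : ℝ) < k := by positivity
  have : NeZero k := ⟨by omega⟩
  -- `s` is the angle of `z` in units of one side; its integer part gives the corner and its
  -- fractional part the offset.
  set s : ℝ := k * Complex.arg z / (2 * Real.pi) with hs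
  refine ⟨(⌊s⌋ : ZMod k), (mem_sector_iff hk).2 ⟨hz, Int.fract s, ?_, ?_⟩⟩
  · rw [abs_of_nonneg (Int.fract_nonneg s)]; exact Int.fract_lt_one s
  · have e : arc k (((⌊s⌋ : ZMod k).val : ℝ) + Int.fract s) = arc k s := by
      rw [arc_eq_iff hk0]
      have : (((⌊s⌋ : ZMod k).val : ℤ) : ZMod k) = (⌊s⌋ : ZMod k) := by simp
      rw [ZMod.intCast_eq_intCast_iff_dvd_sub] at this
      obtain ⟨m, hm⟩ := this
      refine ⟨-m, ?_⟩
      have hm' : (⌊s⌋ : ℝ) - ((⌊s⌋ : ZMod k).val : ℝ) = k * m := by exact_mod_cast hm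
      have := Int.floor_add_fract s
      push_cast
      linarith
    rw [e, arc_coe]
    have : 2 * Real.pi * (s / k) = Complex.arg z := by rw [hs]; field_simp
    rw [this, Complex.norm_mul_exp_arg_mul_I]

/-- On a side of the polygon only the sectors of its two ends are met. This mirrors the rule by
which a point of an edge belongs to the open star of an end vertex. -/
theorem arc_mem_sector_iff {k : ℕ} (hk : 2 ≤ k) {i j : ZMod k} {t : ℝ} (h0 : 0 ≤ t) (h1 : t ≤ 1) :
    (arc k (i.val + t) : ℂ) ∈ sector k j ↔ (j = i ∧ t < 1) ∨ (j = i + 1 ∧ 0 < t) := by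
  have hk0 : 0 < k := by omega
  have : NeZero k := ⟨by omega⟩
  have base : ∀ i : ZMod k, ∀ x : ℝ, |x| < 1 → (arc k (i.val + x) : ℂ) ∈ sector k i := fun i x hx =>
    (mem_sector_iff hk).2 ⟨arc_ne_zero _ _, x, hx, by rw [norm_arc]; simp⟩
  have hsucc : arc k (i.val + t) = arc k ((i + 1 : ZMod k).val + (t - 1)) := by
    have h := arc_val_natCast hk0 (i.val + 1) (t - 1)
    push_cast at h
    rw [ZMod.natCast_zmod_val] at h
    rw [h]; congr 1; ring
  constructor
  · intro h
    obtain ⟨-, x, hx, e⟩ := (mem_sector_iff hk).1 h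
    rw [norm_arc, Complex.ofReal_one, one_mul, ← Subtype.ext_iff, arc_eq_iff hk0] at e
    obtain ⟨m, hm⟩ := e
    rw [abs_lt] at hx
    have hd : ((i.val - j.val - m * k : ℤ) : ℝ) = x - t := by push_cast; linarith
    have h3 : (-2 : ℤ) < (i.val - j.val - m * k : ℤ) := by
      have : ((-2 : ℤ) : ℝ) < ((i.val - j.val - m * k : ℤ) : ℝ) := by rw [hd]; push_cast; linarith
      exact_mod_cast this
    have h4 : (i.val - j.val - m * k : ℤ) < 1 := by
      have : ((i.val - j.val - m * k : ℤ) : ℝ) < ((1 : ℤ) : ℝ) := by rw [hd]; push_cast; linarith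
      exact_mod_cast this
    have key : ((i.val - j.val - m * k : ℤ) : ZMod k) = i - j := by push_cast; simp
    have h5 : (i.val - j.val - m * k : ℤ) = 0 ∨ (i.val - j.val - m * k : ℤ) = -1 := by omega
    rcases h5 with h5 | h5 <;> rw [h5] at key hd <;> push_cast at key hd
    · left; exact ⟨(sub_eq_zero.1 key.symm).symm, by linarith⟩
    · right; exact ⟨by rw [eq_sub_iff_add_eq] at key; rw [← key]; ring, by linarith⟩
  · rintro (⟨rfl, h⟩ | ⟨rfl, h⟩)
    · exact base _ _ (by rwa [abs_of_nonneg h0])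
    · rw [hsucc]
      exact base _ _ (by rw [abs_lt]; constructor <;> linarith)

end Zonogon

end

/-! ### Contractions of sectors, discs and edges -/

section

open scoped unitInterval
namespace Zonogon

/-- Tracks are handled as elements of `C(I, B)`, so that a contraction is one map into a function
space; its continuity is joint continuity, by currying. -/
theorem continuousOn_curry {A B : Type*} [TopologicalSpace A] [TopologicalSpace B] {s : Set A}
    {F : A → C(I, B)} (h : ContinuousOn (fun p : A × I => F p.1 p.2) (s ×ˢ Set.univ)) :
    ContinuousOn F s := by
  rw [continuousOn_iff_continuous_domRestrict]
  have h' : Continuous fun p : s × I => F p.1 p.2 := by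
    refine h.comp_continuous (f := fun p : s × I => ((p.1 : A), p.2)) (by fun_prop) fun p => ?_
    exact ⟨p.1.2, trivial⟩
  exact (ContinuousMap.curry ⟨_, h'⟩).continuous

theorem div_arc_mem_slitPlane {k : ℕ} (hk : 2 ≤ k) {j : ZMod k} {z : ℂ} (hz : z ∈ sector k j) :
    z / arc k j.val ∈ Complex.slitPlane := by
  have hk' : (2 : ℝ) ≤ k := by exact_mod_cast hk
  obtain ⟨hz0, hz1⟩ := hz
  rw [Complex.mem_slitPlane_iff_arg]
  refine ⟨fun h => ?_, div_ne_zero hz0 (arc_ne_zero _ _)⟩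
  rw [h, abs_of_pos Real.pi_pos, lt_div_iff₀ (by linarith)] at hz1
  nlinarith [Real.pi_pos]

/-- The track of a point of the disc under the contraction of a sector to its corner, linear in
logarithmic polar coordinates. -/
noncomputable def toCorner (k : ℕ) (j : ZMod k) (z : Disc) : C(I, Disc) where
  toFun t := ⟨arc k j.val * Complex.exp ((1 - t : ℝ) * Complex.log (z / arc k j.val)), by
    rw [mem_closedBall_zero_iff, norm_mul, norm_arc, one_mul, Complex.norm_exp,
      Real.exp_le_one_iff, Complex.re_ofReal_mul, Complex.log_re, norm_div, norm_arc, div_one]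
    refine mul_nonpos_of_nonneg_of_nonpos (by linarith [t.2.2]) (Real.log_nonpos (norm_nonneg _) ?_)
    exact mem_closedBall_zero_iff.1 z.2⟩
  continuous_toFun := by fun_prop

theorem toCorner_zero {k : ℕ} {j : ZMod k} {z : Disc} (hz : (z : ℂ) ≠ 0) : toCorner k j z 0 = z := by
  ext
  have := arc_ne_zero k j.val
  simp only [toCorner, ContinuousMap.coe_mk, Set.Icc.coe_zero, sub_zero, Complex.ofReal_one, one_mul]
  rw [Complex.exp_log (div_ne_zero hz this)]
  field_simp

theorem toCorner_one {k : ℕ} {j : ZMod k} {z : Disc} : toCorner k j z 1 = arc k j.val := by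
  ext
  simp [toCorner]

/-- The contraction preserves the boundary circle and is linear in the angle there. Hence it agrees
with the linear contraction of an edge to one of its ends, as the gluing requires. -/
theorem toCorner_arc {k : ℕ} (hk : 2 ≤ k) {j : ZMod k} {x : ℝ} (hx : |x| < 1) (t : I) :
    toCorner k j (arc k (j.val + x)) t = arc k (j.val + (1 - t) * x) := by
  ext
  have h := arg_div_arc hk one_pos (a := j.val) hx
  rw [Complex.ofReal_one, one_mul] at h
  have hl : Complex.log ((arc k (j.val + x) : ℂ) / arc k j.val) =
      ((2 * Real.pi * (x / k) : ℝ) : ℂ) * Complex.I := by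
    rw [Complex.log, h, norm_div, norm_arc, norm_arc]; simp
  simp only [toCorner, ContinuousMap.coe_mk]
  rw [hl, arc_add, arc_coe k ((1 - t) * x)]
  congr 2
  push_cast; ring

theorem continuousOn_toCorner {k : ℕ} (hk : 2 ≤ k) (j : ZMod k) :
    ContinuousOn (toCorner k j) {z | (z : ℂ) ∈ sector k j} := by
  refine continuousOn_curry ?_
  rw [Topology.IsInducing.subtypeVal.continuousOn_iff]
  have : ContinuousOn (fun p : Disc × I => Complex.log (p.1 / arc k j.val))
      ({z : Disc | (z : ℂ) ∈ sector k j} ×ˢ Set.univ) := by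
    refine ContinuousOn.clog (by fun_prop) fun p hp => div_arc_mem_slitPlane hk hp.1
  unfold toCorner
  simp only [ContinuousMap.coe_mk, Function.comp_def]
  have h2 : Continuous fun p : Disc × I => ((1 - p.2 : ℝ) : ℂ) := by fun_prop
  exact continuousOn_const.mul (Complex.continuous_exp.comp_continuousOn (h2.continuousOn.mul this))

/-- The radial track of a point of the disc to the centre. -/
noncomputable def toCenter (z : Disc) : C(I, Disc) where
  toFun t := ⟨(1 - t : ℝ) * z, by
    have h := mem_closedBall_zero_iff.1 z.2
    rw [mem_closedBall_zero_iff, norm_mul, Complex.norm_real, Real.norm_of_nonneg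
      (by linarith [t.2.2])]
    nlinarith [t.2.1, t.2.2, norm_nonneg (z : ℂ)]⟩
  continuous_toFun := by fun_prop

theorem continuous_toCenter : Continuous toCenter := by
  rw [← continuousOn_univ]
  refine continuousOn_curry ?_
  rw [Topology.IsInducing.subtypeVal.continuousOn_iff]
  unfold toCenter
  simp only [ContinuousMap.coe_mk, Function.comp_def]
  fun_prop

/-- The track `t (1 - s)` from `t` to `0`. -/
noncomputable def toSource (t : I) : C(I, I) := ⟨fun s => t * σ s, by fun_prop⟩

/-- The track from `t` to `1` symmetric to `toSource`. -/
noncomputable def toTarget (t : I) : C(I, I) := ⟨fun s => σ (σ t * σ s), by fun_prop⟩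

theorem continuous_toSource : Continuous toSource := by
  rw [← continuousOn_univ]
  refine continuousOn_curry (Continuous.continuousOn ?_)
  simp only [toSource, ContinuousMap.coe_mk]; fun_prop

theorem continuous_toTarget : Continuous toTarget := by
  rw [← continuousOn_univ]
  refine continuousOn_curry (Continuous.continuousOn ?_)
  simp only [toTarget, ContinuousMap.coe_mk]; fun_prop

/-! ### Pieces and characteristic maps of a polygonal complex -/

namespace PolygonalComplex

variable {V : Type} (X : PolygonalComplex V)

/-- The quotient map. -/
def proj (x : X.Pieces) : X.Realization := Quot.mk _ x

theorem isQuotientMap_proj : Topology.IsQuotientMap X.proj := isQuotientMap_quot_mk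

theorem proj_surjective : Function.Surjective X.proj := Quot.mk_surjective

/-- The disjoint union underlying the pieces. -/
abbrev PieceSum : Type :=
  (Σ _ : V, Unit) ⊕ (Σ _ : X.graph.Dart, I) ⊕ (Σ _ : X.Face, Disc)

theorem isOpenEmbedding_pt (v : V) : Topology.IsOpenEmbedding fun _ : Unit => X.pt v := by
  have h1 : Topology.IsOpenEmbedding ((fun u => ⟨v, u⟩) : Unit → Σ _ : V, Unit) :=
    @Topology.IsOpenEmbedding.sigmaMk V (fun _ => Unit) _ v
  have h2 : Topology.IsOpenEmbedding (fun u => Sum.inl ⟨v, u⟩ : Unit → X.PieceSum) :=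
    Topology.IsOpenEmbedding.inl.comp h1
  exact h2

theorem isOpenEmbedding_edgePt (d : X.graph.Dart) : Topology.IsOpenEmbedding (X.edgePt d) := by
  have h1 : Topology.IsOpenEmbedding ((fun u => ⟨d, u⟩) : I → Σ _ : X.graph.Dart, I) :=
    @Topology.IsOpenEmbedding.sigmaMk X.graph.Dart (fun _ => I) _ d
  have h2 : Topology.IsOpenEmbedding (fun u => Sum.inr (Sum.inl ⟨d, u⟩) : I → X.PieceSum) :=
    Topology.IsOpenEmbedding.inr.comp (Topology.IsOpenEmbedding.inl.comp h1)
  exact h2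

theorem isOpenEmbedding_facePt (f : X.Face) : Topology.IsOpenEmbedding (X.facePt f) := by
  have h1 : Topology.IsOpenEmbedding ((fun u => ⟨f, u⟩) : Disc → Σ _ : X.Face, Disc) :=
    @Topology.IsOpenEmbedding.sigmaMk X.Face (fun _ => Disc) _ f
  have h2 : Topology.IsOpenEmbedding (fun u => Sum.inr (Sum.inr ⟨f, u⟩) : Disc → X.PieceSum) :=
    Topology.IsOpenEmbedding.inr.comp (Topology.IsOpenEmbedding.inr.comp h1)
  exact h2

variable {X} in
@[elab_as_elim]
theorem piece_cases {C : X.Pieces → Prop} (h0 : ∀ v, C (X.pt v)) (h1 : ∀ d t, C (X.edgePt d t))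
    (h2 : ∀ f z, C (X.facePt f z)) (x : X.Pieces) : C x := by
  rcases x with ⟨v, u⟩ | ⟨d, t⟩ | ⟨f, z⟩
  · exact h0 v
  · exact h1 d t
  · exact h2 f z

/-- The vertices are isolated points of the disjoint union, so only edges and discs impose a
condition. -/
theorem isOpen_pieces {s : Set X.Pieces} (h1 : ∀ d, IsOpen (X.edgePt d ⁻¹' s))
    (h2 : ∀ f, IsOpen (X.facePt f ⁻¹' s)) : IsOpen s := by
  rw [isOpen_iff_mem_nhds]
  intro x
  induction x using piece_cases with
  | h0 v =>
    intro hv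
    rw [← (X.isOpenEmbedding_pt v).map_nhds_eq ()]
    simp only [nhds_discrete, Filter.map_pure, Filter.mem_pure]
    exact hv
  | h1 d t =>
    intro ht
    rw [← (X.isOpenEmbedding_edgePt d).map_nhds_eq t]
    exact (h1 d).mem_nhds ht
  | h2 f z =>
    intro hz
    rw [← (X.isOpenEmbedding_facePt f).map_nhds_eq z]
    exact (h2 f).mem_nhds hz

theorem continuousOn_pieces {Z : Type*} [TopologicalSpace Z] {s : Set X.Pieces} (hs : IsOpen s)
    {g : X.Pieces → Z} (h1 : ∀ d, ContinuousOn (g ∘ X.edgePt d) (X.edgePt d ⁻¹' s))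
    (h2 : ∀ f, ContinuousOn (g ∘ X.facePt f) (X.facePt f ⁻¹' s)) : ContinuousOn g s := by
  intro x
  induction x using piece_cases with
  | h0 v =>
    intro hv
    refine ContinuousAt.continuousWithinAt ?_
    refine ((X.isOpenEmbedding_pt v).continuousAt_iff (x := ())).1 ?_
    exact continuous_of_discreteTopology.continuousAt
  | h1 d t =>
    intro ht
    refine ContinuousAt.continuousWithinAt ?_
    refine ((X.isOpenEmbedding_edgePt d).continuousAt_iff (x := t)).1 ?_
    exact (h1 d).continuousAt ((hs.preimage (X.isOpenEmbedding_edgePt d).continuous).mem_nhds ht)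
  | h2 f z =>
    intro hz
    refine ContinuousAt.continuousWithinAt ?_
    refine ((X.isOpenEmbedding_facePt f).continuousAt_iff (x := z)).1 ?_
    exact (h2 f).continuousAt ((hs.preimage (X.isOpenEmbedding_facePt f).continuous).mem_nhds hz)

/-- The vertex `v` of the realization. -/
def vertex (v : V) : X.Realization := X.proj (X.pt v)

/-- The characteristic map of an oriented edge. -/
def edgeMap (d : X.graph.Dart) : C(I, X.Realization) :=
  ⟨fun t => X.proj (X.edgePt d t),
    X.isQuotientMap_proj.continuous.comp (X.isOpenEmbedding_edgePt d).continuous⟩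

/-- The characteristic map of a polygon. -/
def faceMap (f : X.Face) : C(Disc, X.Realization) :=
  ⟨fun t => X.proj (X.facePt f t),
    X.isQuotientMap_proj.continuous.comp (X.isOpenEmbedding_facePt f).continuous⟩

theorem edgeMap_zero (d : X.graph.Dart) : X.edgeMap d 0 = X.vertex d.fst :=
  Quot.sound (Glue.source d)

theorem edgeMap_symm (d : X.graph.Dart) (t : I) : X.edgeMap d t = X.edgeMap d.symm (σ t) :=
  Quot.sound (Glue.reverse d t)

theorem edgeMap_one (d : X.graph.Dart) : X.edgeMap d 1 = X.vertex d.snd := by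
  rw [edgeMap_symm, unitInterval.symm_one, edgeMap_zero]; rfl

/-- The dart of a side of a polygon. -/
def sideDart (f : X.Face) (j : ZMod (X.sides f)) : X.graph.Dart :=
  ⟨(X.corner f j, X.corner f (j + 1)), X.adj f j⟩

theorem faceMap_arc (f : X.Face) (j : ZMod (X.sides f)) (t : I) :
    X.faceMap f (arc (X.sides f) (j.val + t)) = X.edgeMap (X.sideDart f j) t :=
  Quot.sound (Glue.side f j t _ (by simp only [arc]; push_cast; rfl))

theorem corner_ne (f : X.Face) (j : ZMod (X.sides f)) : X.corner f j ≠ X.corner f (j + 1) :=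
  (X.adj f j).ne

/-- A polygon with one side would be glued along a loop of a simple graph. -/
theorem two_le_sides (f : X.Face) : 2 ≤ X.sides f := by
  by_contra h
  have h1 : X.sides f = 1 := by have := X.sides_pos f; omega
  have : Subsingleton (ZMod (X.sides f)) := by rw [h1]; infer_instance
  exact X.corner_ne f 0 (congrArg _ (Subsingleton.elim _ _))

theorem faceMap_corner (f : X.Face) (j : ZMod (X.sides f)) :
    X.faceMap f (arc (X.sides f) j.val) = X.vertex (X.corner f j) := by
  have := X.faceMap_arc f j 0
  rw [Set.Icc.coe_zero, add_zero] at this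
  rw [this, edgeMap_zero]; rfl

end PolygonalComplex
end Zonogon

end

/-! ### Transport of path classes and contraction of open stars and discs -/

section

open scoped unitInterval
namespace Zonogon

section Transport

variable {B R : Type*} [TopologicalSpace B] [TopologicalSpace R] [SimplyConnectedSpace B] {x₀ : R}
  (F : C(B, R)) {b₀ : B} (q₀ : Path.Homotopic.Quotient x₀ (F b₀))

/-- Extension of a path class to `F b₀` to path classes to all points `F b`. -/
noncomputable def transport (b : B) : Path.Homotopic.Quotient x₀ (F b) :=
  q₀.trans (Path.Homotopic.Quotient.mk ((PathConnectedSpace.somePath b₀ b).map F.continuous))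

/-- The auxiliary path from `b₀` is irrelevant because paths in the simply connected space `B` with
the same ends are homotopic. -/
theorem transport_trans {b b' : B} (δ : Path b b') :
    (transport F q₀ b).trans (Path.Homotopic.Quotient.mk (δ.map F.continuous)) =
      transport F q₀ b' := by
  unfold transport
  rw [Path.Homotopic.Quotient.trans_assoc, ← Path.Homotopic.Quotient.mk_trans, ← Path.map_trans]
  congr 1
  exact Path.Homotopic.Quotient.eq.2 ((SimplyConnectedSpace.paths_homotopic _ _).map F)

theorem transport_self : transport F q₀ b₀ = q₀ := by
  unfold transport
  have : (PathConnectedSpace.somePath b₀ b₀).Homotopic (Path.refl b₀) :=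
    SimplyConnectedSpace.paths_homotopic _ _
  rw [Path.Homotopic.Quotient.eq.2 (this.map F)]
  exact Path.Homotopic.Quotient.trans_refl _

/-- This serves for contraction tracks: `γ` is a track that lifts to `B`, and going to the apex `c`
and back along `γ` gives the transported class. The end `c` is kept apart from `F b'` since corners
are equal to vertices only after gluing. -/
theorem trans_symm_eq_transport {b b' : B} {c : R} (hc : F b' = c) (γ : Path (F b) c)
    (δ : Path b b') (hγ : ∀ t, γ t = F (δ t)) (P : Path.Homotopic.Quotient x₀ c)
    (hP : transport F q₀ b' = P.cast rfl hc) :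
    P.trans (Path.Homotopic.Quotient.mk γ).symm = transport F q₀ b := by
  subst hc
  have e : γ = δ.map F.continuous := by ext t; exact hγ t
  rw [Path.Homotopic.Quotient.cast_rfl_rfl] at hP
  rw [← hP, e, ← transport_trans F q₀ δ, Path.Homotopic.Quotient.trans_assoc,
    Path.Homotopic.Quotient.trans_symm, Path.Homotopic.Quotient.trans_refl]

theorem transport_eq_cast {b b' : B} (δ : Path b b') {c c' : R} (hc : F b = c) (hc' : F b' = c')
    (e : Path c c') (he : ∀ t, e t = F (δ t)) {A : Path.Homotopic.Quotient x₀ c}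
    {A' : Path.Homotopic.Quotient x₀ c'} (hA : A.trans (Path.Homotopic.Quotient.mk e) = A')
    (h : transport F q₀ b = A.cast rfl hc) : transport F q₀ b' = A'.cast rfl hc' := by
  subst hc hc'
  have e : e = δ.map F.continuous := by ext t; exact he t
  rw [Path.Homotopic.Quotient.cast_rfl_rfl] at h ⊢
  rw [← hA, ← h, e, transport_trans]

end Transport

namespace PolygonalComplex

variable {V : Type} (X : PolygonalComplex V)

open Classical in
/-- The tracks of the contraction of the open star of `v`. -/
noncomputable def starTrack (v : V) : X.PieceSum → Option C(I, X.Realization)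
  | .inl p => if p.1 = v then some (ContinuousMap.const I (X.vertex v)) else none
  | .inr (.inl p) =>
    if p.1.fst = v ∧ p.2 ≠ 1 then some ((X.edgeMap p.1).comp (toSource p.2))
    else if p.1.snd = v ∧ p.2 ≠ 0 then some ((X.edgeMap p.1).comp (toTarget p.2)) else none
  | .inr (.inr p) =>
    if h : ∃ j, X.corner p.1 j = v ∧ (p.2 : ℂ) ∈ sector (X.sides p.1) j then
      some ((X.faceMap p.1).comp (toCorner (X.sides p.1) h.choose p.2)) else none

open Classical in
theorem starTrack_pt (v u : V) : X.starTrack v (X.pt u) =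
    if u = v then some (ContinuousMap.const I (X.vertex v)) else none := rfl

open Classical in
theorem starTrack_edgePt (v : V) (d : X.graph.Dart) (t : I) : X.starTrack v (X.edgePt d t) =
    if d.fst = v ∧ t ≠ 1 then some ((X.edgeMap d).comp (toSource t))
    else if d.snd = v ∧ t ≠ 0 then some ((X.edgeMap d).comp (toTarget t)) else none := rfl

/-- The chosen corner is the only possible one: the sectors of distinct corners meet only if the
corners are neighbours, and neighbouring corners are different vertices. -/
theorem starTrack_facePt {v : V} {f : X.Face} {j : ZMod (X.sides f)} (hj : X.corner f j = v)
    {z : Disc} (hz : (z : ℂ) ∈ sector (X.sides f) j) : X.starTrack v (X.facePt f z) =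
      some ((X.faceMap f).comp (toCorner (X.sides f) j z)) := by
  have h : ∃ j, X.corner f j = v ∧ (z : ℂ) ∈ sector (X.sides f) j := ⟨j, hj, hz⟩
  have hc := h.choose_spec
  have e : h.choose = j := by
    rcases sector_inter (X.two_le_sides f) hc.2 hz with e | e | e
    · exact e
    · exact absurd (hj.trans (hc.1.symm.trans (congrArg _ e))) (X.corner_ne f j)
    · exact absurd (hc.1.trans (hj.symm.trans (congrArg _ e))) (X.corner_ne f _)
  refine (dif_pos h).trans ?_
  change some ((X.faceMap f).comp (toCorner (X.sides f) h.choose z)) = _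
  rw [e]

theorem starTrack_facePt_eq_none {v : V} {f : X.Face} {z : Disc}
    (h : ¬ ∃ j, X.corner f j = v ∧ (z : ℂ) ∈ sector (X.sides f) j) :
    X.starTrack v (X.facePt f z) = none :=
  dif_neg h

/-- The partial tracks descend to the quotient. Reversing an edge exchanges `toSource` and
`toTarget`, and on the sides of a polygon `toCorner` restricts to these two. -/
theorem starTrack_glue (v : V) {x y : X.Pieces} (h : X.Glue x y) :
    X.starTrack v x = X.starTrack v y := by
  induction h with
  | source d =>
    rw [starTrack_edgePt, starTrack_pt]
    by_cases h : d.fst = v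
    · rw [if_pos ⟨h, by simp⟩, if_pos h]
      congr 1
      ext s
      simp only [ContinuousMap.comp_apply, toSource, ContinuousMap.coe_mk, zero_mul,
        ContinuousMap.const_apply]
      rw [edgeMap_zero, h]
    · rw [if_neg (by tauto), if_neg (by tauto), if_neg h]
  | reverse d t =>
    have hne : d.fst ≠ d.snd := d.adj.ne
    rw [starTrack_edgePt, starTrack_edgePt]
    have e1 : (X.edgeMap d).comp (toSource t) = (X.edgeMap d.symm).comp (toTarget (σ t)) := by
      ext s
      simp only [ContinuousMap.comp_apply, toSource, toTarget, ContinuousMap.coe_mk,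
        unitInterval.symm_symm]
      rw [edgeMap_symm]
    have e2 : (X.edgeMap d).comp (toTarget t) = (X.edgeMap d.symm).comp (toSource (σ t)) := by
      ext s
      simp only [ContinuousMap.comp_apply, toSource, toTarget, ContinuousMap.coe_mk]
      rw [edgeMap_symm, unitInterval.symm_symm]
    have s1 : d.symm.fst = d.snd := rfl
    have s2 : d.symm.snd = d.fst := rfl
    rw [s1, s2, e1, e2]
    simp only [ne_eq, unitInterval.symm_eq_zero, unitInterval.symm_eq_one]
    by_cases hf : d.fst = v
    · have : d.snd ≠ v := fun h => hne (hf.trans h.symm)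
      by_cases ht : t = 1 <;> simp [hf, this, ht]
    · by_cases hs : d.snd = v
      · by_cases ht : t = 0 <;> simp [hf, hs, ht]
      · simp [hf, hs]
  | side f j t z hz =>
    have hk := X.two_le_sides f
    have hk0 : 0 < X.sides f := X.sides_pos f
    have hz' : z = arc (X.sides f) (j.val + t) := by
      ext; rw [hz]; simp only [arc]; push_cast; rfl
    have hm : ∀ i, (z : ℂ) ∈ sector (X.sides f) i ↔
        (i = j ∧ (t : ℝ) < 1) ∨ (i = j + 1 ∧ 0 < (t : ℝ)) := fun i => by
      rw [hz']; exact arc_mem_sector_iff hk t.2.1 t.2.2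
    have hd1 : (X.sideDart f j).fst = X.corner f j := rfl
    have hd2 : (X.sideDart f j).snd = X.corner f (j + 1) := rfl
    change _ = X.starTrack v (X.edgePt (X.sideDart f j) t)
    rw [starTrack_edgePt, hd1, hd2]
    have ht1 : t ≠ 1 ↔ (t : ℝ) < 1 := by
      rw [← unitInterval.lt_one_iff_ne_one, ← Subtype.coe_lt_coe]; rfl
    have ht0 : t ≠ 0 ↔ 0 < (t : ℝ) := by
      rw [← unitInterval.pos_iff_ne_zero, ← Subtype.coe_lt_coe]; rfl
    by_cases h : X.corner f j = v ∧ t ≠ 1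
    · rw [if_pos h, X.starTrack_facePt h.1 ((hm j).2 (Or.inl ⟨rfl, ht1.1 h.2⟩))]
      congr 1
      ext s
      simp only [ContinuousMap.comp_apply, toSource, ContinuousMap.coe_mk]
      rw [hz', toCorner_arc hk (by rw [abs_of_nonneg t.2.1]; exact ht1.1 h.2), ← faceMap_arc]
      congr 3
      simp only [Set.Icc.coe_mul, unitInterval.coe_symm_eq]; ring
    · rw [if_neg h]
      by_cases h' : X.corner f (j + 1) = v ∧ t ≠ 0
      · rw [if_pos h', X.starTrack_facePt h'.1 ((hm (j + 1)).2 (Or.inr ⟨rfl, ht0.1 h'.2⟩))]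
        congr 1
        ext s
        simp only [ContinuousMap.comp_apply, toTarget, ContinuousMap.coe_mk]
        have : NeZero (X.sides f) := ⟨by omega⟩
        have hs : ∀ x : ℝ, arc (X.sides f) (j.val + x) =
            arc (X.sides f) ((j + 1 : ZMod (X.sides f)).val + (x - 1)) := by
          intro x
          have h := arc_val_natCast hk0 (j.val + 1) (x - 1)
          push_cast at h
          rw [ZMod.natCast_zmod_val] at h
          rw [h]; congr 1; ring
        rw [hz', hs, toCorner_arc hk (by
          rw [abs_lt]; constructor <;> linarith [ht0.1 h'.2, t.2.2]), ← faceMap_arc, hs]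
        congr 3
        simp only [Set.Icc.coe_mul, unitInterval.coe_symm_eq]; ring
      · rw [if_neg h']
        refine X.starTrack_facePt_eq_none ?_
        rintro ⟨i, hi, hzi⟩
        rcases (hm i).1 hzi with ⟨rfl, h3⟩ | ⟨rfl, h3⟩
        · exact h ⟨hi, ht1.2 h3⟩
        · exact h' ⟨hi, ht0.2 h3⟩

open Classical in
/-- The tracks of the contraction of the open disc of `f`. -/
noncomputable def centerTrack (f : X.Face) : X.PieceSum → Option C(I, X.Realization)
  | .inl _ => none
  | .inr (.inl _) => none
  | .inr (.inr p) =>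
    if p.1 = f ∧ ‖(p.2 : ℂ)‖ < 1 then some ((X.faceMap p.1).comp (toCenter p.2)) else none

open Classical in
theorem centerTrack_facePt (f g : X.Face) (z : Disc) : X.centerTrack f (X.facePt g z) =
    if g = f ∧ ‖(z : ℂ)‖ < 1 then some ((X.faceMap g).comp (toCenter z)) else none := rfl

theorem centerTrack_edgePt (f : X.Face) (d : X.graph.Dart) (t : I) :
    X.centerTrack f (X.edgePt d t) = none := rfl

/-- Only boundary points of a disc are glued, and these have no track to the centre. -/
theorem centerTrack_glue (f : X.Face) {x y : X.Pieces} (h : X.Glue x y) :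
    X.centerTrack f x = X.centerTrack f y := by
  induction h with
  | source d => rfl
  | reverse d t => rfl
  | side g j t z hz =>
    have hz' : z = arc (X.sides g) (j.val + t) := by
      ext; rw [hz]; simp only [arc]; push_cast; rfl
    rw [centerTrack_facePt, centerTrack_edgePt, if_neg]
    rw [hz', norm_arc]
    simp

end PolygonalComplex
end Zonogon

end

/-! ### Simple connectivity from a potential of path classes -/

section

open scoped unitInterval
namespace Zonogon
namespace PolygonalComplex

variable {V : Type} (X : PolygonalComplex V)

theorem isSome_starTrack_edgePt {v : V} {d : X.graph.Dart} {t : I} :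
    (X.starTrack v (X.edgePt d t)).isSome ↔ (d.fst = v ∧ t ≠ 1) ∨ (d.snd = v ∧ t ≠ 0) := by
  rw [starTrack_edgePt]
  split_ifs with h1 h2
  · exact iff_of_true rfl (Or.inl h1)
  · exact iff_of_true rfl (Or.inr h2)
  · exact iff_of_false (by simp) (by tauto)

theorem isSome_starTrack_facePt {v : V} {f : X.Face} {z : Disc} :
    (X.starTrack v (X.facePt f z)).isSome ↔
      ∃ j, X.corner f j = v ∧ (z : ℂ) ∈ sector (X.sides f) j := by
  constructor
  · intro h; by_contra hc; rw [X.starTrack_facePt_eq_none hc] at h; simp at h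
  · rintro ⟨j, hj, hz⟩; rw [X.starTrack_facePt hj hz]; rfl

/-- The tracks of the contractions of the open vertex stars and of the open polygons. -/
noncomputable def track : V ⊕ X.Face → X.Realization → Option C(I, X.Realization)
  | .inl v => Quot.lift (X.starTrack v) fun _ _ => X.starTrack_glue v
  | .inr f => Quot.lift (X.centerTrack f) fun _ _ => X.centerTrack_glue f

theorem track_inl (v : V) (x : X.Pieces) : X.track (.inl v) (X.proj x) = X.starTrack v x := rfl

theorem track_inr (f : X.Face) (x : X.Pieces) :
    X.track (.inr f) (X.proj x) = X.centerTrack f x := rfl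

/-- The open vertex stars and the open polygons. -/
def region (i : V ⊕ X.Face) : Set X.Realization := {y | (X.track i y).isSome}

theorem isOpen_region (i : V ⊕ X.Face) : IsOpen (X.region i) := by
  rw [← X.isQuotientMap_proj.isOpen_preimage]
  rcases i with v | f
  · refine X.isOpen_pieces (fun d => ?_) fun f => ?_
    · have : X.edgePt d ⁻¹' (X.proj ⁻¹' X.region (.inl v)) =
          {t | d.fst = v ∧ t ≠ 1} ∪ {t | d.snd = v ∧ t ≠ 0} := by
        ext t; exact X.isSome_starTrack_edgePt
      rw [this]
      exact (isOpen_const.and isOpen_ne).union (isOpen_const.and isOpen_ne)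
    · have : X.facePt f ⁻¹' (X.proj ⁻¹' X.region (.inl v)) =
          ⋃ j, {z : Disc | X.corner f j = v ∧ (z : ℂ) ∈ sector (X.sides f) j} := by
        ext z; rw [Set.mem_iUnion]; exact X.isSome_starTrack_facePt
      rw [this]
      exact isOpen_iUnion fun j => isOpen_const.and
        ((isOpen_sector (X.two_le_sides f) j).preimage continuous_subtype_val)
  · refine X.isOpen_pieces (fun d => ?_) fun g => ?_
    · have : X.edgePt d ⁻¹' (X.proj ⁻¹' X.region (.inr f)) = ∅ := by
        ext t; exact ⟨fun h => absurd h (by simp [region, track_inr, centerTrack_edgePt]), False.elim⟩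
      rw [this]
      exact isOpen_empty
    · have : X.facePt g ⁻¹' (X.proj ⁻¹' X.region (.inr f)) = 
          {z : Disc | g = f ∧ ‖(z : ℂ)‖ < 1} := by
        ext z
        change (X.centerTrack f (X.facePt g z)).isSome ↔ g = f ∧ ‖(z : ℂ)‖ < 1
        rw [centerTrack_facePt]
        split_ifs with h <;> simp [h]
      rw [this]
      exact isOpen_const.and (isOpen_lt (by fun_prop) continuous_const)

/-- `track`, extended by constant tracks. -/
noncomputable def fullTrack (i : V ⊕ X.Face) (y : X.Realization) : C(I, X.Realization) :=
  (X.track i y).getD (ContinuousMap.const I y)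

theorem continuousOn_fullTrack (i : V ⊕ X.Face) : ContinuousOn (X.fullTrack i) (X.region i) := by
  rw [X.isQuotientMap_proj.continuousOn_isOpen_iff (X.isOpen_region i)]
  have ho := (X.isOpen_region i).preimage X.isQuotientMap_proj.continuous
  rcases i with v | f
  · refine X.continuousOn_pieces ho (fun d t ht => ?_) fun f z hz => ?_
    · refine ContinuousAt.continuousWithinAt ?_
      have hpost := ContinuousMap.continuous_postcomp (X := I) (X.edgeMap d)
      rcases X.isSome_starTrack_edgePt.1 ht with h | h
      · refine ContinuousAt.congr (f := fun t => (X.edgeMap d).comp (toSource t))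
          (hpost.comp continuous_toSource).continuousAt ?_
        filter_upwards [isOpen_ne.mem_nhds h.2] with s hs
        simp only [Function.comp_apply, fullTrack, track_inl]
        rw [starTrack_edgePt, if_pos ⟨h.1, hs⟩]; rfl
      · refine ContinuousAt.congr (f := fun t => (X.edgeMap d).comp (toTarget t))
          (hpost.comp continuous_toTarget).continuousAt ?_
        filter_upwards [isOpen_ne.mem_nhds h.2] with s hs
        simp only [Function.comp_apply, fullTrack, track_inl]
        rw [starTrack_edgePt, if_neg, if_pos ⟨h.1, hs⟩]; · rfl
        rintro ⟨h1, -⟩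
        exact d.adj.ne (h1.trans h.1.symm)
    · refine ContinuousAt.continuousWithinAt ?_
      have hpost := ContinuousMap.continuous_postcomp (X := I) (X.faceMap f)
      obtain ⟨j, hj, hzj⟩ := X.isSome_starTrack_facePt.1 hz
      have hn : {z : Disc | (z : ℂ) ∈ sector (X.sides f) j} ∈ nhds z :=
        ((isOpen_sector (X.two_le_sides f) j).preimage continuous_subtype_val).mem_nhds hzj
      refine ContinuousAt.congr (f := fun z => (X.faceMap f).comp (toCorner (X.sides f) j z))
        (hpost.continuousAt.comp ((continuousOn_toCorner (X.two_le_sides f) j).continuousAt hn)) ?_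
      filter_upwards [hn] with s hs
      simp only [Function.comp_apply, fullTrack, track_inl]
      rw [X.starTrack_facePt hj hs]; rfl
  · refine X.continuousOn_pieces ho (fun d t ht => ?_) fun g z hz => ?_
    · exact absurd ht (by simp [region, track_inr, centerTrack_edgePt])
    · refine ContinuousAt.continuousWithinAt ?_
      have hpost := ContinuousMap.continuous_postcomp (X := I) (X.faceMap g)
      have h : g = f ∧ ‖(z : ℂ)‖ < 1 := by
        by_contra h
        simp [region, track_inr, centerTrack_facePt, h] at hz
      refine ContinuousAt.congr (f := fun z => (X.faceMap g).comp (toCenter z))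
        (hpost.comp continuous_toCenter).continuousAt ?_
      have hn : {z : Disc | ‖(z : ℂ)‖ < 1} ∈ nhds z :=
        (isOpen_lt (by fun_prop) continuous_const).mem_nhds h.2
      filter_upwards [hn] with s hs
      simp only [Function.comp_apply, fullTrack, track_inr]
      rw [centerTrack_facePt, if_pos ⟨h.1, hs⟩]; rfl

theorem exists_mem_region (y : X.Realization) : ∃ i, y ∈ X.region i := by
  obtain ⟨x, rfl⟩ := X.proj_surjective y
  induction x using piece_cases with
  | h0 v => exact ⟨.inl v, by simp [region, track_inl, starTrack_pt]⟩
  | h1 d t =>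
    by_cases ht : t = 1
    · exact ⟨.inl d.snd, X.isSome_starTrack_edgePt.2 (Or.inr ⟨rfl, by simp [ht]⟩)⟩
    · exact ⟨.inl d.fst, X.isSome_starTrack_edgePt.2 (Or.inl ⟨rfl, ht⟩)⟩
  | h2 f z =>
    by_cases hz : (z : ℂ) = 0
    · exact ⟨.inr f, by simp [region, track_inr, centerTrack_facePt, hz]⟩
    · obtain ⟨j, hj⟩ := exists_mem_sector (X.two_le_sides f) hz
      exact ⟨.inl (X.corner f j), X.isSome_starTrack_facePt.2 ⟨j, rfl, hj⟩⟩

/-- The centre of the disc. -/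
def discCenter : Disc := ⟨0, by simp⟩

/-- The points to which the regions are contracted. -/
noncomputable def apex : V ⊕ X.Face → X.Realization
  | .inl v => X.vertex v
  | .inr f => X.faceMap f discCenter

/-- The path along an oriented edge. -/
def edgePath (d : X.graph.Dart) : Path (X.vertex d.fst) (X.vertex d.snd) :=
  ⟨X.edgeMap d, X.edgeMap_zero d, X.edgeMap_one d⟩

theorem toCenter_one (z : Disc) : toCenter z 1 = discCenter := by
  ext; simp [toCenter, discCenter]

theorem toCenter_zero (z : Disc) : toCenter z 0 = z := by
  ext; simp [toCenter]

/-- Every track runs inside the piece that contains its starting point, so its ends can be read off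
from the contractions of intervals and discs. -/
theorem fullTrack_ends (i : V ⊕ X.Face) (y : X.Realization) (hy : y ∈ X.region i) :
    X.fullTrack i y 0 = y ∧ X.fullTrack i y 1 = X.apex i := by
  obtain ⟨x, rfl⟩ := X.proj_surjective y
  unfold fullTrack
  rcases i with v | f
  · induction x using piece_cases with
    | h0 u =>
      have h : u = v := by
        by_contra h; simp [region, track_inl, starTrack_pt, h] at hy
      subst h
      simp [track_inl, starTrack_pt, apex, vertex]
    | h1 d t =>
      rw [track_inl, starTrack_edgePt]
      rcases X.isSome_starTrack_edgePt.1 hy with h | h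
      · rw [if_pos h]
        constructor
        · simp [toSource, edgeMap]
        · simp [toSource, edgeMap_zero, apex, h.1]
      · rw [if_neg (fun h' => d.adj.ne (h'.1.trans h.1.symm)), if_pos h]
        constructor
        · simp [toTarget, edgeMap]
        · simp [toTarget, edgeMap_one, apex, h.1]
    | h2 f z =>
      obtain ⟨j, hj, hzj⟩ := X.isSome_starTrack_facePt.1 hy
      rw [track_inl, X.starTrack_facePt hj hzj]
      constructor
      · simp only [Option.getD_some, ContinuousMap.comp_apply]
        rw [toCorner_zero hzj.1]; rfl
      · simp only [Option.getD_some, ContinuousMap.comp_apply]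
        rw [toCorner_one, faceMap_corner, hj]; rfl
  · induction x using piece_cases with
    | h0 u => cases hy
    | h1 d t => exact absurd hy (by simp [region, track_inr, centerTrack_edgePt])
    | h2 g z =>
      have h : g = f ∧ ‖(z : ℂ)‖ < 1 := by
        by_contra h
        simp [region, track_inr, centerTrack_facePt, h] at hy
      rw [track_inr, centerTrack_facePt, if_pos h]
      constructor
      · simp only [Option.getD_some, ContinuousMap.comp_apply]
        rw [toCenter_zero]; rfl
      · simp only [Option.getD_some, ContinuousMap.comp_apply]
        rw [toCenter_one, h.1]; rfl

theorem fullTrack_apex (i : V ⊕ X.Face) :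
    X.apex i ∈ X.region i ∧ ∀ t, X.fullTrack i (X.apex i) t = X.apex i := by
  unfold fullTrack
  rcases i with v | f
  · have h : X.track (.inl v) (X.apex (.inl v)) = some (ContinuousMap.const I (X.vertex v)) := by
      simp [apex, vertex, track_inl, starTrack_pt]
    rw [h]
    exact ⟨by simp [region, h], fun t => rfl⟩
  · have h : X.track (.inr f) (X.apex (.inr f)) =
        some ((X.faceMap f).comp (toCenter discCenter)) := by
      change X.track (.inr f) (X.proj (X.facePt f discCenter)) = _
      rw [track_inr, centerTrack_facePt, if_pos]
      simp [discCenter]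
    rw [h]
    refine ⟨by simp [region, h], fun t => ?_⟩
    have : toCenter discCenter t = discCenter := by ext; simp [toCenter, discCenter]
    simp only [Option.getD_some, ContinuousMap.comp_apply, this]; rfl

section Potential

variable {v₀ : V} (p : ∀ v, Path.Homotopic.Quotient (X.vertex v₀) (X.vertex v))
  (hp : ∀ d : X.graph.Dart,
    (p d.fst).trans (Path.Homotopic.Quotient.mk (X.edgePath d)) = p d.snd)

instance : SimplyConnectedSpace I :=
  have : ContractibleSpace I := (convex_Icc (0 : ℝ) 1).contractibleSpace ⟨0, by simp⟩
  inferInstance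

instance : SimplyConnectedSpace Disc :=
  have : ContractibleSpace Disc :=
    (convex_closedBall (0 : ℂ) 1).contractibleSpace ⟨0, by simp⟩
  inferInstance

/-- The path classes to the points of an edge determined by the potential. -/
noncomputable def edgeClass (d : X.graph.Dart) :=
  transport (X.edgeMap d) ((p d.fst).cast rfl (X.edgeMap_zero d))

/-- The path classes to the points of a polygon determined by the potential. -/
noncomputable def faceClass (f : X.Face) :=
  transport (X.faceMap f) ((p (X.corner f 0)).cast rfl (X.faceMap_corner f 0))

theorem edgeClass_zero (d : X.graph.Dart) :
    X.edgeClass p d 0 = (p d.fst).cast rfl (X.edgeMap_zero d) :=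
  transport_self _ _

include hp in
theorem edgeClass_one (d : X.graph.Dart) :
    X.edgeClass p d 1 = (p d.snd).cast rfl (X.edgeMap_one d) :=
  transport_eq_cast (X.edgeMap d) _ ⟨ContinuousMap.id I, rfl, rfl⟩ (X.edgeMap_zero d)
    (X.edgeMap_one d) (X.edgePath d) (fun _ => rfl) (hp d) (X.edgeClass_zero p d)

-- The class is carried from corner to corner around the boundary of the disc. Each side contributes
-- one instance of the compatibility `hp`, beginning with corner `0`, where the class was
-- prescribed.
include hp in
theorem faceClass_corner (f : X.Face) (j : ZMod (X.sides f)) :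
    X.faceClass p f (arc (X.sides f) j.val) =
      (p (X.corner f j)).cast rfl (X.faceMap_corner f j) := by
  have hk0 : 0 < X.sides f := X.sides_pos f
  have : NeZero (X.sides f) := ⟨by omega⟩
  have key : ∀ m : ℕ, ∀ j : ZMod (X.sides f), j = m → X.faceClass p f (arc (X.sides f) j.val) =
      (p (X.corner f j)).cast rfl (X.faceMap_corner f j) := by
    intro m
    induction m with
    | zero =>
      rintro j hj
      obtain rfl : j = 0 := by simpa using hj
      exact transport_self _ _
    | succ m ih =>
      rintro j hj
      obtain rfl : j = m + 1 := by simpa using hj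
      have hs : arc (X.sides f) ((m : ZMod (X.sides f)).val + 1) =
          arc (X.sides f) ((m : ZMod (X.sides f)) + 1).val := by
        have h := arc_val_natCast hk0 ((m : ZMod (X.sides f)).val + 1) 0
        push_cast at h
        rw [ZMod.natCast_zmod_val, add_zero, add_zero] at h
        exact h.symm
      let δ : Path (arc (X.sides f) (m : ZMod (X.sides f)).val)
          (arc (X.sides f) ((m : ZMod (X.sides f)) + 1).val) :=
        ⟨⟨fun t => arc (X.sides f) ((m : ZMod (X.sides f)).val + t),
          (continuous_arc _).comp (by fun_prop)⟩, by simp, by simpa using hs⟩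
      exact transport_eq_cast (X.faceMap f) _ δ (X.faceMap_corner f m) (X.faceMap_corner f (m + 1))
        (X.edgePath (X.sideDart f m)) (fun t => (X.faceMap_arc f m t).symm) (hp (X.sideDart f m)) (ih _ rfl)
  exact key j.val j (ZMod.natCast_zmod_val j).symm

/-- The path classes to the apices of the regions. -/
noncomputable def apexClass : ∀ i, Path.Homotopic.Quotient (X.vertex v₀) (X.apex i)
  | .inl v => p v
  | .inr f => X.faceClass p f discCenter

theorem trans_symm_refl {R : Type*} [TopologicalSpace R] {a b : R}
    (P : Path.Homotopic.Quotient a b) (γ : Path b b) (h : γ = Path.refl b) :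
    P.trans (Path.Homotopic.Quotient.mk γ).symm = P := by
  rw [h, ← Path.Homotopic.Quotient.mk_symm, Path.refl_symm, Path.Homotopic.Quotient.mk_refl,
    Path.Homotopic.Quotient.trans_refl]

-- The common class `Q` is obtained by transport inside the edge or disc that contains `x`. Each
-- track of `x` stays in that piece, so coming back from any apex along it reproduces `Q`; a vertex
-- has only its constant track.
include hp in
theorem apexClass_trans (x : X.Pieces) : ∃ Q : Path.Homotopic.Quotient (X.vertex v₀) (X.proj x),
    ∀ i (γ : Path (X.proj x) (X.apex i)), X.track i (X.proj x) = some γ.toContinuousMap →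
      (X.apexClass p i).trans (Path.Homotopic.Quotient.mk γ).symm = Q := by
  induction x using piece_cases with
  | h0 v =>
    refine ⟨p v, fun i γ hγ => ?_⟩
    rcases i with u | f
    · rw [track_inl, starTrack_pt] at hγ
      split_ifs at hγ with h
      subst h
      have : γ = Path.refl _ := by
        ext t
        have := congrArg (fun g : C(I, X.Realization) => g t) (Option.some.inj hγ)
        exact this.symm
      exact trans_symm_refl _ _ this
    · cases hγ
  | h1 d t =>
    refine ⟨X.edgeClass p d t, fun i γ hγ => ?_⟩
    rcases i with u | f
    · rw [track_inl, starTrack_edgePt] at hγ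
      split_ifs at hγ with h1 h2
      · obtain ⟨rfl, -⟩ := h1
        refine trans_symm_eq_transport (X.edgeMap d) _ (X.edgeMap_zero d) γ
          ⟨toSource t, by simp [toSource], by simp [toSource]⟩ (fun s => ?_) _ (X.edgeClass_zero p d)
        exact (congrArg (fun g : C(I, X.Realization) => g s) (Option.some.inj hγ)).symm
      · obtain ⟨rfl, -⟩ := h2
        refine trans_symm_eq_transport (X.edgeMap d) _ (X.edgeMap_one d) γ
          ⟨toTarget t, by simp [toTarget], by simp [toTarget]⟩ (fun s => ?_) _
          (X.edgeClass_one p hp d)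
        exact (congrArg (fun g : C(I, X.Realization) => g s) (Option.some.inj hγ)).symm
    · cases hγ
  | h2 f z =>
    refine ⟨X.faceClass p f z, fun i γ hγ => ?_⟩
    rcases i with u | g
    · rw [track_inl] at hγ
      obtain ⟨j, rfl, hz⟩ := X.isSome_starTrack_facePt.1 (Option.isSome_iff_exists.2 ⟨_, hγ⟩)
      rw [X.starTrack_facePt rfl hz] at hγ
      refine trans_symm_eq_transport (X.faceMap f) _ (X.faceMap_corner f j) γ
        ⟨toCorner _ j z, toCorner_zero hz.1, toCorner_one⟩ (fun s => ?_) _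
        (X.faceClass_corner p hp f j)
      exact (congrArg (fun g : C(I, X.Realization) => g s) (Option.some.inj hγ)).symm
    · rw [track_inr, centerTrack_facePt] at hγ
      split_ifs at hγ with h
      obtain ⟨rfl, -⟩ := h
      refine trans_symm_eq_transport (X.faceMap f) _ rfl γ
        ⟨toCenter z, toCenter_zero z, toCenter_one z⟩ (fun s => ?_) _ ?_
      · exact (congrArg (fun g : C(I, X.Realization) => g s) (Option.some.inj hγ)).symm
      · exact (Path.Homotopic.Quotient.cast_rfl_rfl (X.faceClass p f discCenter)).symm

include hp in
/-- A polygonal complex is simply connected if there are path classes from one vertex to all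
vertices that are compatible with the edges. -/
theorem simplyConnectedSpace_of_potential : SimplyConnectedSpace X.Realization := by
  refine PathCompatible.simplyConnectedSpace_of_contractions (x₀ := X.vertex v₀) X.isOpen_region
    X.exists_mem_region X.continuousOn_fullTrack (fun i y hy => (X.fullTrack_ends i y hy).1)
    (fun i y hy => (X.fullTrack_ends i y hy).2) (fun i => (X.fullTrack_apex i).1)
    (fun i => (X.fullTrack_apex i).2) (X.apexClass p) fun y => ?_
  obtain ⟨x, rfl⟩ := X.proj_surjective y
  obtain ⟨Q, hQ⟩ := X.apexClass_trans p hp x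
  refine ⟨Q, fun i hy => hQ i _ ?_⟩
  obtain ⟨g, hg⟩ := Option.isSome_iff_exists.1 hy
  simp [fullTrack, hg]

end Potential

end PolygonalComplex
end Zonogon

end

/-! ### The cohomological criterion -/

section

namespace Zonogon

/-- `q` is a primitive of `φ` along the cyclic sequence `w`. -/
def HasCyclePrimitive {V Γ : Type*} [Mul Γ] {k : ℕ} (φ : V → V → Γ) (w : ZMod k → V) : Prop :=
  ∃ q : ZMod k → Γ, ∀ j, q j * φ (w j) (w (j + 1)) = q (j + 1)

/-- A polygon carries only one labelling of its cycle, chosen arbitrarily. A primitive for it is a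
function on the vertices of the cycle, hence also a primitive for any other labelling; edges run
backwards are handled by `hinv`. -/
theorem HasCyclePrimitive.of_cycleEdges_eq {V : Type} {Γ : Type*} [Group Γ] {k : ℕ} [NeZero k]
    {φ : V → V → Γ} {w w' : ZMod k → V} (hw : Function.Injective w)
    (hinv : ∀ j, φ (w' j) (w' (j + 1)) * φ (w' (j + 1)) (w' j) = 1)
    (he : cycleEdges w = cycleEdges w') (h : HasCyclePrimitive φ w') : HasCyclePrimitive φ w := by
  classical
  obtain ⟨q', hq'⟩ := h
  have hmem : ∀ j, ∃ i, s(w j, w (j + 1)) = s(w' i, w' (i + 1)) := fun j => by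
    have : s(w j, w (j + 1)) ∈ cycleEdges w' := he ▸ ⟨j, rfl⟩
    obtain ⟨i, hi⟩ := this
    exact ⟨i, hi.symm⟩
  -- All `k` distinct vertices of `w` occur on `w'`, which has only `k` positions.
  have hw' : Function.Injective w' := by
    have hsub : Finset.univ.image w ⊆ Finset.univ.image w' := by
      intro v hv
      obtain ⟨j, -, rfl⟩ := Finset.mem_image.1 hv
      obtain ⟨i, hi⟩ := hmem j
      rw [Sym2.eq_iff] at hi
      rcases hi with ⟨h, -⟩ | ⟨h, -⟩ <;> rw [h] <;> exact Finset.mem_image_of_mem _ (Finset.mem_univ _)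
    have h1 := Finset.card_le_card hsub
    rw [Finset.card_image_of_injective _ hw] at h1
    have h2 := Finset.card_image_iff.1 (le_antisymm Finset.card_image_le h1)
    exact fun x y hxy => h2 (by simp) (by simp) hxy
  have hQ : ∀ i, q' (Function.invFun w' (w' i)) = q' i := fun i => by
    rw [Function.leftInverse_invFun hw' i]
  refine ⟨fun j => q' (Function.invFun w' (w j)), fun j => ?_⟩
  obtain ⟨i, hi⟩ := hmem j
  rw [Sym2.eq_iff] at hi
  rcases hi with ⟨h1, h2⟩ | ⟨h1, h2⟩
  · beta_reduce; rw [h1, h2, hQ, hQ, hq']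
  · beta_reduce; rw [h1, h2, hQ, hQ, ← hq', mul_assoc, hinv, mul_one]

theorem transport_cast_trans {B R : Type*} [TopologicalSpace B] [TopologicalSpace R]
    [SimplyConnectedSpace B] {x₀ : R} (F : C(B, R)) {b₀ : B}
    (q₀ : Path.Homotopic.Quotient x₀ (F b₀)) {b b' : B} (δ : Path b b') {c c' : R} (hc : F b = c)
    (hc' : F b' = c') (e : Path c c') (he : ∀ t, e t = F (δ t)) :
    ((transport F q₀ b).cast rfl hc.symm).trans (Path.Homotopic.Quotient.mk e) =
      (transport F q₀ b').cast rfl hc'.symm := by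
  subst hc hc'
  have e : e = δ.map F.continuous := by ext t; exact he t
  rw [Path.Homotopic.Quotient.cast_rfl_rfl, Path.Homotopic.Quotient.cast_rfl_rfl, e, transport_trans]

/-- The group of path classes of loops, with concatenation as multiplication. -/
@[reducible]
noncomputable def loopGroup {R : Type*} [TopologicalSpace R] (x : R) : Group (Path.Homotopic.Quotient x x) :=
  letI : Mul (Path.Homotopic.Quotient x x) := ⟨Path.Homotopic.Quotient.trans⟩
  letI : One (Path.Homotopic.Quotient x x) := ⟨Path.Homotopic.Quotient.refl x⟩
  letI : Inv (Path.Homotopic.Quotient x x) := ⟨Path.Homotopic.Quotient.symm⟩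
  Group.ofLeftAxioms Path.Homotopic.Quotient.trans_assoc Path.Homotopic.Quotient.refl_trans
    Path.Homotopic.Quotient.symm_trans

namespace PolygonalComplex

variable {V : Type} (X : PolygonalComplex V)

theorem exists_path_of_reachable {u v : V} (h : X.graph.Reachable u v) :
    Nonempty (Path.Homotopic.Quotient (X.vertex u) (X.vertex v)) := by
  obtain ⟨p⟩ := h
  induction p with
  | nil => exact ⟨Path.Homotopic.Quotient.refl _⟩
  | cons h p ih =>
    obtain ⟨q⟩ := ih
    exact ⟨(Path.Homotopic.Quotient.mk (X.edgePath ⟨(_, _), h⟩)).trans q⟩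

/-- The disc of `f` is simply connected, so a class at one corner extends over the whole disc; its
values at the corners are related along the sides. This is the triviality of the boundary of a
2-cell. -/
theorem exists_cyclePrimitive {x₀ : X.Realization} (f : X.Face)
    (c : Path.Homotopic.Quotient x₀ (X.vertex (X.corner f 0))) :
    ∃ T : ∀ j, Path.Homotopic.Quotient x₀ (X.vertex (X.corner f j)),
      ∀ j, (T j).trans (Path.Homotopic.Quotient.mk (X.edgePath (X.sideDart f j))) = T (j + 1) := by
  refine ⟨fun j => (transport (X.faceMap f) (c.cast rfl (X.faceMap_corner f 0))
    (arc (X.sides f) j.val)).cast rfl (X.faceMap_corner f j).symm, fun j => ?_⟩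
  have hk0 : 0 < X.sides f := X.sides_pos f
  have : NeZero (X.sides f) := ⟨by omega⟩
  have hs : arc (X.sides f) (j.val + 1) = arc (X.sides f) (j + 1).val := by
    have h := arc_val_natCast hk0 (j.val + 1) 0
    push_cast at h
    rw [ZMod.natCast_zmod_val, add_zero, add_zero] at h
    exact h.symm
  let δ : Path (arc (X.sides f) j.val) (arc (X.sides f) (j + 1).val) :=
    ⟨⟨fun t => arc (X.sides f) (j.val + t), (continuous_arc _).comp (by fun_prop)⟩, by simp,
      by simpa using hs⟩
  exact transport_cast_trans (X.faceMap f) _ δ (X.faceMap_corner f j) (X.faceMap_corner f (j + 1))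
    (X.edgePath (X.sideDart f j)) (fun t => (X.faceMap_arc f j t).symm)

/-- A polygonal complex with connected graph is simply connected if its first cohomology with
coefficients in all groups vanishes. -/
theorem simplyConnectedSpace_of_cohomology [Nonempty V] (hconn : X.graph.Preconnected)
    (h : ∀ (Γ : Type) [Group Γ] (φ : V → V → Γ),
      (∀ u v, X.graph.Adj u v → φ u v * φ v u = 1) →
      (∀ f, HasCyclePrimitive φ (X.corner f)) →
      ∃ g : V → Γ, ∀ u v, X.graph.Adj u v → g u * φ u v = g v) :
    SimplyConnectedSpace X.Realization := by
  classical
  obtain ⟨v₀⟩ := ‹Nonempty V›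
  have hc := fun v => X.exists_path_of_reachable (hconn v₀ v)
  let c := fun v => (hc v).some
  let _ := loopGroup (X.vertex v₀)
  -- An edge is closed up to a loop by the chosen classes `c`. If `g` trivializes the resulting
  -- cochain, then the classes `g v · c v` are compatible with the edges.
  let φ : V → V → Path.Homotopic.Quotient (X.vertex v₀) (X.vertex v₀) := fun u v =>
    if huv : X.graph.Adj u v then ((c u).trans (Path.Homotopic.Quotient.mk
      (X.edgePath ⟨(u, v), huv⟩))).trans (c v).symm else 1
  have hφ : ∀ u v (huv : X.graph.Adj u v), φ u v = ((c u).trans (Path.Homotopic.Quotient.mk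
      (X.edgePath ⟨(u, v), huv⟩))).trans (c v).symm := fun u v huv => dif_pos huv
  have hmul : ∀ a b : Path.Homotopic.Quotient (X.vertex v₀) (X.vertex v₀), a * b = a.trans b :=
    fun _ _ => rfl
  have hone : (1 : Path.Homotopic.Quotient (X.vertex v₀) (X.vertex v₀)) =
    Path.Homotopic.Quotient.refl _ := rfl
  obtain ⟨g, hg⟩ := h _ φ (fun u v huv => by
      rw [hφ u v huv, hφ v u huv.symm, hmul, hone]
      have e : X.edgePath ⟨(v, u), huv.symm⟩ = (X.edgePath ⟨(u, v), huv⟩).symm := by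
        ext t
        exact X.edgeMap_symm _ _
      rw [e, Path.Homotopic.Quotient.mk_symm]
      simp only [Path.Homotopic.Quotient.trans_assoc]
      rw [← Path.Homotopic.Quotient.trans_assoc (c v).symm (c v),
        Path.Homotopic.Quotient.symm_trans, Path.Homotopic.Quotient.refl_trans,
        ← Path.Homotopic.Quotient.trans_assoc (Path.Homotopic.Quotient.mk _),
        Path.Homotopic.Quotient.trans_symm, Path.Homotopic.Quotient.refl_trans,
        Path.Homotopic.Quotient.trans_symm])
    (fun f => by
      obtain ⟨T, hT⟩ := X.exists_cyclePrimitive f (c (X.corner f 0))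
      refine ⟨fun j => (T j).trans (c (X.corner f j)).symm, fun j => ?_⟩
      beta_reduce
      rw [hφ _ _ (X.adj f j), hmul, ← hT j]
      simp only [Path.Homotopic.Quotient.trans_assoc]
      rw [← Path.Homotopic.Quotient.trans_assoc (c _).symm (c _),
        Path.Homotopic.Quotient.symm_trans, Path.Homotopic.Quotient.refl_trans]
      exact (Path.Homotopic.Quotient.trans_assoc _ _ _).symm)
  refine X.simplyConnectedSpace_of_potential (v₀ := v₀) (fun v => (g v).trans (c v)) fun d => ?_
  have := hg d.fst d.snd d.adj
  rw [hφ _ _ d.adj, hmul] at this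
  rw [← this]
  simp only [Path.Homotopic.Quotient.trans_assoc]
  rw [Path.Homotopic.Quotient.symm_trans, Path.Homotopic.Quotient.trans_refl]

end PolygonalComplex

/-- The cochain may be assumed flat along every labelling of a cycle, not only the chosen one. The
transfer needs distinct corners: octagon cycles have them by definition, for squares they are
demanded. -/
theorem simplyConnectedSpace_flipComplex {n : ℕ} (a : Fin n → ℕ) (θ : Fin n → ℝ)
    (hne : Nonempty (Tiling a θ)) (hconn : (flipGraph a θ).Preconnected)
    (h : ∀ (Γ : Type) [Group Γ] (φ : Tiling a θ → Tiling a θ → Γ),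
      (∀ u v, (flipGraph a θ).Adj u v → φ u v * φ v u = 1) →
      (∀ w : ZMod 4 → Tiling a θ, IsSquareCycle w → Function.Injective w → HasCyclePrimitive φ w) →
      (∀ w : ZMod 8 → Tiling a θ, IsOctagonCycle w → HasCyclePrimitive φ w) →
      ∃ g : Tiling a θ → Γ, ∀ u v, (flipGraph a θ).Adj u v → g u * φ u v = g v) :
    SimplyConnectedSpace (flipComplex a θ).Realization := by
  refine (flipComplex a θ).simplyConnectedSpace_of_cohomology hconn fun Γ _ φ hinv hφ => ?_
  refine h Γ φ hinv (fun w hw hwi => ?_) fun w hw => ?_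
  · let E : {E : Set (Sym2 (Tiling a θ)) // ∃ w : ZMod 4 → Tiling a θ,
      IsSquareCycle w ∧ cycleEdges w = E} := ⟨cycleEdges w, w, hw, rfl⟩
    exact .of_cycleEdges_eq hwi (fun j => hinv _ _ (E.2.choose_spec.1.adj j))
      E.2.choose_spec.2.symm (hφ (Sum.inl E))
  · let E : {E : Set (Sym2 (Tiling a θ)) // ∃ w : ZMod 8 → Tiling a θ,
      IsOctagonCycle w ∧ cycleEdges w = E} := ⟨cycleEdges w, w, hw, rfl⟩
    exact .of_cycleEdges_eq hw.1 (fun j => hinv _ _ (E.2.choose_spec.1.adj j))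
      E.2.choose_spec.2.symm (hφ (Sum.inr E))

end Zonogon

end

/-! ### Lattice paths and the boundary of the zonogon -/

namespace Zonogon

variable {n : ℕ} {θ : Fin n → ℝ}

/-- The angles increase and lie in the open upper half plane. -/
structure IsAngles (θ : Fin n → ℝ) : Prop where
  strictMono : StrictMono θ
  pos : ∀ i, 0 < θ i
  lt_pi : ∀ i, θ i < Real.pi

theorem IsAngles.sin_pos (hθ : IsAngles θ) (i : Fin n) : 0 < Real.sin (θ i) :=
  Real.sin_pos_of_pos_of_lt_pi (hθ.pos i) (hθ.lt_pi i)

theorem IsAngles.sin_sub_pos (hθ : IsAngles θ) {i j : Fin n} (h : i < j) :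
    0 < Real.sin (θ j - θ i) :=
  Real.sin_pos_of_pos_of_lt_pi (sub_pos.2 (hθ.strictMono h))
    (by linarith [hθ.pos i, hθ.lt_pi j])

theorem IsAngles.sin_sub_neg (hθ : IsAngles θ) {i j : Fin n} (h : j < i) :
    Real.sin (θ j - θ i) < 0 := by
  rw [← neg_sub, Real.sin_neg, neg_lt_zero]
  exact hθ.sin_sub_pos h

/-- The first coordinate of the projection. -/
noncomputable def abscissa (θ : Fin n → ℝ) : (Fin n → ℝ) →ₗ[ℝ] ℝ :=
  ∑ i, Real.cos (θ i) • LinearMap.proj i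

/-- The second coordinate of the projection. -/
noncomputable def height (θ : Fin n → ℝ) : (Fin n → ℝ) →ₗ[ℝ] ℝ :=
  ∑ i, Real.sin (θ i) • LinearMap.proj i

theorem abscissa_apply (x : Fin n → ℝ) : abscissa θ x = ∑ i, x i * Real.cos (θ i) := by
  simp [abscissa, mul_comm]

theorem height_apply (x : Fin n → ℝ) : height θ x = ∑ i, x i * Real.sin (θ i) := by
  simp [height, mul_comm]

theorem proj_eq (x : Fin n → ℝ) : proj θ x = (abscissa θ x, height θ x) := by
  rw [abscissa_apply, height_apply]; rfl

theorem height_single (j : Fin n) (c : ℝ) : height θ (Pi.single j c) = c * Real.sin (θ j) := by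
  rw [height_apply, Finset.sum_eq_single j] <;> simp +contextual

theorem abscissa_single (j : Fin n) (c : ℝ) : abscissa θ (Pi.single j c) = c * Real.cos (θ j) := by
  rw [abscissa_apply, Finset.sum_eq_single j] <;> simp +contextual

/-- A point that is, at equal height, farther in the directions after `i` and less far in the
directions before `i`, lies farther to the left. -/
theorem abscissa_le_of_height_eq (hθ : IsAngles θ) {x p : Fin n → ℝ}
    (h : height θ x = height θ p) (i : Fin n) (hl : ∀ m < i, x m ≤ p m) (hr : ∀ m > i, p m ≤ x m) :
    abscissa θ x ≤ abscissa θ p ∧ (abscissa θ x = abscissa θ p → x = p) := by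
  have hterm : ∀ m ∈ Finset.univ, 0 ≤ (x m - p m) * Real.sin (θ m - θ i) := by
    intro m _
    rcases lt_trichotomy m i with hm | rfl | hm
    · exact mul_nonneg_of_nonpos_of_nonpos (sub_nonpos.2 (hl m hm)) (hθ.sin_sub_neg hm).le
    · simp
    · exact mul_nonneg (sub_nonneg.2 (hr m hm)) (hθ.sin_sub_pos hm).le
  -- The sum is the determinant of `v_i` and the projected difference. By hypothesis all its terms
  -- are nonnegative, and at equal height it only sees the difference of the abscissas.
  have hsum : ∑ m, (x m - p m) * Real.sin (θ m - θ i) =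
      Real.sin (θ i) * (abscissa θ p - abscissa θ x) := by
    have e : ∑ m, (x m - p m) * Real.sin (θ m - θ i) =
        Real.cos (θ i) * (height θ x - height θ p) -
        Real.sin (θ i) * (abscissa θ x - abscissa θ p) := by
      rw [← map_sub, ← map_sub, height_apply, abscissa_apply, Finset.mul_sum, Finset.mul_sum,
        ← Finset.sum_sub_distrib]
      refine Finset.sum_congr rfl fun m _ => ?_
      rw [Real.sin_sub, Pi.sub_apply]; ring
    rw [e, h]; ring
  have hs := hθ.sin_pos i
  constructor
  · have := Finset.sum_nonneg hterm
    rw [hsum] at this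
    have := nonneg_of_mul_nonneg_right this hs
    linarith
  · intro heq
    rw [heq, sub_self, mul_zero] at hsum
    have hz := (Finset.sum_eq_zero_iff_of_nonneg hterm).1 hsum
    have hne : ∀ m, m ≠ i → x m = p m := by
      intro m hm
      have := hz m (Finset.mem_univ m)
      rcases mul_eq_zero.1 this with h1 | h1
      · linarith
      · rcases lt_or_gt_of_ne hm with h2 | h2
        · exact absurd h1 (hθ.sin_sub_neg h2).ne
        · exact absurd h1 (hθ.sin_sub_pos h2).ne'
    have hi : x i = p i := by
      have e : x - p = Pi.single i (x i - p i) := by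
        ext m
        rcases eq_or_ne m i with rfl | hm
        · simp
        · simp [hm, hne m hm]
      have : height θ (x - p) = 0 := by rw [map_sub, h, sub_self]
      rw [e, height_single] at this
      rcases mul_eq_zero.1 this with h1 | h1
      · linarith
      · exact absurd h1 hs.ne'
    ext m
    rcases eq_or_ne m i with rfl | hm
    · exact hi
    · exact hne m hm

/-- The endpoint of the lattice path with steps `w`. -/
def cnt (w : List (Fin n)) : Fin n → ℕ := fun i => w.count i

theorem cnt_append (u v : List (Fin n)) : cnt (u ++ v) = cnt u + cnt v := by
  ext i; simp [cnt]

theorem cnt_nil : cnt ([] : List (Fin n)) = 0 := rfl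

theorem cnt_cons (j : Fin n) (w : List (Fin n)) : cnt (j :: w) = Pi.single j 1 + cnt w := by
  ext i
  simp only [cnt, List.count_cons, Pi.add_apply, Pi.single_apply, beq_iff_eq]
  rw [add_comm]
  congr 1
  by_cases h : i = j <;> simp [h, Ne.symm]

/-- Lattice points as points of `ℝⁿ`. -/
def toReal (K : Fin n → ℕ) : Fin n → ℝ := fun i => K i

@[simp] theorem toReal_apply (K : Fin n → ℕ) (i : Fin n) : toReal K i = K i := rfl

theorem toReal_add (K L : Fin n → ℕ) : toReal (K + L) = toReal K + toReal L := by
  ext i; simp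

/-- The height of the endpoint of a lattice path. -/
noncomputable def len (θ : Fin n → ℝ) (w : List (Fin n)) : ℝ := height θ (toReal (cnt w))

theorem len_nil : len θ ([] : List (Fin n)) = 0 := by
  rw [len, cnt_nil, height_apply]; simp

theorem len_cons (j : Fin n) (w : List (Fin n)) : len θ (j :: w) = Real.sin (θ j) + len θ w := by
  have : toReal (Pi.single j 1 : Fin n → ℕ) = Pi.single j (1 : ℝ) := by
    ext i; simp [Pi.single_apply]
  rw [len, cnt_cons, toReal_add, map_add, this, height_single, one_mul]; rfl

theorem len_nonneg (hθ : IsAngles θ) (w : List (Fin n)) : 0 ≤ len θ w := by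
  rw [len, height_apply]
  exact Finset.sum_nonneg fun i _ => mul_nonneg (by simp) (hθ.sin_pos i).le

/-- The point at height `h` of the lattice path with steps `w`. -/
noncomputable def trace (θ : Fin n → ℝ) : List (Fin n) → ℝ → Fin n → ℝ
  | [], _ => 0
  -- The clamp makes a step contribute nothing at heights below it and its full length above it, so
  -- the trace rests at the ends of the path outside its range of heights.
  | j :: w, h => Pi.single j (max 0 (min (h / Real.sin (θ j)) 1)) + trace θ w (h - Real.sin (θ j))

theorem trace_append (u v : List (Fin n)) (h : ℝ) :
    trace θ (u ++ v) h = trace θ u h + trace θ v (h - len θ u) := by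
  induction u generalizing h with
  | nil => simp [trace, len_nil]
  | cons j u ih =>
    rw [List.cons_append, trace, ih, trace, len_cons, add_assoc]
    congr 3
    ring

theorem trace_nonneg_le (w : List (Fin n)) (h : ℝ) (i : Fin n) :
    0 ≤ trace θ w h i ∧ trace θ w h i ≤ cnt w i := by
  induction w generalizing h with
  | nil => simp [trace, cnt]
  | cons j w ih =>
    obtain ⟨h1, h2⟩ := ih (h - Real.sin (θ j))
    rw [trace, cnt_cons]
    simp only [Pi.add_apply, Nat.cast_add]
    by_cases hij : i = j
    · subst hij
      simp only [Pi.single_eq_same, Nat.cast_one]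
      have h3 : (0 : ℝ) ≤ max 0 (min (h / Real.sin (θ i)) 1) := le_max_left _ _
      have h4 : max 0 (min (h / Real.sin (θ i)) 1) ≤ 1 := max_le zero_le_one (min_le_right _ _)
      constructor <;> linarith
    · simp only [Pi.single_eq_of_ne hij, Nat.cast_zero]
      constructor <;> linarith

theorem trace_of_nonpos (hθ : IsAngles θ) (w : List (Fin n)) {h : ℝ} (hh : h ≤ 0) :
    trace θ w h = 0 := by
  induction w generalizing h with
  | nil => rfl
  | cons j w ih =>
    have hs := hθ.sin_pos j
    rw [trace, ih (by linarith), max_eq_left]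
    · simp
    · exact (min_le_left _ _).trans (div_nonpos_of_nonpos_of_nonneg hh hs.le)

theorem trace_of_len_le (hθ : IsAngles θ) (w : List (Fin n)) {h : ℝ} (hh : len θ w ≤ h) :
    trace θ w h = toReal (cnt w) := by
  induction w generalizing h with
  | nil => ext; simp [trace, cnt]
  | cons j w ih =>
    have hs := hθ.sin_pos j
    have hl := len_nonneg hθ w
    rw [len_cons] at hh
    rw [trace, ih (by linarith), cnt_cons, toReal_add, min_eq_right, max_eq_right zero_le_one]
    · congr 1; ext i; simp [Pi.single_apply]
    · rw [le_div_iff₀ hs]; linarith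

theorem height_trace (hθ : IsAngles θ) (w : List (Fin n)) {h : ℝ} (h0 : 0 ≤ h)
    (h1 : h ≤ len θ w) : height θ (trace θ w h) = h := by
  induction w generalizing h with
  | nil => rw [len_nil] at h1; simp [trace]; linarith
  | cons j w ih =>
    have hs := hθ.sin_pos j
    rw [len_cons] at h1
    rw [trace, map_add, height_single]
    rcases le_total h (Real.sin (θ j)) with hle | hle
    · rw [trace_of_nonpos hθ w (by linarith), map_zero, min_eq_left (by rwa [div_le_one hs]),
        max_eq_right (by positivity)]
      field_simp
      simp
    · rw [ih (by linarith) (by linarith), min_eq_right (by rwa [one_le_div hs]),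
        max_eq_right zero_le_one]
      ring

/-- At each height one direction `i` is in progress; in a sorted word the smaller ones are then
exhausted and the larger ones not begun. This is the extremality needed in
`abscissa_le_of_height_eq`. The index `i₀` only serves the empty word. -/
theorem trace_of_sorted (w : List (Fin n)) (hw : w.Pairwise (· ≤ ·)) (hθ : IsAngles θ)
    (h : ℝ) (i₀ : Fin n) :
    ∃ i, (∀ m < i, trace θ w h m = cnt w m) ∧ (∀ m > i, trace θ w h m = 0) := by
  induction w generalizing h with
  | nil => exact ⟨i₀, fun m _ => by simp [trace, cnt], fun m _ => by simp [trace]⟩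
  | cons j w ih =>
    have hs := hθ.sin_pos j
    obtain ⟨hj, hw⟩ := List.pairwise_cons.1 hw
    have hcnt : ∀ m < j, cnt (j :: w) m = 0 := by
      intro m hm
      rw [cnt, List.count_eq_zero, List.mem_cons]
      rintro (rfl | h)
      · exact lt_irrefl _ hm
      · exact absurd (hj m h) (not_le.2 hm)
    have hlow : ∀ m < j, trace θ (j :: w) h m = cnt (j :: w) m := by
      intro m hm
      have := trace_nonneg_le (θ := θ) (j :: w) h m
      rw [hcnt m hm, Nat.cast_zero] at this ⊢
      linarith
    rcases le_total h (Real.sin (θ j)) with hle | hle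
    · refine ⟨j, hlow, fun m hm => ?_⟩
      rw [trace, trace_of_nonpos hθ w (by linarith)]
      simp [hm.ne']
    · obtain ⟨i, h1, h2⟩ := ih hw (h - Real.sin (θ j))
      have e : trace θ (j :: w) h = Pi.single j 1 + trace θ w (h - Real.sin (θ j)) := by
        rw [trace, min_eq_right (by rwa [one_le_div hs]), max_eq_right zero_le_one]
      rcases le_or_gt j i with hji | hji
      · refine ⟨i, fun m hm => ?_, fun m hm => ?_⟩
        · rw [e, cnt_cons, Pi.add_apply, h1 m hm]; simp [Pi.single_apply]
        · rw [e, Pi.add_apply, h2 m hm, Pi.single_eq_of_ne (hji.trans_lt hm).ne', add_zero]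
      · refine ⟨j, hlow, fun m hm => ?_⟩
        rw [e, Pi.add_apply, h2 m (hji.trans hm), Pi.single_eq_of_ne hm.ne', add_zero]

theorem trace_of_reverse_sorted (w : List (Fin n)) (hw : w.Pairwise (· ≥ ·)) (hθ : IsAngles θ)
    (h : ℝ) (i₀ : Fin n) :
    ∃ i, (∀ m < i, trace θ w h m = 0) ∧ (∀ m > i, trace θ w h m = cnt w m) := by
  induction w generalizing h with
  | nil => exact ⟨i₀, fun m _ => by simp [trace], fun m _ => by simp [trace, cnt]⟩
  | cons j w ih =>
    have hs := hθ.sin_pos j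
    obtain ⟨hj, hw⟩ := List.pairwise_cons.1 hw
    have hcnt : ∀ m > j, cnt (j :: w) m = 0 := by
      intro m hm
      rw [cnt, List.count_eq_zero, List.mem_cons]
      rintro (rfl | h)
      · exact lt_irrefl _ hm
      · exact absurd (hj m h) (not_le.2 hm)
    have hlow : ∀ m > j, trace θ (j :: w) h m = cnt (j :: w) m := by
      intro m hm
      have := trace_nonneg_le (θ := θ) (j :: w) h m
      rw [hcnt m hm, Nat.cast_zero] at this ⊢
      linarith
    rcases le_total h (Real.sin (θ j)) with hle | hle
    · refine ⟨j, fun m hm => ?_, hlow⟩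
      rw [trace, trace_of_nonpos hθ w (by linarith)]
      simp [hm.ne]
    · obtain ⟨i, h1, h2⟩ := ih hw (h - Real.sin (θ j))
      have e : trace θ (j :: w) h = Pi.single j 1 + trace θ w (h - Real.sin (θ j)) := by
        rw [trace, min_eq_right (by rwa [one_le_div hs]), max_eq_right zero_le_one]
      rcases le_or_gt i j with hji | hji
      · refine ⟨i, fun m hm => ?_, fun m hm => ?_⟩
        · rw [e, Pi.add_apply, h1 m hm, Pi.single_eq_of_ne (hm.trans_le hji).ne, add_zero]
        · rw [e, cnt_cons, Pi.add_apply, h2 m hm]; simp [Pi.single_apply]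
      · refine ⟨j, fun m hm => ?_, hlow⟩
        rw [e, Pi.add_apply, h1 m (hm.trans hji), Pi.single_eq_of_ne hm.ne, add_zero]

/-- The box with upper corner `K`. -/
def cbox (K : Fin n → ℕ) : Set (Fin n → ℝ) := {x | ∀ i, 0 ≤ x i ∧ x i ≤ K i}

theorem height_mem_of_mem_cbox (hθ : IsAngles θ) {w : List (Fin n)} {x : Fin n → ℝ}
    (hx : x ∈ cbox (cnt w)) : 0 ≤ height θ x ∧ height θ x ≤ len θ w := by
  rw [len, height_apply, height_apply]
  exact ⟨Finset.sum_nonneg fun i _ => mul_nonneg (hx i).1 (hθ.sin_pos i).le,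
    Finset.sum_le_sum fun i _ => mul_le_mul_of_nonneg_right (hx i).2 (hθ.sin_pos i).le⟩

theorem eq_of_isEmpty_fin {x y : Fin n → ℝ} (h : IsEmpty (Fin n)) : x = y :=
  funext fun i => h.elim i

/-- The sorted path runs along the right boundary of the projected box, and a boundary point has
only one preimage in the box. The equality clause records this uniqueness. -/
theorem abscissa_le_trace_of_sorted (hθ : IsAngles θ) {w : List (Fin n)}
    (hw : w.Pairwise (· ≤ ·)) {x : Fin n → ℝ} (hx : x ∈ cbox (cnt w)) :
    abscissa θ x ≤ abscissa θ (trace θ w (height θ x)) ∧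
      (abscissa θ x = abscissa θ (trace θ w (height θ x)) → x = trace θ w (height θ x)) := by
  rcases isEmpty_or_nonempty (Fin n) with hn | ⟨⟨i₀⟩⟩
  · have := eq_of_isEmpty_fin (x := x) (y := trace θ w (height θ x)) hn
    exact ⟨le_of_eq (congrArg _ this), fun _ => this⟩
  · obtain ⟨h0, h1⟩ := height_mem_of_mem_cbox hθ hx
    obtain ⟨i, hl, hr⟩ := trace_of_sorted w hw hθ (height θ x) i₀
    refine abscissa_le_of_height_eq hθ (height_trace hθ w h0 h1).symm i (fun m hm => ?_)
      fun m hm => ?_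
    · rw [hl m hm]; exact (hx m).2
    · rw [hr m hm]; exact (hx m).1

theorem trace_le_abscissa_of_reverse_sorted (hθ : IsAngles θ) {w : List (Fin n)}
    (hw : w.Pairwise (· ≥ ·)) {x : Fin n → ℝ} (hx : x ∈ cbox (cnt w)) :
    abscissa θ (trace θ w (height θ x)) ≤ abscissa θ x ∧
      (abscissa θ (trace θ w (height θ x)) = abscissa θ x → x = trace θ w (height θ x)) := by
  rcases isEmpty_or_nonempty (Fin n) with hn | ⟨⟨i₀⟩⟩
  · have := eq_of_isEmpty_fin (x := x) (y := trace θ w (height θ x)) hn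
    exact ⟨le_of_eq (congrArg _ this.symm), fun _ => this⟩
  · obtain ⟨h0, h1⟩ := height_mem_of_mem_cbox hθ hx
    obtain ⟨i, hl, hr⟩ := trace_of_reverse_sorted w hw hθ (height θ x) i₀
    have := abscissa_le_of_height_eq hθ (height_trace hθ w h0 h1) i (fun m hm => by
      rw [hl m hm]; exact (hx m).1) (fun m hm => by rw [hr m hm]; exact (hx m).2)
    exact ⟨this.1, fun h => (this.2 h).symm⟩

end Zonogon

/-! ### Rhombi and sweeps -/

namespace Zonogon

variable {n : ℕ} {θ : Fin n → ℝ}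

/-- The two-dimensional cell with lowest vertex `K` and directions `j`, `m`. -/
def rhombus (K : Fin n → ℕ) (j m : Fin n) : Cell n := ⟨K, {j, m}⟩

theorem rhombus_comm (K : Fin n → ℕ) (j m : Fin n) : rhombus K j m = rhombus K m j := by
  rw [rhombus, rhombus, Finset.pair_comm]

theorem cnt_pair {j m : Fin n} (h : j ≠ m) (i : Fin n) :
    (cnt [j, m] i : ℝ) = if i ∈ ({j, m} : Finset (Fin n)) then 1 else 0 := by
  rw [cnt_cons, cnt_cons, cnt_nil]
  simp only [Pi.add_apply, Pi.single_apply, Finset.mem_insert, Finset.mem_singleton]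
  by_cases h1 : i = j <;> by_cases h2 : i = m <;> simp_all

theorem cnt_swap (j m : Fin n) : cnt [m, j] = cnt [j, m] := by
  simp only [cnt_cons, cnt_nil]; abel

theorem mem_rhombus_iff {K : Fin n → ℕ} {j m : Fin n} (h : j ≠ m) {x : Fin n → ℝ} :
    x ∈ (rhombus K j m).carrier ↔ x - toReal K ∈ cbox (cnt [j, m]) := by
  refine forall_congr' fun i => ?_
  rw [cnt_pair h]
  simp only [rhombus, Pi.sub_apply, toReal_apply]
  by_cases hi : i ∈ ({j, m} : Finset (Fin n)) <;> simp only [hi, if_true, if_false] <;>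
    constructor <;> rintro ⟨h1, h2⟩ <;> constructor <;> linarith

theorem trace_pair_clamp (hθ : IsAngles θ) (w : List (Fin n)) (h : ℝ) :
    trace θ w (max 0 (min h (len θ w))) = trace θ w h := by
  have hl := len_nonneg hθ w
  rcases le_total h 0 with h0 | h0
  · rw [min_eq_left (h0.trans hl), max_eq_left h0, trace_of_nonpos hθ w h0,
      trace_of_nonpos hθ w le_rfl]
  · rcases le_total h (len θ w) with h1 | h1
    · rw [min_eq_left h1, max_eq_right h0]
    · rw [min_eq_right h1, max_eq_right hl, trace_of_len_le hθ w h1, trace_of_len_le hθ w le_rfl]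

theorem height_trace_clamp (hθ : IsAngles θ) (w : List (Fin n)) (h : ℝ) :
    height θ (trace θ w h) = max 0 (min h (len θ w)) := by
  have hl := len_nonneg hθ w
  rw [← trace_pair_clamp hθ, height_trace hθ w (le_max_left _ _) (max_le hl (min_le_right _ _))]

theorem trace_mem_cbox (w : List (Fin n)) (h : ℝ) : trace θ w h ∈ cbox (cnt w) :=
  fun i => trace_nonneg_le w h i

theorem trace_swap_le (hθ : IsAngles θ) {j m : Fin n} (hjm : j < m) (h : ℝ) :
    abscissa θ (trace θ [m, j] h) ≤ abscissa θ (trace θ [j, m] h) ∧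
      (abscissa θ (trace θ [m, j] h) = abscissa θ (trace θ [j, m] h) →
        trace θ [m, j] h = trace θ [j, m] h) := by
  have hx : trace θ [m, j] h ∈ cbox (cnt [j, m]) := by
    rw [← cnt_swap]; exact trace_mem_cbox _ _
  have hl : len θ [m, j] = len θ [j, m] := by rw [len, len, cnt_swap]
  have := abscissa_le_trace_of_sorted hθ (w := [j, m]) (by simpa using hjm.le) hx
  rwa [height_trace_clamp hθ, hl, trace_pair_clamp hθ] at this

theorem trace_middle (u x v : List (Fin n)) (h : ℝ) :
    trace θ (u ++ (x ++ v)) h =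
      trace θ u h + (trace θ x (h - len θ u) + trace θ v (h - len θ u - len θ x)) := by
  rw [trace_append, trace_append]

/-- Swapping an ascent moves a lattice path to the left. -/
theorem trace_step_le (hθ : IsAngles θ) {u v : List (Fin n)} {j m : Fin n} (hjm : j < m) (h : ℝ) :
    abscissa θ (trace θ (u ++ m :: j :: v) h) ≤ abscissa θ (trace θ (u ++ j :: m :: v) h) ∧
      (abscissa θ (trace θ (u ++ m :: j :: v) h) = abscissa θ (trace θ (u ++ j :: m :: v) h) →
        trace θ (u ++ m :: j :: v) h = trace θ (u ++ j :: m :: v) h) := by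
  have hl : len θ [m, j] = len θ [j, m] := by rw [len, len, cnt_swap]
  have e1 := trace_middle (θ := θ) u [m, j] v h
  have e2 := trace_middle (θ := θ) u [j, m] v h
  simp only [List.cons_append, List.nil_append] at e1 e2
  rw [e1, e2, hl]
  simp only [map_add]
  obtain ⟨h1, h2⟩ := trace_swap_le hθ hjm (h - len θ u)
  refine ⟨by linarith, fun h => ?_⟩
  rw [h2 (by linarith)]

/-- At the heights occurring in the rhombus, the steps of `u` are completed and those of `v` not
begun. -/
theorem trace_of_mem_rhombus (hθ : IsAngles θ) {K : Fin n → ℕ} {u v : List (Fin n)} {j m : Fin n}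
    (hjm : j ≠ m) {x : Fin n → ℝ} (hx : x ∈ (rhombus (K + cnt u) j m).carrier) :
    toReal K + trace θ (u ++ j :: m :: v) (height θ x - height θ (toReal K)) =
      toReal (K + cnt u) + trace θ [j, m] (height θ (x - toReal (K + cnt u))) := by
  rw [mem_rhombus_iff hjm] at hx
  obtain ⟨h0, h1⟩ := height_mem_of_mem_cbox hθ hx
  have e : height θ x - height θ (toReal K) = len θ u + height θ (x - toReal (K + cnt u)) := by
    rw [map_sub, toReal_add, map_add, len]; ring
  have e2 := trace_middle (θ := θ) u [j, m] v (height θ x - height θ (toReal K))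
  simp only [List.cons_append, List.nil_append] at e2
  rw [e2, e, trace_of_len_le hθ u (by linarith), trace_of_nonpos hθ v (by linarith), toReal_add]
  simp only [add_sub_cancel_left, add_zero, add_assoc]

/-- A rhombus lies between the lattice paths along its right and its left boundary. -/
theorem rhombus_between (hθ : IsAngles θ) {K : Fin n → ℕ} {u v : List (Fin n)} {j m : Fin n}
    (hjm : j < m) {x : Fin n → ℝ} (hx : x ∈ (rhombus (K + cnt u) j m).carrier) :
    (abscissa θ x ≤ abscissa θ
        (toReal K + trace θ (u ++ j :: m :: v) (height θ x - height θ (toReal K))) ∧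
      (abscissa θ x = abscissa θ
        (toReal K + trace θ (u ++ j :: m :: v) (height θ x - height θ (toReal K))) →
        x = toReal K + trace θ (u ++ j :: m :: v) (height θ x - height θ (toReal K)))) ∧
    (abscissa θ (toReal K + trace θ (u ++ m :: j :: v) (height θ x - height θ (toReal K))) ≤
        abscissa θ x ∧
      (abscissa θ (toReal K + trace θ (u ++ m :: j :: v) (height θ x - height θ (toReal K))) =
        abscissa θ x →
        x = toReal K + trace θ (u ++ m :: j :: v) (height θ x - height θ (toReal K)))) := by
  have hx' := hx
  rw [rhombus_comm] at hx'
  have hc := (mem_rhombus_iff hjm.ne).1 hx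
  have hc' := (mem_rhombus_iff hjm.ne').1 hx'
  rw [trace_of_mem_rhombus hθ hjm.ne hx, trace_of_mem_rhombus hθ hjm.ne' hx']
  obtain ⟨a1, a2⟩ := abscissa_le_trace_of_sorted hθ (w := [j, m]) (by simpa using hjm.le) hc
  obtain ⟨b1, b2⟩ := trace_le_abscissa_of_reverse_sorted hθ (w := [m, j]) (by simpa using hjm.le) hc'
  rw [map_sub (abscissa θ)] at a1 a2 b1 b2
  simp only [map_add (abscissa θ)]
  refine ⟨⟨by linarith, fun h => ?_⟩, by linarith, fun h => ?_⟩
  · rw [← a2 (by linarith)]; simp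
  · rw [← b2 (by linarith)]; simp

/-- The region between two lattice paths that differ by a rhombus is covered by this rhombus. -/
theorem exists_mem_rhombus (hθ : IsAngles θ) (K : Fin n → ℕ) {u v : List (Fin n)} {j m : Fin n}
    (hjm : j < m) {h X : ℝ}
    (hne : trace θ (u ++ m :: j :: v) h ≠ trace θ (u ++ j :: m :: v) h)
    (h1 : abscissa θ (toReal K + trace θ (u ++ m :: j :: v) h) ≤ X)
    (h2 : X ≤ abscissa θ (toReal K + trace θ (u ++ j :: m :: v) h)) :
    ∃ x ∈ (rhombus (K + cnt u) j m).carrier, abscissa θ x = X ∧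
      height θ x = height θ (toReal K) + h := by
  have hl : len θ [m, j] = len θ [j, m] := by rw [len, len, cnt_swap]
  have e1 := trace_middle (θ := θ) u [m, j] v h
  have e2 := trace_middle (θ := θ) u [j, m] v h
  simp only [List.cons_append, List.nil_append] at e1 e2
  set h' := h - len θ u with hh'
  have hpos : 0 < h' := by
    by_contra hc; push Not at hc
    exact hne (by rw [e1, e2, trace_of_nonpos hθ [m, j] hc, trace_of_nonpos hθ [j, m] hc, hl])
  have hlt : h' < len θ [j, m] := by
    by_contra hc; push Not at hc
    exact hne (by rw [e1, e2, trace_of_len_le hθ [m, j] (hl ▸ hc), trace_of_len_le hθ [j, m] hc, hl,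
      cnt_swap])
  rw [trace_of_len_le hθ u (by linarith), trace_of_nonpos hθ v (by linarith), add_zero] at e1 e2
  rw [e1] at h1 hne
  rw [e2] at h2 hne
  set p := trace θ [m, j] h' with hp
  set q := trace θ [j, m] h' with hq
  obtain ⟨g1, g2⟩ := trace_swap_le hθ hjm h'
  rw [← hp, ← hq] at g1 g2
  have hD : 0 < abscissa θ q - abscissa θ p := by
    rcases g1.lt_or_eq with h | h
    · linarith
    · exact absurd (by rw [g2 h]) hne
  have hpq : height θ p = h' ∧ height θ q = h' :=
    ⟨height_trace hθ _ hpos.le (hl ▸ hlt.le), height_trace hθ _ hpos.le hlt.le⟩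
  simp only [map_add] at h1 h2
  set A := abscissa θ (toReal K) + abscissa θ (toReal (cnt u)) with hA
  -- The wanted point divides the horizontal chord from the left boundary point `p` to the right
  -- boundary point `q` in the ratio prescribed by `X`.
  set t := (X - A - abscissa θ p) / (abscissa θ q - abscissa θ p) with ht
  have ht0 : 0 ≤ t := div_nonneg (by linarith) hD.le
  have ht1 : t ≤ 1 := (div_le_one hD).2 (by linarith)
  have htD : t * (abscissa θ q - abscissa θ p) = X - A - abscissa θ p := by
    rw [ht]; field_simp
  refine ⟨toReal (K + cnt u) + (p + t • (q - p)), ?_, ?_, ?_⟩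
  · rw [mem_rhombus_iff hjm.ne, add_sub_cancel_left]
    intro i
    have hpi := trace_nonneg_le (θ := θ) [m, j] h' i
    have hqi := trace_nonneg_le (θ := θ) [j, m] h' i
    rw [← hp, cnt_swap] at hpi
    rw [← hq] at hqi
    simp only [Pi.add_apply, Pi.smul_apply, Pi.sub_apply, smul_eq_mul]
    constructor <;> nlinarith
  · rw [toReal_add]
    simp only [map_add, map_smul, map_sub, smul_eq_mul]
    rw [htD]; ring
  · rw [toReal_add]
    simp only [map_add, map_smul, map_sub, smul_eq_mul, hpq.1, hpq.2, hh', len]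
    ring

theorem eq_of_height_eq_of_le (hθ : IsAngles θ) {x y : Fin n → ℝ} (h : height θ x = height θ y)
    (hle : ∀ i, x i ≤ y i) : x = y := by
  have hle' : ∀ i ∈ Finset.univ, 0 ≤ (y i - x i) * Real.sin (θ i) := fun i _ =>
    mul_nonneg (sub_nonneg.2 (hle i)) (hθ.sin_pos i).le
  have hs : ∑ i, (y i - x i) * Real.sin (θ i) = 0 := by
    have := height_apply (θ := θ) (y - x)
    rw [map_sub, h, sub_self] at this
    simpa using this.symm
  have := (Finset.sum_eq_zero_iff_of_nonneg hle').1 hs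
  ext i
  rcases mul_eq_zero.1 (this i (Finset.mem_univ i)) with h | h
  · linarith
  · exact absurd h (hθ.sin_pos i).ne'

theorem proj_eq_iff {x y : Fin n → ℝ} :
    proj θ x = proj θ y ↔ abscissa θ x = abscissa θ y ∧ height θ x = height θ y := by
  rw [proj_eq, proj_eq, Prod.mk.injEq]

/-- If the two coordinates of a point vary in the same sense, the height changes; if they vary in
opposite senses at equal height, the abscissa changes. -/
theorem proj_injOn_rhombus (hθ : IsAngles θ) {K : Fin n → ℕ} {j m : Fin n}
    (hjm : j < m) {x y : Fin n → ℝ} (hx : x ∈ (rhombus K j m).carrier)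
    (hy : y ∈ (rhombus K j m).carrier) (h : proj θ x = proj θ y) : x = y := by
  rw [proj_eq_iff] at h
  rw [mem_rhombus_iff hjm.ne] at hx hy
  have hz : ∀ i, i ≠ j → i ≠ m → x i = y i := by
    intro i h1 h2
    have a := hx i
    have b := hy i
    rw [cnt_pair hjm.ne, if_neg (by simp [h1, h2])] at a b
    simp only [Pi.sub_apply, toReal_apply] at a b
    linarith
  rcases le_total (x j) (y j) with hj | hj <;> rcases le_total (x m) (y m) with hm | hm
  · refine eq_of_height_eq_of_le hθ h.2 fun i => ?_
    by_cases h1 : i = j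
    · rwa [h1]
    by_cases h2 : i = m
    · rwa [h2]
    exact (hz i h1 h2).le
  · refine (abscissa_le_of_height_eq hθ h.2 j (fun i hi => (hz i hi.ne (hi.trans hjm).ne).le)
      (fun i hi => ?_)).2 h.1
    by_cases h2 : i = m
    · rwa [h2]
    · exact (hz i hi.ne' h2).ge
  · refine ((abscissa_le_of_height_eq hθ h.2.symm j
      (fun i hi => (hz i hi.ne (hi.trans hjm).ne).ge) (fun i hi => ?_)).2 h.1.symm).symm
    by_cases h2 : i = m
    · rwa [h2]
    · exact (hz i hi.ne' h2).le
  · refine (eq_of_height_eq_of_le hθ h.2.symm fun i => ?_).symm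
    by_cases h1 : i = j
    · rwa [h1]
    by_cases h2 : i = m
    · rwa [h2]
    exact (hz i h1 h2).ge

/-- `Sweep K w L w'`: the lattice path `w` starting from `K` can be moved to `w'` by successively
swapping ascents, and `L` is the set of rhombi passed in this way. -/
inductive Sweep (K : Fin n → ℕ) (w : List (Fin n)) : Set (Cell n) → List (Fin n) → Prop
  | refl : Sweep K w ∅ w
  | step {L : Set (Cell n)} {u v : List (Fin n)} {j m : Fin n} (hjm : j < m)
      (h : Sweep K w L (u ++ j :: m :: v)) :
      Sweep K w (insert (rhombus (K + cnt u) j m) L) (u ++ m :: j :: v)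

namespace Sweep

variable {K : Fin n → ℕ} {w w' w'' : List (Fin n)} {L M : Set (Cell n)}

theorem trans (h : Sweep K w L w') (h' : Sweep K w' M w'') : Sweep K w (L ∪ M) w'' := by
  induction h' with
  | refl => simpa using h
  | step hjm _ ih => rw [Set.union_insert]; exact .step hjm ih

theorem append_context (u₀ v₀ : List (Fin n)) (h : Sweep (K + cnt u₀) w L w') :
    Sweep K (u₀ ++ w ++ v₀) L (u₀ ++ w' ++ v₀) := by
  induction h with
  | refl => exact .refl
  | @step L u v j m hjm _ ih =>
    have e : K + cnt u₀ + cnt u = K + cnt (u₀ ++ u) := by rw [cnt_append, add_assoc]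
    have := ih
    rw [show u₀ ++ (u ++ j :: m :: v) ++ v₀ = (u₀ ++ u) ++ j :: m :: (v ++ v₀) by simp] at this
    have := Sweep.step hjm this
    rw [e]
    simpa using this

theorem perm (h : Sweep K w L w') : w'.Perm w := by
  induction h with
  | refl => exact .refl _
  | step hjm _ ih => exact ((List.Perm.swap _ _ _).append_left _).trans ih

theorem cnt_eq (h : Sweep K w L w') : cnt w' = cnt w := by
  ext i; exact h.perm.count_eq i

theorem finite (h : Sweep K w L w') : L.Finite := by
  induction h with
  | refl => exact Set.finite_empty
  | step _ _ ih => exact ih.insert _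

theorem card_dirs (h : Sweep K w L w') : ∀ f ∈ L, f.dirs.card = 2 := by
  induction h with
  | refl => simp
  | step hjm _ ih =>
    rintro f (rfl | hf)
    · exact Finset.card_pair hjm.ne
    · exact ih f hf

theorem carrier_subset (h : Sweep K w L w') : ∀ f ∈ L, ∀ x ∈ f.carrier,
    x - toReal K ∈ cbox (cnt w) := by
  induction h with
  | refl => simp
  | @step L u v j m hjm h ih =>
    rintro f (rfl | hf) x hx
    · rw [mem_rhombus_iff hjm.ne] at hx
      have e : cnt w = cnt u + (cnt [j, m] + cnt v) := by
        rw [← h.cnt_eq, ← cnt_append, ← cnt_append]; rfl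
      intro i
      have := hx i
      rw [e]
      simp only [Pi.sub_apply, toReal_apply, Pi.add_apply, Nat.cast_add] at this ⊢
      constructor <;> [skip; skip] <;> [have := this.1; have := this.2] <;>
        nlinarith [(cnt u i).cast_nonneg (α := ℝ), (cnt v i).cast_nonneg (α := ℝ)]
    · exact ih f hf x hx

/-- What has been passed stays on the right of the path, because every further swap moves the path
to the left. The equality clause says that contact occurs on the path itself, with the same
preimage. -/
theorem left_bound (hθ : IsAngles θ) (h : Sweep K w L w') : ∀ x ∈ union L,
    abscissa θ (toReal K + trace θ w' (height θ x - height θ (toReal K))) ≤ abscissa θ x ∧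
      (abscissa θ (toReal K + trace θ w' (height θ x - height θ (toReal K))) = abscissa θ x →
        x = toReal K + trace θ w' (height θ x - height θ (toReal K))) := by
  induction h with
  | refl => rintro x ⟨f, hf, -⟩; exact absurd hf (Set.notMem_empty f)
  | @step L u v j m hjm h ih =>
    rintro x ⟨f, rfl | hf, hx⟩
    · exact (rhombus_between hθ hjm hx).2
    · obtain ⟨h1, h2⟩ := ih x ⟨f, hf, hx⟩
      obtain ⟨g1, g2⟩ := trace_step_le hθ (u := u) (v := v) hjm (height θ x - height θ (toReal K))
      simp only [map_add] at h1 h2 ⊢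
      refine ⟨by linarith, fun e => ?_⟩
      rw [g2 (by linarith)]
      exact h2 (by linarith)

/-- A newly passed rhombus lies to the left of the path and all earlier ones to the right. A common
image point is therefore on the path, where both preimages equal the point of the trace. -/
theorem injOn (hθ : IsAngles θ) (h : Sweep K w L w') : Set.InjOn (proj θ) (union L) := by
  induction h with
  | refl => rintro x ⟨f, hf, -⟩; exact absurd hf (Set.notMem_empty f)
  | @step L u v j m hjm h ih =>
    have key : ∀ x ∈ (rhombus (K + cnt u) j m).carrier, ∀ y ∈ union L, proj θ x = proj θ y →
        x = y := by
      intro x hx y hy hxy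
      rw [proj_eq_iff] at hxy
      obtain ⟨⟨h1, h2⟩, -⟩ := rhombus_between hθ (v := v) hjm hx
      obtain ⟨h3, h4⟩ := h.left_bound hθ y hy
      rw [hxy.1, hxy.2] at h1 h2
      exact (h2 (le_antisymm h1 h3)).trans (h4 (le_antisymm h3 h1)).symm
    rintro x ⟨f, rfl | hf, hx⟩ y ⟨g, rfl | hg, hy⟩ hxy
    · exact proj_injOn_rhombus hθ hjm hx hy hxy
    · exact key x hx y ⟨g, hg, hy⟩ hxy
    · exact (key y hy x ⟨f, hf, hx⟩ hxy.symm).symm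
    · exact ih ⟨f, hf, hx⟩ ⟨g, hg, hy⟩ hxy

/-- At each height where the two paths differ, the chord between them is covered step by step. Where
they coincide nothing needs to have been passed, whence the inequality assumed. -/
theorem fills (hθ : IsAngles θ) (h : Sweep K w L w') : ∀ t X : ℝ,
    trace θ w' t ≠ trace θ w t → abscissa θ (toReal K + trace θ w' t) ≤ X →
    X ≤ abscissa θ (toReal K + trace θ w t) →
    ∃ x ∈ union L, abscissa θ x = X ∧ height θ x = height θ (toReal K) + t := by
  induction h with
  | refl => exact fun t X h => absurd rfl h
  | @step L u v j m hjm h ih =>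
    intro t X hne h1 h2
    by_cases hc : trace θ (u ++ m :: j :: v) t ≠ trace θ (u ++ j :: m :: v) t ∧
        X ≤ abscissa θ (toReal K + trace θ (u ++ j :: m :: v) t)
    · obtain ⟨x, hx, e⟩ := exists_mem_rhombus hθ K hjm hc.1 h1 hc.2
      exact ⟨x, ⟨_, Set.mem_insert _ _, hx⟩, e⟩
    · have hex : ∃ x ∈ union L, abscissa θ x = X ∧ height θ x = height θ (toReal K) + t := by
        by_cases hc1 : trace θ (u ++ m :: j :: v) t = trace θ (u ++ j :: m :: v) t
        · rw [hc1] at hne h1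
          exact ih t X hne h1 h2
        · have hlt : abscissa θ (toReal K + trace θ (u ++ j :: m :: v) t) < X := by
            by_contra hlt; push Not at hlt; exact hc ⟨hc1, hlt⟩
          refine ih t X (fun e => ?_) hlt.le h2
          rw [e] at hlt; linarith
      obtain ⟨x, ⟨f, hf, hx⟩, e⟩ := hex
      exact ⟨x, ⟨f, Set.mem_insert_of_mem _ hf, hx⟩, e⟩

end Sweep

end Zonogon

/-! ### Complete sweeps as tilings -/

namespace Zonogon

variable {n : ℕ} {θ : Fin n → ℝ}

theorem Cell.carrier_eq_Icc (c : Cell n) : c.carrier =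
    Set.Icc (toReal c.base) (fun i => (c.base i : ℝ) + if i ∈ c.dirs then 1 else 0) := by
  ext x
  exact ⟨fun h => ⟨fun i => (h i).1, fun i => (h i).2⟩, fun h i => ⟨h.1 i, h.2 i⟩⟩

theorem Cell.isCompact_carrier (c : Cell n) : IsCompact c.carrier := by
  rw [c.carrier_eq_Icc]; exact isCompact_Icc

theorem union_eq_biUnion (F : Set (Cell n)) : union F = ⋃ f ∈ F, f.carrier := by
  ext x; simp [union]

theorem union_mono {F G : Set (Cell n)} (h : F ⊆ G) : union F ⊆ union G :=
  fun _ ⟨f, hf, hx⟩ => ⟨f, h hf, hx⟩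

theorem isCompact_union {F : Set (Cell n)} (hF : F.Finite) : IsCompact (union F) := by
  rw [union_eq_biUnion]
  exact hF.isCompact_biUnion fun f _ => f.isCompact_carrier

theorem continuous_proj (θ : Fin n → ℝ) : Continuous (proj θ) := by
  unfold proj; fun_prop

/-- A finite union of cells is compact, so a continuous injection of it into the plane is a
homeomorphism onto its image. -/
theorem tiles_of_injOn {F : Set (Cell n)} (hF : F.Finite) (hcard : ∀ f ∈ F, f.dirs.card = 2)
    (hinj : Set.InjOn (proj θ) (union F)) {R : Set (ℝ × ℝ)} (himg : proj θ '' union F = R) :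
    Tiles θ F R := by
  refine ⟨hcard, ?_⟩
  subst himg
  have := isCompact_iff_compactSpace.1 (isCompact_union hF)
  let e := Equiv.Set.imageOfInjOn (proj θ) (union F) hinj
  have hc : Continuous e := by
    refine Continuous.subtype_mk ((continuous_proj θ).comp continuous_subtype_val) _
  exact ⟨hc.homeoOfEquivCompactToT2, fun x => rfl⟩

theorem Tiles.injOn {F : Set (Cell n)} {R : Set (ℝ × ℝ)} (h : Tiles θ F R) :
    Set.InjOn (proj θ) (union F) := by
  obtain ⟨-, e, he⟩ := h
  intro x hx y hy hxy
  have : e ⟨x, hx⟩ = e ⟨y, hy⟩ := Subtype.ext (by rw [he, he]; exact hxy)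
  exact congrArg Subtype.val (e.injective this)

theorem Tiles.exists_of_mem {F : Set (Cell n)} {R : Set (ℝ × ℝ)} (h : Tiles θ F R) {y : ℝ × ℝ}
    (hy : y ∈ R) : ∃ x ∈ union F, proj θ x = y := by
  obtain ⟨-, e, he⟩ := h
  refine ⟨e.symm ⟨y, hy⟩, (e.symm ⟨y, hy⟩).2, ?_⟩
  rw [← he, Homeomorph.apply_symm_apply]

theorem toReal_single (j : Fin n) : toReal (Pi.single j 1 : Fin n → ℕ) = Pi.single j (1 : ℝ) := by
  ext i; simp [Pi.single_apply]

theorem sub_toReal_mem_cbox_add (K : Fin n → ℕ) {x : Fin n → ℝ} {L : Fin n → ℕ} :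
    x - toReal K ∈ cbox L ↔ ∀ i, (K i : ℝ) ≤ x i ∧ x i ≤ K i + L i := by
  refine forall_congr' fun i => ?_
  simp only [Pi.sub_apply, toReal_apply]
  constructor <;> rintro ⟨h1, h2⟩ <;> constructor <;> linarith

namespace Sweep

variable {K : Fin n → ℕ} {w w' w'' : List (Fin n)} {L M : Set (Cell n)}

/-- The rhombi between the right and the left boundary path tile the zonogon. -/
theorem tiles (hθ : IsAngles θ) (h : Sweep K w L w') (hw : w.Pairwise (· ≤ ·))
    (hw' : w'.Pairwise (· ≥ ·)) {p q : Fin n} (hpq : p ≠ q) (hp : 0 < cnt w p) (hq : 0 < cnt w q) :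
    Tiles θ L (proj θ '' {x | x - toReal K ∈ cbox (cnt w)}) := by
  refine tiles_of_injOn h.finite h.card_dirs (h.injOn hθ) (Set.Subset.antisymm ?_ ?_)
  · rintro _ ⟨x, ⟨f, hf, hx⟩, rfl⟩
    exact ⟨x, h.carrier_subset f hf x hx, rfl⟩
  · have hclosed : IsClosed (proj θ '' union L) :=
      ((isCompact_union h.finite).image (continuous_proj θ)).isClosed
    rintro _ ⟨x, hx, rfl⟩
    -- A boundary point has at most one coordinate strictly between its bounds. Two such coordinates
    -- `p` and `q` thus force the left and right boundaries to differ at the height of `y`, and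
    -- `fills` applies.
    have key : ∀ y, y - toReal K ∈ cbox (cnt w) → (0 < (y - toReal K) p) →
        ((y - toReal K) p < cnt w p) → (0 < (y - toReal K) q) →
        ((y - toReal K) q < cnt w q) → proj θ y ∈ proj θ '' union L := by
      intro y hy hp0 hp1 hq0 hq1
      obtain ⟨b1, b2⟩ := abscissa_le_trace_of_sorted hθ hw hy
      obtain ⟨c1, -⟩ := trace_le_abscissa_of_reverse_sorted hθ hw' (h.cnt_eq ▸ hy)
      set t := height θ (y - toReal K) with ht
      have hne : trace θ w' t ≠ trace θ w t := by
        intro e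
        rw [e] at c1
        have hy' := b2 (le_antisymm b1 c1)
        obtain ⟨i, hl, hr⟩ := trace_of_sorted w hw hθ t p
        rw [← hy'] at hl hr
        have aux : ∀ m, 0 < (y - toReal K) m → (y - toReal K) m < cnt w m → m = i := by
          intro m h0 h1
          rcases lt_trichotomy m i with hm | hm | hm
          · rw [hl m hm] at h1; exact absurd h1 (lt_irrefl _)
          · exact hm
          · rw [hr m hm] at h0; exact absurd h0 (lt_irrefl _)
        exact hpq ((aux p hp0 hp1).trans (aux q hq0 hq1).symm)
      obtain ⟨z, hz, e1, e2⟩ := h.fills hθ t (abscissa θ y) hne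
        (by rw [map_add]; rw [map_sub] at c1; linarith)
        (by rw [map_add]; rw [map_sub] at b1; linarith)
      refine ⟨z, hz, proj_eq_iff.2 ⟨e1, ?_⟩⟩
      rw [e2, ht, map_sub]; ring
    -- The remaining points are limits of points moved slightly towards the centre of the box, and
    -- the covered set is closed.
    let c : ℝ → Fin n → ℝ := fun s => x + s • ((1 / 2 : ℝ) • toReal (cnt w) - (x - toReal K))
    have hc : Filter.Tendsto (fun s => proj θ (c s)) (nhdsWithin 0 (Set.Ioi 0)) (nhds (proj θ x)) := by
      have h1 : Continuous fun s => proj θ (c s) := (continuous_proj θ).comp (by fun_prop)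
      have h2 : c 0 = x := by simp [c]
      have := h1.tendsto 0
      rw [h2] at this
      exact this.mono_left nhdsWithin_le_nhds
    refine hclosed.mem_of_tendsto hc ?_
    filter_upwards [Ioo_mem_nhdsGT (show (0 : ℝ) < 1 by norm_num)] with s hs
    have hval : ∀ i, (c s - toReal K) i = (1 - s) * (x - toReal K) i + s * (cnt w i / 2) := by
      intro i
      simp only [c, Pi.sub_apply, Pi.add_apply, Pi.smul_apply, smul_eq_mul, toReal_apply]; ring
    obtain ⟨hs0, hs1⟩ := hs
    have hbase : ∀ i, 0 ≤ (c s - toReal K) i ∧ (c s - toReal K) i ≤ cnt w i := by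
      intro i
      rw [hval]
      obtain ⟨h1, h2⟩ := hx i
      have h3 : (0 : ℝ) ≤ cnt w i := Nat.cast_nonneg _
      constructor <;> nlinarith
    have hstrict : ∀ i, 0 < cnt w i → 0 < (c s - toReal K) i ∧ (c s - toReal K) i < cnt w i := by
      intro i hi
      rw [hval]
      obtain ⟨h1, h2⟩ := hx i
      have h3 : (0 : ℝ) < cnt w i := Nat.cast_pos.2 hi
      constructor <;> nlinarith
    exact key _ hbase (hstrict p hp).1 (hstrict p hp).2 (hstrict q hq).1 (hstrict q hq).2

/-- If the next rhombus had been passed already, its centre would be on both sides of the path and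
hence on it. But at the height of the centre the path has covered more than half of the step `j`. -/
theorem rhombus_notMem (hθ : IsAngles θ) {u v : List (Fin n)} {j m : Fin n} (hjm : j < m)
    (h : Sweep K w L (u ++ j :: m :: v)) : rhombus (K + cnt u) j m ∉ L := by
  intro hL
  let y : Fin n → ℝ := Pi.single j (1 / 2) + Pi.single m (1 / 2)
  have hy : y ∈ cbox (cnt [j, m]) := by
    intro i
    rw [cnt_pair hjm.ne]
    simp only [y, Pi.add_apply, Pi.single_apply, Finset.mem_insert, Finset.mem_singleton]
    by_cases h1 : i = j <;> by_cases h2 : i = m <;> simp_all <;> norm_num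
  have hx : toReal (K + cnt u) + y ∈ (rhombus (K + cnt u) j m).carrier := by
    rw [mem_rhombus_iff hjm.ne, add_sub_cancel_left]; exact hy
  obtain ⟨⟨h1, h2⟩, -⟩ := rhombus_between hθ (v := v) hjm hx
  obtain ⟨h3, -⟩ := h.left_bound hθ _ ⟨_, hL, hx⟩
  have e := h2 (le_antisymm h1 h3)
  rw [trace_of_mem_rhombus hθ hjm.ne hx, add_sub_cancel_left] at e
  have e := congrFun (add_left_cancel e) j
  have hs := hθ.sin_pos j
  have hs' := hθ.sin_pos m
  have hh : height θ y = (Real.sin (θ j) + Real.sin (θ m)) / 2 := by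
    simp only [y, map_add, height_single]; ring
  rw [hh] at e
  simp only [y, trace, Pi.add_apply, Pi.single_eq_same, Pi.single_eq_of_ne hjm.ne, add_zero]
    at e
  have hlt : (1 / 2 : ℝ) < (Real.sin (θ j) + Real.sin (θ m)) / 2 / Real.sin (θ j) := by
    rw [lt_div_iff₀ hs]; linarith
  have : (1 / 2 : ℝ) < max 0 (min ((Real.sin (θ j) + Real.sin (θ m)) / 2 / Real.sin (θ j)) 1) :=
    lt_max_of_lt_right (lt_min hlt (by norm_num))
  linarith

theorem disjoint (hθ : IsAngles θ) (h : Sweep K w L w') (h' : Sweep K w' M w'') :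
    Disjoint L M := by
  induction h' with
  | refl => simp
  | step hjm h' ih =>
    rw [Set.disjoint_insert_right]
    exact ⟨fun hL => (h.trans h').rhombus_notMem hθ hjm (Or.inl hL), ih⟩

end Sweep

/-- Two points of a set on which the projection is injective
cannot differ by a linear relation between three of the vectors. -/
theorem false_of_relation (hθ : IsAngles θ) {S : Set (Fin n → ℝ)} (hS : Set.InjOn (proj θ) S)
    {p q r : Fin n} (hpq : p < q) (hqr : q < r) {x y : Fin n → ℝ} (hx : x ∈ S) (hy : y ∈ S)
    (h : x + Pi.single q (Real.sin (θ r - θ p)) =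
      y + (Pi.single p (Real.sin (θ r - θ q)) + Pi.single r (Real.sin (θ q - θ p)))) : False := by
  have h1 := congrArg (abscissa θ) h
  have h2 := congrArg (height θ) h
  simp only [map_add, abscissa_single, height_single] at h1 h2
  have e1 : Real.sin (θ r - θ p) * Real.cos (θ q) =
      Real.sin (θ r - θ q) * Real.cos (θ p) + Real.sin (θ q - θ p) * Real.cos (θ r) := by
    simp only [Real.sin_sub]; ring
  have e2 : Real.sin (θ r - θ p) * Real.sin (θ q) =
      Real.sin (θ r - θ q) * Real.sin (θ p) + Real.sin (θ q - θ p) * Real.sin (θ r) := by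
    simp only [Real.sin_sub]; ring
  have hxy : x = y := hS hx hy (proj_eq_iff.2 ⟨by linarith, by linarith⟩)
  rw [hxy] at h
  have := congrFun (add_left_cancel h) q
  simp only [Pi.add_apply, Pi.single_eq_same, Pi.single_eq_of_ne hpq.ne',
    Pi.single_eq_of_ne hqr.ne, add_zero] at this
  exact (hθ.sin_sub_pos (hpq.trans hqr)).ne' this

theorem mem_rhombus (K : Fin n → ℕ) {j m : Fin n} (hjm : j ≠ m) {s t : ℝ} (hs : s ∈ Set.Icc 0 1)
    (ht : t ∈ Set.Icc 0 1) :
    toReal K + (Pi.single j s + Pi.single m t) ∈ (rhombus K j m).carrier := by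
  rw [mem_rhombus_iff hjm, add_sub_cancel_left]
  intro i
  rw [cnt_pair hjm]
  simp only [Pi.add_apply, Pi.single_apply, Finset.mem_insert, Finset.mem_singleton]
  obtain ⟨h1, h2⟩ := hs
  obtain ⟨h3, h4⟩ := ht
  by_cases h5 : i = j <;> by_cases h6 : i = m <;> simp_all

theorem IsAngles.sin_mem (hθ : IsAngles θ) {i j : Fin n} (h : i < j) :
    Real.sin (θ j - θ i) ∈ Set.Icc (0 : ℝ) 1 :=
  ⟨(hθ.sin_sub_pos h).le, Real.sin_le_one _⟩

theorem one_sub_mem_Icc {t : ℝ} (h : t ∈ Set.Icc (0 : ℝ) 1) : 1 - t ∈ Set.Icc (0 : ℝ) 1 :=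
  ⟨by linarith [h.2], by linarith [h.1]⟩

end Zonogon

/-! ### Edges inside a tiling -/

namespace Zonogon

variable {n : ℕ} {θ : Fin n → ℝ} {a : Fin n → ℕ}

theorem finite_of_subset_box {F : Set (Cell n)} (hF : ∀ f ∈ F, f.carrier ⊆ box a) : F.Finite := by
  have hfin : {p : (Fin n → ℕ) × Finset (Fin n) | p.1 ∈ Set.Icc 0 a}.Finite := by
    have : {p : (Fin n → ℕ) × Finset (Fin n) | p.1 ∈ Set.Icc 0 a} = Set.Icc 0 a ×ˢ Set.univ := by
      ext; simp
    rw [this]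
    exact (Set.finite_Icc _ _).prod Set.finite_univ
  refine (hfin.preimage (f := fun c : Cell n => (c.base, c.dirs)) ?_).subset fun f hf => ?_
  · intro x _ y _ h
    exact Cell.ext (congrArg Prod.fst h) (congrArg Prod.snd h)
  · have hmem : toReal f.base ∈ f.carrier := fun i => ⟨le_rfl, by
      simp only [toReal_apply]; split_ifs <;> linarith⟩
    exact ⟨fun i => Nat.zero_le _, fun i => by
      have : (f.base i : ℝ) ≤ a i := (hF f hf hmem i).2
      show f.base i ≤ a i
      exact_mod_cast this⟩

/-- The lattice path from `K` with steps `w` lies in `S`. -/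
def PathIn (S : Set (Fin n → ℝ)) : (Fin n → ℕ) → List (Fin n) → Prop
  | _, [] => True
  | K, j :: w => (∀ t ∈ Set.Icc (0 : ℝ) 1, toReal K + Pi.single j t ∈ S) ∧
      PathIn S (K + Pi.single j 1) w

theorem pathIn_append {S : Set (Fin n → ℝ)} {K : Fin n → ℕ} {u v : List (Fin n)} :
    PathIn S K (u ++ v) ↔ PathIn S K u ∧ PathIn S (K + cnt u) v := by
  induction u generalizing K with
  | nil => simp [PathIn, cnt_nil]
  | cons j u ih =>
    simp only [List.cons_append, PathIn, ih, cnt_cons, and_assoc, add_assoc]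

theorem PathIn.swap {S : Set (Fin n → ℝ)} {K : Fin n → ℕ} {u v : List (Fin n)} {j m : Fin n}
    (hjm : j ≠ m) (h : PathIn S K (u ++ j :: m :: v))
    (hr : (rhombus (K + cnt u) j m).carrier ⊆ S) : PathIn S K (u ++ m :: j :: v) := by
  rw [pathIn_append] at h ⊢
  refine ⟨h.1, fun t ht => ?_, fun t ht => ?_, ?_⟩
  · have := mem_rhombus (K + cnt u) hjm (s := 0) (by simp) ht
    rw [Pi.single_zero, zero_add] at this
    exact hr this
  · have := mem_rhombus (K + cnt u) hjm ht (t := 1) (by simp)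
    rw [toReal_add (K + cnt u), toReal_single, add_assoc, add_comm (Pi.single m 1)]
    exact hr this
  · have := h.2.2.2
    rwa [add_right_comm]

namespace Tiling

variable (T : Tiling a θ)

theorem finite_rhombi : T.rhombi.Finite := finite_of_subset_box T.subset_box

theorem injOn : Set.InjOn (proj θ) (union T.rhombi) := T.tiles.injOn

variable {T}

theorem false_of_relation (hθ : IsAngles θ) {p q r : Fin n} (hpq : p < q) (hqr : q < r)
    {x y : Fin n → ℝ} (hx : x ∈ union T.rhombi) (hy : y ∈ union T.rhombi)
    (h : x + Pi.single q (Real.sin (θ r - θ p)) =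
      y + (Pi.single p (Real.sin (θ r - θ q)) + Pi.single r (Real.sin (θ q - θ p)))) : False :=
  Zonogon.false_of_relation hθ T.injOn hpq hqr hx hy h

theorem mem_union {K : Fin n → ℕ} {j m : Fin n} (h : rhombus K j m ∈ T.rhombi) (hjm : j ≠ m)
    {s t : ℝ} (hs : s ∈ Set.Icc 0 1) (ht : t ∈ Set.Icc 0 1) :
    toReal K + (Pi.single j s + Pi.single m t) ∈ union T.rhombi :=
  ⟨_, h, mem_rhombus K hjm hs ht⟩

/-- An edge of the tiling that does not lie on the left boundary bounds a rhombus on its left. -/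
theorem exists_left_rhombus (hθ : IsAngles θ) {J : Fin n → ℕ} {j : Fin n}
    (hedge : ∀ t ∈ Set.Icc (0 : ℝ) 1, toReal J + Pi.single j t ∈ union T.rhombi) {m : Fin n}
    (hm : (j < m ∧ J m + 1 ≤ a m) ∨ (m < j ∧ 0 < J m)) :
    ∃ m', (j < m' ∧ rhombus J j m' ∈ T.rhombi) ∨
      (m' < j ∧ ∃ B, J = B + Pi.single m' 1 ∧ rhombus B m' j ∈ T.rhombi) := by
  set mid : Fin n → ℝ := toReal J + Pi.single j (1 / 2) with hmid
  have hmidS : mid ∈ union T.rhombi := hedge _ (by constructor <;> norm_num)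
  have hmidbox : mid ∈ box a := by
    obtain ⟨f, hf, hx⟩ := hmidS
    exact T.subset_box f hf hx
  -- From the midpoint of the edge one moves in the direction `e_m` or `-e_m`, whichever leads to
  -- the left of `v_j`; the assumption on `m` keeps the motion in the box.
  obtain ⟨c, hc, hcD⟩ : ∃ c : ℝ, (∀ t ∈ Set.Icc (0 : ℝ) 1, mid + Pi.single m (c * t) ∈ box a) ∧
      0 < c * Real.sin (θ m - θ j) := by
    rcases hm with ⟨h1, h2⟩ | ⟨h1, h2⟩
    · refine ⟨1, fun t ht i => ?_, by rw [one_mul]; exact hθ.sin_sub_pos h1⟩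
      have := hmidbox i
      by_cases hi : i = m
      · subst hi
        have h2' : (J i : ℝ) + 1 ≤ a i := by exact_mod_cast h2
        simp only [hmid, Pi.add_apply, toReal_apply, Pi.single_eq_of_ne h1.ne', Pi.single_eq_same,
          add_zero, one_mul] at this ⊢
        exact ⟨by linarith [ht.1], by linarith [ht.2]⟩
      · simpa [Pi.single_eq_of_ne hi] using this
    · refine ⟨-1, fun t ht i => ?_, by nlinarith [hθ.sin_sub_neg h1]⟩
      have := hmidbox i
      by_cases hi : i = m
      · subst hi
        have h2' : (1 : ℝ) ≤ J i := by exact_mod_cast h2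
        simp only [hmid, Pi.add_apply, toReal_apply, Pi.single_eq_of_ne h1.ne, Pi.single_eq_same,
          add_zero] at this ⊢
        exact ⟨by linarith [ht.2], by linarith [ht.1]⟩
      · simpa [Pi.single_eq_of_ne hi] using this
  obtain ⟨-, e, he⟩ := T.tiles
  -- The projected motion is lifted back to the tiling by the inverse homeomorphism.
  let z : unitInterval → union T.rhombi := fun t =>
    e.symm ⟨proj θ (mid + Pi.single m (c * t)), _, hc t t.2, rfl⟩
  have hz : ∀ t, proj θ (z t) = proj θ (mid + Pi.single m (c * t)) := fun t => by
    rw [← he, Homeomorph.apply_symm_apply]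
  have hzc : Continuous fun t => (z t : Fin n → ℝ) := by
    refine continuous_subtype_val.comp (e.symm.continuous.comp
      (Continuous.subtype_mk ((continuous_proj θ).comp ?_) _))
    refine continuous_const.add ?_
    exact (continuous_single (A := fun _ => ℝ) m).comp (by fun_prop)
  have hz0 : (z 0 : Fin n → ℝ) = mid :=
    T.injOn (z 0).2 hmidS (by rw [hz]; simp)
  -- The finitely many rhombi avoiding the midpoint form a closed set, so for small times the lift
  -- lies in a rhombus containing the midpoint.
  have hbad : IsClosed (⋃ f ∈ {f ∈ T.rhombi | mid ∉ f.carrier}, f.carrier) :=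
    (T.finite_rhombi.subset (Set.sep_subset _ _)).isClosed_biUnion
      fun f _ => f.isCompact_carrier.isClosed
  have hopen := hbad.isOpen_compl.preimage hzc
  have h0mem : (0 : unitInterval) ∈ (fun t => (z t : Fin n → ℝ)) ⁻¹'
      (⋃ f ∈ {f ∈ T.rhombi | mid ∉ f.carrier}, f.carrier)ᶜ := by
    rw [Set.mem_preimage, hz0]
    simp only [Set.mem_compl_iff, Set.mem_iUnion, not_exists]
    exact fun f hf => hf.2
  obtain ⟨t, htpos, ht⟩ : ∃ t : unitInterval, 0 < (t : ℝ) ∧ (z t : Fin n → ℝ) ∉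
      ⋃ f ∈ {f ∈ T.rhombi | mid ∉ f.carrier}, f.carrier := by
    have h1 : Filter.Tendsto (fun s : ℝ => Set.projIcc (0 : ℝ) 1 zero_le_one s)
        (nhdsWithin 0 (Set.Ioi 0)) (nhds 0) := by
      have h2 := (continuous_projIcc (a := (0 : ℝ)) (b := 1) (h := zero_le_one)).tendsto 0
      rw [Set.projIcc_left] at h2
      exact h2.mono_left nhdsWithin_le_nhds
    have h3 := (h1.eventually (hopen.mem_nhds h0mem)).and
      (Ioo_mem_nhdsGT (show (0 : ℝ) < 1 by norm_num))
    obtain ⟨s, hs, hs'⟩ := h3.exists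
    refine ⟨_, ?_, hs⟩
    rw [Set.projIcc_of_mem zero_le_one ⟨hs'.1.le, hs'.2.le⟩]
    exact hs'.1
  obtain ⟨f, hf, hzf⟩ := (z t).2
  have hmf : mid ∈ f.carrier := by
    by_contra hmf
    exact ht (Set.mem_biUnion (show f ∈ {f ∈ T.rhombi | mid ∉ f.carrier} from ⟨hf, hmf⟩) hzf)
  have hother : ∀ i, i ≠ j → f.base i ≤ J i ∧ J i ≤ f.base i + if i ∈ f.dirs then 1 else 0 := by
    intro i hi
    have := hmf i
    simp only [hmid, Pi.add_apply, toReal_apply, Pi.single_eq_of_ne hi, add_zero] at this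
    exact ⟨by exact_mod_cast this.1, by split_ifs at this ⊢ <;> exact_mod_cast this.2⟩
  -- The `j`-coordinate of the midpoint is half-integral, so the rhombus extends in the direction
  -- `j`.
  have hj : j ∈ f.dirs ∧ f.base j = J j := by
    have := hmf j
    simp only [hmid, Pi.add_apply, toReal_apply, Pi.single_eq_same] at this
    obtain ⟨h1, h2⟩ := this
    have h3 : f.base j ≤ J j := by
      have : (f.base j : ℝ) < (J j + 1 : ℕ) := by push_cast; linarith
      have : f.base j < J j + 1 := by exact_mod_cast this
      omega
    split_ifs at h2 with hjd
    · refine ⟨hjd, le_antisymm h3 ?_⟩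
      have : ((J j : ℕ) : ℝ) < (f.base j + 1 : ℕ) := by push_cast; linarith
      have : J j < f.base j + 1 := by exact_mod_cast this
      omega
    · have : (f.base j : ℝ) ≤ J j := by exact_mod_cast h3
      linarith
  obtain ⟨m', hm', hdirs⟩ : ∃ m', m' ≠ j ∧ f.dirs = {j, m'} := by
    have h2 := T.tiles.1 f hf
    obtain ⟨p, q, hpq, e⟩ := Finset.card_eq_two.1 h2
    have := hj.1
    rw [e, Finset.mem_insert, Finset.mem_singleton] at this
    rcases this with rfl | rfl
    · exact ⟨q, hpq.symm, e⟩
    · exact ⟨p, hpq, by rw [e, Finset.pair_comm]⟩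
  have hfix : ∀ i, i ≠ j → i ≠ m' → f.base i = J i ∧ (z t : Fin n → ℝ) i = J i := by
    intro i h1 h2
    have hnd : i ∉ f.dirs := by rw [hdirs]; simp [h1, h2]
    have h3 := hother i h1
    have h4 := hzf i
    rw [if_neg hnd] at h3 h4
    have h5 : f.base i = J i := by omega
    rw [h5] at h4
    exact ⟨h5, by linarith⟩
  -- Taking determinants with `v_j` removes the `j`-coordinate. The sign of what remains tells on
  -- which side of the edge the direction `m'` is used.
  have hdet : ((z t : Fin n → ℝ) m' - J m') * Real.sin (θ m' - θ j) =
      c * t * Real.sin (θ m - θ j) := by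
    have D : ∀ x : Fin n → ℝ, Real.cos (θ j) * height θ x - Real.sin (θ j) * abscissa θ x =
        ∑ i, x i * Real.sin (θ i - θ j) := by
      intro x
      rw [height_apply, abscissa_apply, Finset.mul_sum, Finset.mul_sum, ← Finset.sum_sub_distrib]
      refine Finset.sum_congr rfl fun i _ => ?_
      rw [Real.sin_sub]; ring
    obtain ⟨e1, e2⟩ := proj_eq_iff.1 (hz t)
    have h1 := D ((z t : Fin n → ℝ) - mid)
    rw [map_sub, map_sub, e1, e2, map_add (height θ), map_add (abscissa θ), add_sub_cancel_left,
      add_sub_cancel_left, height_single, abscissa_single, Finset.sum_eq_single m'] at h1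
    · have h2 : mid m' = J m' := by simp [hmid, Pi.single_eq_of_ne hm']
      rw [Pi.sub_apply, h2] at h1
      rw [← h1, Real.sin_sub]; ring
    · intro i _ hi
      by_cases hij : i = j
      · rw [hij, sub_self, Real.sin_zero, mul_zero]
      · rw [Pi.sub_apply, (hfix i hij hi).2]
        simp [hmid, Pi.single_eq_of_ne hij]
    · simp
  have hpos : 0 < ((z t : Fin n → ℝ) m' - J m') * Real.sin (θ m' - θ j) := by
    rw [hdet]; nlinarith
  have hbm := hother m' hm'
  have hzm := hzf m'
  have hmd : m' ∈ f.dirs := by rw [hdirs]; simp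
  rw [if_pos hmd] at hbm hzm
  refine ⟨m', ?_⟩
  rcases lt_or_gt_of_ne hm' with hlt | hgt
  · right
    have hs := hθ.sin_sub_neg hlt
    have hneg : (z t : Fin n → ℝ) m' < J m' := by nlinarith
    have hlt' : f.base m' < J m' := by
      have : (f.base m' : ℝ) < J m' := by linarith [hzm.1]
      exact_mod_cast this
    refine ⟨hlt, f.base, ?_, ?_⟩
    · ext i
      by_cases h1 : i = j
      · rw [h1, Pi.add_apply, hj.2, Pi.single_eq_of_ne hlt.ne', add_zero]
      by_cases h2 : i = m'
      · rw [h2, Pi.add_apply, Pi.single_eq_same]; omega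
      · rw [Pi.add_apply, (hfix i h1 h2).1, Pi.single_eq_of_ne h2, add_zero]
    · have : f = rhombus f.base m' j := Cell.ext rfl (by rw [hdirs, Finset.pair_comm]; rfl)
      rwa [← this]
  · left
    have hs := hθ.sin_sub_pos hgt
    have hgt' : (J m' : ℝ) < (z t : Fin n → ℝ) m' := by nlinarith
    have hge : J m' < f.base m' + 1 := by
      have : ((J m' : ℕ) : ℝ) < (f.base m' + 1 : ℕ) := by push_cast; linarith [hzm.2]
      exact_mod_cast this
    refine ⟨hgt, ?_⟩
    have hb : f.base = J := by
      ext i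
      by_cases h1 : i = j
      · rw [h1, hj.2]
      by_cases h2 : i = m'
      · rw [h2]; omega
      · exact (hfix i h1 h2).1
    have : f = rhombus J j m' := Cell.ext hb hdirs
    rwa [← this]

end Tiling
end Zonogon

/-! ### Every tiling arises from a sweep -/

namespace Zonogon

variable {n : ℕ} {θ : Fin n → ℝ} {a : Fin n → ℕ}

theorem cnt_append_singleton (u : List (Fin n)) (j : Fin n) :
    cnt (u ++ [j]) = cnt u + Pi.single j 1 := by
  rw [cnt_append, cnt_cons, cnt_nil, add_zero]

theorem apply_add_one_le_of_rhombus_subset {K : Fin n → ℕ} {j m : Fin n} (hjm : j ≠ m)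
    (h : (rhombus K j m).carrier ⊆ box a) : K m + 1 ≤ a m := by
  have := (h (mem_rhombus K hjm (s := 0) (t := 1) (by simp) (by simp)) m).2
  simp only [Pi.single_zero, zero_add, Pi.add_apply, toReal_apply, Pi.single_eq_same] at this
  exact_mod_cast this

namespace Tiling

variable {T : Tiling a θ}

/-- The word `w` has an ascent such that the lowest rhombus of the tiling there is passed when
the ascent is swapped. -/
def HasAscentRhombus (T : Tiling a θ) (w : List (Fin n)) : Prop :=
  ∃ u j m v, w = u ++ j :: m :: v ∧ j < m ∧ rhombus (cnt u) j m ∈ T.rhombi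

/-- Backward search. The edge `j` is the upper right side of a rhombus in directions `m < j`; let
`i` be the preceding letter. If `i = m`, the ascent is found; if `i < m`, the preceding edge would
cut into the rhombus. If `m < i`, the preceding edge has a rhombus on its left: either this overlaps
the given one, or that edge is again an upper right side and the search continues with a shorter
prefix. -/
theorem hasAscentRhombus_of_left (hθ : IsAngles θ) (u : List (Fin n)) :
    ∀ (j : Fin n) (v : List (Fin n)) (m : Fin n) (B : Fin n → ℕ),
      PathIn (union T.rhombi) 0 (u ++ j :: v) → m < j → cnt u = B + Pi.single m 1 →
      rhombus B m j ∈ T.rhombi → T.HasAscentRhombus (u ++ j :: v) := by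
  induction u using List.reverseRecOn with
  | nil =>
    intro j v m B _ _ h
    have := congrFun h m
    simp [cnt] at this
  | append_singleton u i ih =>
    intro j v m B hp hmj hB hT
    rw [List.append_assoc, List.singleton_append] at hp ⊢
    rw [cnt_append_singleton] at hB
    have hB' := congrArg toReal hB
    rw [toReal_add, toReal_add, toReal_single, toReal_single] at hB'
    have hedge := (pathIn_append.1 hp).2.1
    rw [zero_add] at hedge
    rcases lt_trichotomy i m with him | rfl | hmi
    · refine (T.false_of_relation hθ him hmj
        (mem_union hT hmj.ne (one_sub_mem_Icc (hθ.sin_mem (him.trans hmj))) (hθ.sin_mem him))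
        (hedge _ (one_sub_mem_Icc (hθ.sin_mem hmj))) ?_).elim
      simp only [Pi.single_sub]
      linear_combination -hB'
    · rw [← add_right_cancel hB] at hT
      exact ⟨u, i, j, v, rfl, hmj, hT⟩
    · have hpos : 0 < cnt u m := by
        have := congrFun hB m
        simp only [Pi.add_apply, Pi.single_eq_same, Pi.single_eq_of_ne hmi.ne] at this
        omega
      obtain ⟨m', ⟨him', hT'⟩ | ⟨him', B', hB'', hT'⟩⟩ :=
        exists_left_rhombus hθ hedge (Or.inr ⟨hmi, hpos⟩)
      · refine (T.false_of_relation hθ hmi him'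
          (mem_union hT' him'.ne (one_sub_mem_Icc (hθ.sin_mem (hmi.trans him'))) (hθ.sin_mem hmi))
          (mem_union hT hmj.ne (one_sub_mem_Icc (hθ.sin_mem him')) (t := 0) (by simp)) ?_).elim
        simp only [Pi.single_sub, Pi.single_zero]
        linear_combination hB'
      · exact ih i (j :: v) m' B' hp him' hB'' hT'

/-- The edge `i` would leave the right corner of the rhombus into its interior, contradicting
injectivity of the projection. -/
theorem adjacent_conflict (hθ : IsAngles θ) {K : Fin n → ℕ} {j m i : Fin n} (hjm : j < m)
    (hmi : m < i) (h : rhombus K j m ∈ T.rhombi)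
    (h' : ∀ t ∈ Set.Icc (0 : ℝ) 1, toReal (K + Pi.single j 1) + Pi.single i t ∈ union T.rhombi) :
    False := by
  refine T.false_of_relation hθ hjm hmi (h' _ (hθ.sin_mem hjm))
    (mem_union h hjm.ne (one_sub_mem_Icc (hθ.sin_mem hmi)) (hθ.sin_mem (hjm.trans hmi))) ?_
  rw [toReal_add, toReal_single]
  simp only [Pi.single_sub]
  ring

/-- Forward search. The edge `j` is the lower right side of a rhombus in directions `j < m`; let `i`
be the next letter. If `i = m`, the ascent is found, and `i > m` is a conflict. If `i < m`, the next
edge has a rhombus on its left, and the search goes on forwards or turns backwards according to its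
position. It cannot reach the end, since the direction `m` is not yet exhausted. -/
theorem hasAscentRhombus_of_right (hθ : IsAngles θ) (v : List (Fin n)) :
    ∀ (u : List (Fin n)) (j m : Fin n),
      PathIn (union T.rhombi) 0 (u ++ j :: v) → cnt (u ++ j :: v) = a → j < m →
      rhombus (cnt u) j m ∈ T.rhombi → T.HasAscentRhombus (u ++ j :: v) := by
  induction v with
  | nil =>
    intro u j m _ hc hjm hT
    have := apply_add_one_le_of_rhombus_subset hjm.ne (T.subset_box _ hT)
    rw [← hc, cnt_append_singleton, Pi.add_apply, Pi.single_eq_of_ne hjm.ne'] at this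
    omega
  | cons i v ih =>
    intro u j m hp hc hjm hT
    have happ : u ++ j :: i :: v = (u ++ [j]) ++ i :: v := by simp
    have hp' := hp
    have hc' := hc
    rw [happ] at hp' hc'
    have hedge := (pathIn_append.1 hp').2.1
    rw [zero_add] at hedge
    rcases lt_trichotomy m i with hmi | rfl | him
    · exact (adjacent_conflict hθ hjm hmi hT
        (by rw [← cnt_append_singleton]; exact hedge)).elim
    · exact ⟨u, j, m, v, rfl, hjm, hT⟩
    · have hle : cnt (u ++ [j]) m + 1 ≤ a m := by
        have := apply_add_one_le_of_rhombus_subset hjm.ne (T.subset_box _ hT)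
        rwa [cnt_append_singleton, Pi.add_apply, Pi.single_eq_of_ne hjm.ne', add_zero]
      obtain ⟨m', ⟨him', hT'⟩ | ⟨him', B', hB', hT'⟩⟩ :=
        exists_left_rhombus hθ hedge (Or.inl ⟨him, hle⟩)
      · rw [happ]
        exact ih _ _ _ hp' hc' him' hT'
      · rw [happ]
        exact hasAscentRhombus_of_left hθ _ _ _ _ _ hp' him' hB' hT'

/-- A lattice path in a tiling that is not its left boundary can be moved to the left across a
rhombus of the tiling. -/
theorem hasAscentRhombus (hθ : IsAngles θ) {u v : List (Fin n)} {j m : Fin n} (hjm : j < m)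
    (hp : PathIn (union T.rhombi) 0 (u ++ j :: m :: v)) (hc : cnt (u ++ j :: m :: v) = a) :
    T.HasAscentRhombus (u ++ j :: m :: v) := by
  have hedge := (pathIn_append.1 hp).2.1
  rw [zero_add] at hedge
  have hle : cnt u m + 1 ≤ a m := by
    rw [← hc, cnt_append, cnt_cons, cnt_cons]
    simp only [Pi.add_apply, Pi.single_eq_same]
    omega
  obtain ⟨m', ⟨h, hT⟩ | ⟨h, B, hB, hT⟩⟩ := exists_left_rhombus hθ hedge (Or.inl ⟨hjm, hle⟩)
  · exact hasAscentRhombus_of_right hθ _ _ _ _ hp hc h hT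
  · exact hasAscentRhombus_of_left hθ _ _ _ _ _ hp h hB hT

end Tiling

theorem pathIn_of_forall {S : Set (Fin n → ℝ)} {K : Fin n → ℕ} {w : List (Fin n)}
    (h : ∀ u j v, w = u ++ j :: v → ∀ t ∈ Set.Icc (0 : ℝ) 1,
      toReal (K + cnt u) + Pi.single j t ∈ S) : PathIn S K w := by
  induction w generalizing K with
  | nil => trivial
  | cons j w ih =>
    refine ⟨by simpa [cnt_nil] using h [] j w rfl, ih fun u i v e => ?_⟩
    have := h (j :: u) i v (by rw [e]; rfl)
    rwa [cnt_cons, ← add_assoc] at this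

/-- The right boundary of the zonogon lies in every tiling. -/
theorem Tiling.pathIn_of_sorted (T : Tiling a θ) (hθ : IsAngles θ) {w : List (Fin n)}
    (hw : w.Pairwise (· ≤ ·)) (hc : cnt w = a) : PathIn (union T.rhombi) 0 w := by
  refine pathIn_of_forall fun u j v e t ht => ?_
  rw [zero_add]
  set x := toReal (cnt u) + Pi.single j t with hx
  have hca : ∀ m, a m = cnt u m + ((Pi.single j 1 : Fin n → ℕ) m + cnt v m) := fun m => by
    rw [← hc, e, cnt_append, cnt_cons]; rfl
  subst e
  obtain ⟨-, hjv, huv⟩ := List.pairwise_append.1 hw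
  have hjv := (List.pairwise_cons.1 hjv).1
  have hlow : ∀ m < j, x m = a m := by
    intro m hm
    have : cnt v m = 0 := List.count_eq_zero.2 fun h => absurd (hjv m h) (not_le.2 hm)
    rw [hca, this]
    simp [hx, hm.ne]
  have hhigh : ∀ m > j, x m = 0 := by
    intro m hm
    have : cnt u m = 0 := List.count_eq_zero.2 fun h =>
      absurd (huv m h j (List.mem_cons_self)) (not_le.2 hm)
    simp [hx, hm.ne', this]
  have hxbox : x ∈ box a := by
    intro i
    rcases lt_trichotomy i j with hi | rfl | hi
    · rw [hlow i hi]; exact ⟨Nat.cast_nonneg _, le_rfl⟩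
    · rw [hca]
      simp only [hx, Pi.add_apply, toReal_apply, Pi.single_eq_same, Nat.cast_add, Nat.cast_one]
      have h1 : (0 : ℝ) ≤ cnt u i := Nat.cast_nonneg _
      have h2 : (0 : ℝ) ≤ cnt v i := Nat.cast_nonneg _
      constructor <;> linarith [ht.1, ht.2]
    · rw [hhigh i hi]; exact ⟨le_rfl, Nat.cast_nonneg _⟩
  obtain ⟨y, hy, hyx⟩ := T.tiles.exists_of_mem ⟨x, hxbox, rfl⟩
  obtain ⟨e1, e2⟩ := proj_eq_iff.1 hyx
  have hybox : y ∈ box a := by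
    obtain ⟨f, hf, hyf⟩ := hy
    exact T.subset_box f hf hyf
  -- A point of the right boundary has a unique preimage in the box, so the preimage in the tiling
  -- is the given point.
  have := (abscissa_le_of_height_eq hθ e2 j (fun m hm => by rw [hlow m hm]; exact (hybox m).2)
    (fun m hm => by rw [hhigh m hm]; exact (hybox m).1)).2 e1
  rwa [← this]

theorem Sweep.pathIn {S : Set (Fin n → ℝ)} {K : Fin n → ℕ} {w w' : List (Fin n)}
    {L : Set (Cell n)} (h : Sweep K w L w') (hL : union L ⊆ S) (hw : PathIn S K w) :
    PathIn S K w' := by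
  induction h with
  | refl => exact hw
  | step hjm _ ih =>
    exact (ih ((union_mono (Set.subset_insert _ _)).trans hL)).swap hjm.ne
      fun x hx => hL ⟨_, Set.mem_insert _ _, hx⟩

/-- A quantity that decreases when an ascent is swapped. -/
def weight : List (Fin n) → ℕ
  | [] => 0
  | _ :: w => weight w + (w.map Fin.val).sum

theorem weight_swap_lt (u v : List (Fin n)) {j m : Fin n} (hjm : j < m) :
    weight (u ++ m :: j :: v) < weight (u ++ j :: m :: v) := by
  induction u with
  | nil =>
    have : j.val < m.val := hjm
    simp only [List.nil_append, weight, List.map_cons, List.sum_cons]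
    omega
  | cons i u ih =>
    simp only [List.cons_append, weight, List.map_append, List.map_cons, List.sum_append,
      List.sum_cons]
    omega

theorem pairwise_ge_or_exists_ascent (w : List (Fin n)) :
    w.Pairwise (· ≥ ·) ∨ ∃ u j m v, w = u ++ j :: m :: v ∧ j < m := by
  induction w with
  | nil => exact Or.inl List.Pairwise.nil
  | cons i w ih =>
    rcases ih with ih | ⟨u, j, m, v, rfl, h⟩
    · cases w with
      | nil => exact Or.inl (List.pairwise_singleton _ _)
      | cons m v =>
        rcases lt_or_ge i m with him | him
        · exact Or.inr ⟨[], i, m, v, rfl, him⟩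
        · refine Or.inl (List.pairwise_cons.2 ⟨fun x hx => ?_, ih⟩)
          rcases List.mem_cons.1 hx with rfl | hx
          · exact him
          · exact ((List.pairwise_cons.1 ih).1 x hx).le.trans him
    · exact Or.inr ⟨i :: u, j, m, v, rfl, h⟩

theorem Sweep.exists_complete (K : Fin n → ℕ) (w : List (Fin n)) :
    ∃ M w', Sweep K w M w' ∧ w'.Pairwise (· ≥ ·) := by
  induction hμ : weight w using Nat.strong_induction_on generalizing w with
  | _ k ih =>
    rcases pairwise_ge_or_exists_ascent w with h | ⟨u, j, m, v, rfl, hjm⟩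
    · exact ⟨∅, w, .refl, h⟩
    · obtain ⟨M, w', h, h'⟩ := ih _ (hμ ▸ weight_swap_lt u v hjm) _ rfl
      exact ⟨_, w', (Sweep.step hjm .refl).trans h, h'⟩

/-- As long as there is an ascent, there is one whose rhombus belongs to `T`; swapping it keeps the
path inside `T` and lowers the weight. -/
theorem Sweep.exists_complete_subset (hθ : IsAngles θ) (T : Tiling a θ) (w : List (Fin n))
    (hc : cnt w = a) (hp : PathIn (union T.rhombi) 0 w) :
    ∃ M w', Sweep 0 w M w' ∧ w'.Pairwise (· ≥ ·) ∧ M ⊆ T.rhombi := by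
  induction hμ : weight w using Nat.strong_induction_on generalizing w with
  | _ k ih =>
    rcases pairwise_ge_or_exists_ascent w with h | ⟨u, j, m, v, rfl, hjm⟩
    · exact ⟨∅, w, .refl, h, Set.empty_subset _⟩
    · obtain ⟨u', j', m', v', e, hjm', hT⟩ := T.hasAscentRhombus hθ hjm hp hc
      rw [e] at hp hc hμ ⊢
      have hs : Sweep 0 (u' ++ j' :: m' :: v') _ _ := Sweep.step hjm' .refl
      have hsub : insert (rhombus (0 + cnt u') j' m') ∅ ⊆ T.rhombi := by
        rw [zero_add]; exact Set.insert_subset hT (Set.empty_subset _)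
      obtain ⟨M, w', h, h', hM⟩ := ih _ (hμ ▸ weight_swap_lt u' v' hjm') _
        (by rw [hs.cnt_eq, hc]) (hs.pathIn (union_mono hsub) hp) rfl
      exact ⟨_, w', hs.trans h, h', Set.union_subset hsub hM⟩

/-- The center of a cell. -/
noncomputable def Cell.center (f : Cell n) : Fin n → ℝ :=
  fun i => f.base i + if i ∈ f.dirs then 1 / 2 else 0

theorem Cell.center_mem (f : Cell n) : f.center ∈ f.carrier := by
  intro i
  simp only [Cell.center]
  split_ifs <;> constructor <;> linarith

/-- The half-integral coordinates of the centre are the directions of `f`. The other cell must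
extend in all of these, and it has no further ones. -/
theorem Cell.eq_of_center_mem {f g : Cell n} (hcard : f.dirs.card = g.dirs.card)
    (h : f.center ∈ g.carrier) : f = g := by
  have hi : ∀ i, (i ∈ f.dirs → i ∈ g.dirs) ∧ (i ∈ f.dirs → f.base i = g.base i) ∧
      (i ∉ f.dirs → i ∉ g.dirs → f.base i = g.base i) := by
    intro i
    obtain ⟨h1, h2⟩ := h i
    simp only [Cell.center] at h1 h2
    refine ⟨fun hf => ?_, fun hf => ?_, fun hf hg => ?_⟩
    · by_contra hg
      rw [if_pos hf] at h1 h2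
      rw [if_neg hg] at h2
      have h3 : (f.base i : ℝ) < g.base i := by linarith
      have h4 : (g.base i : ℝ) < (f.base i + 1 : ℕ) := by push_cast; linarith
      have h3 : f.base i < g.base i := by exact_mod_cast h3
      have h4 : g.base i < f.base i + 1 := by exact_mod_cast h4
      omega
    · rw [if_pos hf] at h1 h2
      have h3 : (g.base i : ℝ) < (f.base i + 1 : ℕ) := by push_cast; linarith
      have h4 : (f.base i : ℝ) < (g.base i + 1 : ℕ) := by
        push_cast; split_ifs at h2 <;> linarith
      have h3 : g.base i < f.base i + 1 := by exact_mod_cast h3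
      have h4 : f.base i < g.base i + 1 := by exact_mod_cast h4
      omega
    · rw [if_neg hf] at h1 h2
      rw [if_neg hg] at h2
      have : (f.base i : ℝ) = g.base i := by linarith
      exact_mod_cast this
  have hd : f.dirs = g.dirs := Finset.eq_of_subset_of_card_le (fun i => (hi i).1) hcard.ge
  refine Cell.ext (funext fun i => ?_) hd
  by_cases hf : i ∈ f.dirs
  · exact (hi i).2.1 hf
  · exact (hi i).2.2 hf (hd ▸ hf)

/-- A set of rhombi of a tiling that covers the image of the center of a rhombus contains it. -/
theorem Tiling.mem_of_tiles (T : Tiling a θ) {F : Set (Cell n)} (hF : F ⊆ T.rhombi)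
    {R : Set (ℝ × ℝ)} (h : Tiles θ F R) {f : Cell n} (hf : f ∈ T.rhombi)
    (hR : proj θ f.center ∈ R) : f ∈ F := by
  obtain ⟨x, ⟨g, hg, hx⟩, e⟩ := h.exists_of_mem hR
  have : x = f.center := T.injOn ⟨g, hF hg, hx⟩ ⟨f, hf, f.center_mem⟩ e
  rw [this] at hx
  rwa [Cell.eq_of_center_mem ((T.tiles.1 f hf).trans (T.tiles.1 g (hF hg)).symm) hx]

theorem box_eq (w : List (Fin n)) (hc : cnt w = a) :
    box a = {x | x - toReal 0 ∈ cbox (cnt w)} := by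
  have : toReal (0 : Fin n → ℕ) = 0 := by ext; simp
  subst hc
  simp only [this, sub_zero]
  rfl

/-- The right boundary path of the zonogon. -/
structure IsRightBoundary (a : Fin n → ℕ) (w : List (Fin n)) : Prop where
  sorted : w.Pairwise (· ≤ ·)
  cnt_eq : cnt w = a
  exists_ne : ∃ p q : Fin n, p ≠ q ∧ 0 < a p ∧ 0 < a q

section
variable {w₀ w w' : List (Fin n)} {L M : Set (Cell n)}

theorem Sweep.tiles_box (hθ : IsAngles θ) (hw₀ : IsRightBoundary a w₀) (h : Sweep 0 w₀ L w)
    (hw : w.Pairwise (· ≥ ·)) : Tiles θ L (proj θ '' box a) := by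
  obtain ⟨hs, hc, p, q, hpq, hp, hq⟩ := hw₀
  rw [box_eq w₀ hc]
  rw [← hc] at hp hq
  exact h.tiles hθ hs hw hpq hp hq

/-- The tiling consisting of the rhombi passed by a sweep from the right to the left boundary. -/
def Tiling.ofSweep (hθ : IsAngles θ) (hw₀ : IsRightBoundary a w₀) (h : Sweep 0 w₀ L w)
    (hw : w.Pairwise (· ≥ ·)) : Tiling a θ where
  rhombi := L
  subset_box f hf x hx := by
    rw [box_eq w₀ hw₀.cnt_eq]
    exact h.carrier_subset f hf x hx
  tiles := h.tiles_box hθ hw₀ hw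

/-- Every tiling that contains the rhombi of a sweep arises by completing this sweep. -/
theorem Tiling.exists_sweep (T : Tiling a θ) (hθ : IsAngles θ) (hw₀ : IsRightBoundary a w₀)
    (h : Sweep 0 w₀ L w) (hL : L ⊆ T.rhombi) :
    ∃ M w', Sweep 0 w M w' ∧ w'.Pairwise (· ≥ ·) ∧ T.rhombi = L ∪ M := by
  obtain ⟨M, w', hM, hw', hsub⟩ := Sweep.exists_complete_subset hθ T w
    (by rw [h.cnt_eq, hw₀.cnt_eq])
    (h.pathIn (union_mono hL) (T.pathIn_of_sorted hθ hw₀.sorted hw₀.cnt_eq))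
  refine ⟨M, w', hM, hw', Set.Subset.antisymm (fun f hf => ?_) (Set.union_subset hL hsub)⟩
  -- The swept rhombi already cover the zonogon, which leaves no room for another rhombus of `T`.
  exact T.mem_of_tiles (Set.union_subset hL hsub) ((h.trans hM).tiles_box hθ hw₀ hw') hf
    ⟨_, T.subset_box f hf f.center_mem, rfl⟩

end

end Zonogon

/-! ### Cubes and flips -/

namespace Zonogon

variable {n : ℕ} {θ : Fin n → ℝ} {a : Fin n → ℕ}

theorem Cell.carrier_subset_iff {f g : Cell n} : f.carrier ⊆ g.carrier ↔
    ∀ i, g.base i ≤ f.base i ∧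
      f.base i + (if i ∈ f.dirs then 1 else 0) ≤ g.base i + if i ∈ g.dirs then 1 else 0 := by
  constructor
  · intro h i
    have h1 := (h (show toReal f.base ∈ f.carrier from fun i => ⟨le_rfl, by
      simp only [toReal_apply]; split_ifs <;> linarith⟩) i).1
    have h2 := (h (show (fun i => (f.base i : ℝ) + if i ∈ f.dirs then 1 else 0) ∈ f.carrier from
      fun i => ⟨le_add_of_nonneg_right (by split_ifs <;> norm_num), le_rfl⟩) i).2
    rw [toReal_apply] at h1
    refine ⟨by exact_mod_cast h1, ?_⟩
    split_ifs at h2 ⊢ <;> exact_mod_cast h2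
  · intro h x hx i
    obtain ⟨h1, h2⟩ := h i
    obtain ⟨h3, h4⟩ := hx i
    have h1 : (g.base i : ℝ) ≤ f.base i := by exact_mod_cast h1
    refine ⟨h1.trans h3, h4.trans ?_⟩
    split_ifs at h2 ⊢ <;> exact_mod_cast h2

namespace Cube

variable (c : Cube n)

theorem hjl : c.j < c.l := c.hjk.trans c.hkl

theorem mem_facesAt {V : Fin n → ℕ} {f : Cell n} :
    f ∈ c.facesAt (fun i => (V i : ℝ)) ↔ f.dirs.card = 2 ∧ f.carrier ⊆ c.cell.carrier ∧
      ∀ i, f.base i ≤ V i ∧ V i ≤ f.base i + if i ∈ f.dirs then 1 else 0 := by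
  refine and_congr_right fun _ => and_congr_right fun _ => forall_congr' fun i => ?_
  split_ifs <;> dsimp only <;> norm_cast

/-- A face through the lattice point `V` is determined by its two directions: its base agrees with
that of the cube in these and with `V` elsewhere. -/
theorem eq_of_mem_facesAt {V : Fin n → ℕ} {f : Cell n} (h : f ∈ c.facesAt (fun i => (V i : ℝ))) :
    (f.dirs = {c.j, c.k} ∨ f.dirs = {c.j, c.l} ∨ f.dirs = {c.k, c.l}) ∧
      ∀ i, f.base i = if i ∈ f.dirs then c.base i else V i := by
  obtain ⟨h1, h2, h3⟩ := c.mem_facesAt.1 h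
  rw [Cell.carrier_subset_iff] at h2
  have hsub : f.dirs ⊆ {c.j, c.k, c.l} := by
    intro i hi
    by_contra hc
    have := h2 i
    rw [if_pos hi, if_neg (show i ∉ c.cell.dirs from hc)] at this
    omega
  constructor
  · obtain ⟨x, y, hxy, e⟩ := Finset.card_eq_two.1 h1
    rw [e] at hsub ⊢
    have hx := hsub (Finset.mem_insert_self x _)
    have hy := hsub (Finset.mem_insert_of_mem (Finset.mem_singleton_self y))
    simp only [Finset.mem_insert, Finset.mem_singleton] at hx hy
    rcases hx with rfl | rfl | rfl <;> rcases hy with rfl | rfl | rfl <;>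
      simp_all [Finset.pair_comm]
  · intro i
    have h2 := h2 i
    have h3 := h3 i
    split_ifs with hi
    · rw [if_pos hi] at h2
      have : c.base i ≤ f.base i := h2.1
      have : f.base i + 1 ≤ c.base i + 1 := h2.2.trans (Nat.add_le_add_left (by split_ifs <;> omega) _)
      omega
    · rw [if_neg hi] at h3
      omega

theorem bottom_eq : c.bottom = {rhombus c.base c.j c.k, rhombus (c.base + Pi.single c.k 1) c.j c.l,
    rhombus c.base c.k c.l} := by
  have hV : c.bottom = c.facesAt (fun i => ((c.base + Pi.single c.k 1 : Fin n → ℕ) i : ℝ)) := by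
    rw [bottom]; congr 1; ext i; simp [Pi.single_apply]
  have h1 := c.hjk
  have h2 := c.hkl
  have h3 := c.hjl
  rw [hV]
  ext f
  constructor
  · intro h
    obtain ⟨hd, hb⟩ := c.eq_of_mem_facesAt h
    rcases hd with hd | hd | hd
    · left
      refine Cell.ext (funext fun i => ?_) hd
      rw [hb, hd]
      by_cases e : i = c.k <;> simp [e, rhombus]
    · right; left
      refine Cell.ext (funext fun i => ?_) hd
      rw [hb, hd]
      by_cases e1 : i = c.j
      · simp [e1, rhombus, h1.ne]
      by_cases e2 : i = c.l
      · simp [e2, rhombus, h2.ne']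
      · simp [e1, e2, rhombus]
    · right; right
      refine Cell.ext (funext fun i => ?_) hd
      rw [hb, hd]
      by_cases e : i = c.k <;> simp [e, rhombus]
  · intro h
    rw [mem_facesAt, Cell.carrier_subset_iff]
    rcases h with rfl | rfl | rfl
    · refine ⟨Finset.card_pair h1.ne, fun i => ?_, fun i => ?_⟩ <;>
      by_cases e1 : i = c.j <;> by_cases e2 : i = c.k <;> by_cases e3 : i = c.l <;>
        simp_all [rhombus, cell, h1.ne, h1.ne', h2.ne, h2.ne', h3.ne, h3.ne']
    · refine ⟨Finset.card_pair h3.ne, fun i => ?_, fun i => ?_⟩ <;>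
      by_cases e1 : i = c.j <;> by_cases e2 : i = c.k <;> by_cases e3 : i = c.l <;>
        simp_all [rhombus, cell, h1.ne, h1.ne', h2.ne, h2.ne', h3.ne, h3.ne']
    · refine ⟨Finset.card_pair h2.ne, fun i => ?_, fun i => ?_⟩ <;>
      by_cases e1 : i = c.j <;> by_cases e2 : i = c.k <;> by_cases e3 : i = c.l <;>
        simp_all [rhombus, cell, h1.ne, h1.ne', h2.ne, h2.ne', h3.ne, h3.ne']

theorem top_eq : c.top = {rhombus (c.base + Pi.single c.j 1) c.k c.l, rhombus c.base c.j c.l,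
    rhombus (c.base + Pi.single c.l 1) c.j c.k} := by
  have hV : c.top = c.facesAt
      (fun i => ((c.base + Pi.single c.j 1 + Pi.single c.l 1 : Fin n → ℕ) i : ℝ)) := by
    rw [top]; congr 1; ext i; simp [Pi.single_apply]
  have h1 := c.hjk
  have h2 := c.hkl
  have h3 := c.hjl
  rw [hV]
  ext f
  constructor
  · intro h
    obtain ⟨hd, hb⟩ := c.eq_of_mem_facesAt h
    rcases hd with hd | hd | hd
    · right; right
      refine Cell.ext (funext fun i => ?_) hd
      rw [hb, hd]
      by_cases e1 : i = c.j
      · simp [e1, rhombus, h3.ne]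
      by_cases e2 : i = c.k
      · simp [e2, rhombus, h2.ne]
      · simp [e1, e2, rhombus]
    · right; left
      refine Cell.ext (funext fun i => ?_) hd
      rw [hb, hd]
      by_cases e1 : i = c.j <;> by_cases e2 : i = c.l <;> simp [e1, e2, rhombus]
    · left
      refine Cell.ext (funext fun i => ?_) hd
      rw [hb, hd]
      by_cases e1 : i = c.k
      · simp [e1, rhombus, h1.ne']
      by_cases e2 : i = c.l
      · simp [e2, rhombus, h3.ne']
      · simp [e1, e2, rhombus]
  · intro h
    rw [mem_facesAt, Cell.carrier_subset_iff]
    rcases h with rfl | rfl | rfl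
    · refine ⟨Finset.card_pair h2.ne, fun i => ?_, fun i => ?_⟩ <;>
      by_cases e1 : i = c.j <;> by_cases e2 : i = c.k <;> by_cases e3 : i = c.l <;>
        simp_all [rhombus, cell, h1.ne, h1.ne', h2.ne, h2.ne', h3.ne, h3.ne']
    · refine ⟨Finset.card_pair h3.ne, fun i => ?_, fun i => ?_⟩ <;>
      by_cases e1 : i = c.j <;> by_cases e2 : i = c.k <;> by_cases e3 : i = c.l <;>
        simp_all [rhombus, cell, h1.ne, h1.ne', h2.ne, h2.ne', h3.ne, h3.ne']
    · refine ⟨Finset.card_pair h1.ne, fun i => ?_, fun i => ?_⟩ <;>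
      by_cases e1 : i = c.j <;> by_cases e2 : i = c.k <;> by_cases e3 : i = c.l <;>
        simp_all [rhombus, cell, h1.ne, h1.ne', h2.ne, h2.ne', h3.ne, h3.ne']

theorem disjoint_bottom_top : Disjoint c.bottom c.top := by
  refine Set.disjoint_left.2 fun f hb ht => ?_
  have h1 := c.hjk
  have h2 := c.hkl
  have h3 := c.hjl
  have hV : c.bottom = c.facesAt (fun i => ((c.base + Pi.single c.k 1 : Fin n → ℕ) i : ℝ)) := by
    rw [bottom]; congr 1; ext i; simp [Pi.single_apply]
  have hV' : c.top = c.facesAt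
      (fun i => ((c.base + Pi.single c.j 1 + Pi.single c.l 1 : Fin n → ℕ) i : ℝ)) := by
    rw [top]; congr 1; ext i; simp [Pi.single_apply]
  rw [hV] at hb
  rw [hV'] at ht
  obtain ⟨hd, hb⟩ := c.eq_of_mem_facesAt hb
  obtain ⟨-, ht⟩ := c.eq_of_mem_facesAt ht
  have key : ∀ i ∉ f.dirs, (c.base + Pi.single c.k 1 : Fin n → ℕ) i =
      (c.base + Pi.single c.j 1 + Pi.single c.l 1 : Fin n → ℕ) i := by
    intro i hi
    have e1 := hb i
    have e2 := ht i
    rw [if_neg hi] at e1 e2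
    rw [← e1, ← e2]
  rcases hd with hd | hd | hd
  · have := key c.l (by rw [hd]; simp [h2.ne', h3.ne'])
    simp [h2.ne', h3.ne'] at this
  · have := key c.k (by rw [hd]; simp [h1.ne', h2.ne])
    simp [h1.ne', h2.ne] at this
  · have := key c.j (by rw [hd]; simp [h1.ne, h3.ne])
    simp [h1.ne, h3.ne] at this

/-- The word `j k l` can be reversed by swaps of ascents in two ways. Beginning with the ascent `j
k` one passes the bottom faces, beginning with `k l` the top faces. -/
theorem sweep_bottom : Sweep c.base [c.j, c.k, c.l] c.bottom [c.l, c.k, c.j] := by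
  have s1 := Sweep.step (u := []) (v := [c.l]) c.hjk
    (Sweep.refl (K := c.base) (w := [c.j, c.k, c.l]))
  have s2 := Sweep.step (u := [c.k]) (v := []) c.hjl s1
  have s3 := Sweep.step (u := []) (v := [c.j]) c.hkl s2
  convert s3 using 1
  · rw [bottom_eq]
    simp only [cnt_nil, add_zero, cnt_cons]
    ext f
    simp only [Set.mem_insert_iff, Set.mem_singleton_iff, Set.mem_empty_iff_false]
    tauto
  · rfl

theorem sweep_top : Sweep c.base [c.j, c.k, c.l] c.top [c.l, c.k, c.j] := by
  have s1 := Sweep.step (u := [c.j]) (v := []) c.hkl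
    (Sweep.refl (K := c.base) (w := [c.j, c.k, c.l]))
  have s2 := Sweep.step (u := []) (v := [c.k]) c.hjl s1
  have s3 := Sweep.step (u := [c.l]) (v := []) c.hjk s2
  convert s3 using 1
  · rw [top_eq]
    simp only [cnt_nil, add_zero, cnt_cons]
    ext f
    simp only [Set.mem_insert_iff, Set.mem_singleton_iff, Set.mem_empty_iff_false]
    tauto
  · rfl

theorem pairwise_steps : [c.j, c.k, c.l].Pairwise (· ≤ ·) := by
  simp [c.hjk.le, c.hkl.le, c.hjl.le]

theorem pairwise_steps_reverse : [c.l, c.k, c.j].Pairwise (· ≥ ·) := by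
  simp [c.hjk.le, c.hkl.le, c.hjl.le]

theorem tiles_bottom (hθ : IsAngles θ) : Tiles θ c.bottom
    (proj θ '' {x | x - toReal c.base ∈ cbox (cnt [c.j, c.k, c.l])}) :=
  c.sweep_bottom.tiles hθ c.pairwise_steps c.pairwise_steps_reverse c.hjk.ne
    (by simp [cnt]) (by simp [cnt])

/-- A tiling that contains the bottom faces of a cube contains none of its top faces. -/
theorem disjoint_top_of_bottom_subset (hθ : IsAngles θ) {T : Tiling a θ} (h : c.bottom ⊆ T.rhombi) :
    Disjoint c.top T.rhombi := by
  refine Set.disjoint_left.2 fun f hf hT => Set.disjoint_right.1 c.disjoint_bottom_top hf ?_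
  exact T.mem_of_tiles h (c.tiles_bottom hθ) hT
    ⟨_, c.sweep_top.carrier_subset f hf _ f.center_mem, rfl⟩

theorem cell_subset_box {w : List (Fin n)} (hc : cnt w = a) {u v : List (Fin n)}
    (hu : c.base = cnt u) (hw : w = u ++ c.j :: c.k :: c.l :: v) : c.cell.carrier ⊆ box a := by
  have h1 := c.hjk
  have h2 := c.hkl
  have h3 := c.hjl
  intro x hx i
  obtain ⟨h4, h5⟩ := hx i
  refine ⟨(Nat.cast_nonneg _).trans h4, h5.trans ?_⟩
  have : c.base i + (if i ∈ c.cell.dirs then 1 else 0) ≤ a i := by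
    rw [← hc, hw, hu, cnt_append, cnt_cons, cnt_cons, cnt_cons]
    simp only [Pi.add_apply, cell, Finset.mem_insert, Finset.mem_singleton]
    split_ifs with h
    · rcases h with rfl | rfl | rfl <;> simp only [Pi.single_eq_same] <;> omega
    · omega
  have hb : (c.base i : ℝ) + (if i ∈ c.cell.dirs then 1 else 0) ≤ a i := by
    split_ifs at this ⊢ <;> exact_mod_cast this
  exact hb

end Cube

section
variable {w₀ w w' : List (Fin n)} {L M : Set (Cell n)} {c d : Cube n}

theorem Cube.sweep_bottom_context {u v : List (Fin n)} (hu : c.base = cnt u) :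
    Sweep 0 (u ++ c.j :: c.k :: c.l :: v) c.bottom (u ++ c.l :: c.k :: c.j :: v) := by
  have := Sweep.append_context (K := 0) u v (by rw [zero_add, ← hu]; exact c.sweep_bottom)
  simpa using this

theorem Cube.sweep_top_context {u v : List (Fin n)} (hu : c.base = cnt u) :
    Sweep 0 (u ++ c.j :: c.k :: c.l :: v) c.top (u ++ c.l :: c.k :: c.j :: v) := by
  have := Sweep.append_context (K := 0) u v (by rw [zero_add, ← hu]; exact c.sweep_top)
  simpa using this

/-- Completing a sweep across the bottom resp. the top of a cube in the same way gives tilings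
related by a flip. -/
theorem upFlip_of_sweep (hθ : IsAngles θ) (hw₀ : IsRightBoundary a w₀) {u v : List (Fin n)}
    (h : Sweep 0 w₀ L (u ++ c.j :: c.k :: c.l :: v)) (hu : c.base = cnt u)
    (hM : Sweep 0 (u ++ c.l :: c.k :: c.j :: v) M w) {T T' : Tiling a θ}
    (hT : T.rhombi = L ∪ c.bottom ∪ M) (hT' : T'.rhombi = L ∪ c.top ∪ M) : UpFlip c T T' := by
  have hb := c.sweep_bottom_context (v := v) hu
  refine ⟨c.cell_subset_box (h.cnt_eq.trans hw₀.cnt_eq) hu rfl, ?_, ?_⟩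
  · rw [hT]
    exact fun f hf => Or.inl (Or.inr hf)
  · have h1 := (h.disjoint hθ hb)
    have h2 := (hb.disjoint hθ hM)
    rw [hT, hT', Set.union_sdiff_distrib, Set.union_sdiff_distrib, h1.sdiff_eq_left,
      h2.symm.sdiff_eq_left, Set.sdiff_self, Set.union_empty, Set.union_right_comm]

/-- A tiling that contains the bottom faces of the cube at three consecutive steps of a sweep
admits the flip at this cube. -/
theorem exists_upFlip (hθ : IsAngles θ) (hw₀ : IsRightBoundary a w₀) {u v : List (Fin n)}
    (h : Sweep 0 w₀ L (u ++ c.j :: c.k :: c.l :: v)) (hu : c.base = cnt u) {T : Tiling a θ}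
    (hT : L ∪ c.bottom ⊆ T.rhombi) :
    ∃ T' : Tiling a θ, UpFlip c T T' ∧ L ∪ c.top ⊆ T'.rhombi := by
  obtain ⟨M, w', hM, hw', e⟩ := T.exists_sweep hθ hw₀ (h.trans (Cube.sweep_bottom_context hu)) hT
  refine ⟨Tiling.ofSweep hθ hw₀ ((h.trans (Cube.sweep_top_context hu)).trans hM) hw',
    upFlip_of_sweep hθ hw₀ h hu hM e rfl, ?_⟩
  exact Set.subset_union_left

theorem UpFlip.sdiff_subset {T T' : Tiling a θ} (h : UpFlip c T T') :
    T.rhombi \ T'.rhombi ⊆ c.bottom := by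
  rintro f ⟨hf, hf'⟩
  by_contra hb
  rw [h.2.2] at hf'
  exact hf' (Or.inl ⟨hf, hb⟩)

theorem UpFlip.sdiff_subset_top {T T' : Tiling a θ} (h : UpFlip c T T') :
    T'.rhombi \ T.rhombi ⊆ c.top := by
  rintro f ⟨hf, hf'⟩
  rw [h.2.2] at hf
  rcases hf with hf | hf
  · exact absurd hf.1 hf'
  · exact hf

theorem UpFlip.disjoint_bottom {T T' : Tiling a θ} (h : UpFlip c T T') :
    Disjoint c.bottom T'.rhombi := by
  rw [h.2.2, Set.disjoint_union_right]
  exact ⟨Set.disjoint_sdiff_right, c.disjoint_bottom_top⟩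

theorem UpFlip.unique {T T' T'' : Tiling a θ} (h : UpFlip c T T') (h' : UpFlip c T T'') :
    T' = T'' := Tiling.ext (h.2.2.trans h'.2.2.symm)

/-- Flips at two cubes whose bottom faces persist commute. -/
theorem UpFlip.commute (hθ : IsAngles θ) {T T₁ T₂ T₃ : Tiling a θ} (hd : UpFlip d T T₁)
    (h : UpFlip c T T₂) (h' : UpFlip c T₁ T₃) : UpFlip d T₂ T₃ := by
  have h1 := c.disjoint_top_of_bottom_subset hθ h.2.1
  have h2 := d.disjoint_top_of_bottom_subset hθ hd.2.1
  have hbb : Disjoint c.bottom d.bottom :=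
    (hd.disjoint_bottom.mono_right h'.2.1).symm
  have htd : Disjoint c.top d.bottom := h1.mono_right hd.2.1
  have hct : Disjoint d.top c.bottom := h2.mono_right h.2.1
  refine ⟨hd.1, ?_, ?_⟩
  · rw [h.2.2]
    exact fun f hf => Or.inl ⟨hd.2.1 hf, Set.disjoint_right.1 hbb hf⟩
  · rw [h'.2.2, hd.2.2, h.2.2, Set.union_sdiff_distrib, Set.union_sdiff_distrib, htd.sdiff_eq_left,
      hct.sdiff_eq_left, Set.sdiff_sdiff, Set.sdiff_sdiff, Set.union_comm c.bottom,
      Set.union_right_comm]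

/-- The tiling `T₁` contains all bottom faces of `c` but none of `d`. So the two flips use disjoint
sets of rhombi, and the four tilings are told apart by the bottom faces they contain. -/
theorem UpFlip.square (hθ : IsAngles θ) {T T₁ T₂ T₃ : Tiling a θ} (hd : UpFlip d T T₁)
    (h : UpFlip c T T₂) (h' : UpFlip c T₁ T₃) :
    IsSquareCycle (![T, T₂, T₃, T₁] : ZMod 4 → Tiling a θ) ∧
      Function.Injective (![T, T₂, T₃, T₁] : ZMod 4 → Tiling a θ) := by
  have hd' := hd.commute hθ h h'
  have hbb : Disjoint c.bottom d.bottom :=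
    (hd.disjoint_bottom.mono_right h'.2.1).symm
  refine ⟨⟨c, d, Or.inl h, Or.inl hd, hbb.mono h.sdiff_subset hd.sdiff_subset, Or.inl hd', Or.inl h'⟩,
    ?_⟩
  obtain ⟨f, hf, -⟩ := c.exists_bottom_not_top
  have n1 : T ≠ T₃ := fun e => Set.disjoint_left.1 h'.disjoint_bottom hf (e ▸ h.2.1 hf)
  have n2 : T₂ ≠ T₁ := fun e => Set.disjoint_left.1 h.disjoint_bottom hf (e ▸ h'.2.1 hf)
  have n3 := h.ne
  have n4 := hd.ne
  have n5 := hd'.ne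
  have n6 := h'.ne
  intro i j hij
  fin_cases i <;> fin_cases j <;> first | rfl | (exfalso; simp at hij; tauto)

theorem rhombus_inj {K K' : Fin n → ℕ} {j m j' m' : Fin n} (h : j < m) (h' : j' < m') :
    rhombus K j m = rhombus K' j' m' ↔ K = K' ∧ j = j' ∧ m = m' := by
  constructor
  · intro e
    obtain ⟨e1, e2⟩ := Cell.mk.injEq .. ▸ e
    refine ⟨e1, ?_⟩
    have hj : j ∈ ({j', m'} : Finset (Fin n)) := e2 ▸ Finset.mem_insert_self _ _
    have hm : m ∈ ({j', m'} : Finset (Fin n)) :=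
      e2 ▸ Finset.mem_insert_of_mem (Finset.mem_singleton_self _)
    simp only [Finset.mem_insert, Finset.mem_singleton] at hj hm
    rcases hj with rfl | rfl <;> rcases hm with rfl | rfl
    · exact absurd h (lt_irrefl _)
    · exact ⟨rfl, rfl⟩
    · exact absurd (h.trans h') (lt_irrefl _)
    · exact absurd h (lt_irrefl _)
  · rintro ⟨rfl, rfl, rfl⟩; rfl

theorem eq_nil_of_cnt_eq_zero {w : List (Fin n)} (h : cnt w = 0) : w = [] :=
  List.eq_nil_iff_forall_not_mem.2 fun i => List.count_eq_zero.1 (congrFun h i)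

theorem Cube.mem_bottom_iff {K : Fin n → ℕ} {j m : Fin n} (h : j < m) :
    rhombus K j m ∈ c.bottom ↔ (K = c.base ∧ j = c.j ∧ m = c.k) ∨
      (K = c.base + Pi.single c.k 1 ∧ j = c.j ∧ m = c.l) ∨ (K = c.base ∧ j = c.k ∧ m = c.l) := by
  rw [c.bottom_eq, Set.mem_insert_iff, Set.mem_insert_iff, Set.mem_singleton_iff,
    rhombus_inj h c.hjk, rhombus_inj h c.hjl, rhombus_inj h c.hkl]

theorem Cube.mem_top_iff {K : Fin n → ℕ} {j m : Fin n} (h : j < m) :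
    rhombus K j m ∈ c.top ↔ (K = c.base + Pi.single c.j 1 ∧ j = c.k ∧ m = c.l) ∨
      (K = c.base ∧ j = c.j ∧ m = c.l) ∨ (K = c.base + Pi.single c.l 1 ∧ j = c.j ∧ m = c.k) := by
  rw [c.top_eq, Set.mem_insert_iff, Set.mem_insert_iff, Set.mem_singleton_iff,
    rhombus_inj h c.hkl, rhombus_inj h c.hjl, rhombus_inj h c.hjk]

/-- If the flip from `T` to `T'` destroys the rhombus at one ascent of a path and creates the
rhombus at another ascent, then the second ascent follows the first one immediately, and the cube
of the flip is spanned by these steps. -/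
theorem UpFlip.eq_of_ascents {T T' : Tiling a θ} (h : UpFlip c T T') {u v u' v' : List (Fin n)}
    {j m j' m' : Fin n} (hjm : j < m) (hjm' : j' < m')
    (hw : u ++ j :: m :: v = u' ++ j' :: m' :: v')
    (hα : rhombus (cnt u) j m ∈ T.rhombi) (hα' : rhombus (cnt u) j m ∉ T'.rhombi)
    (hβ : rhombus (cnt u') j' m' ∈ T'.rhombi) (hβ' : rhombus (cnt u') j' m' ∉ T.rhombi) :
    u' = u ++ [j] ∧ m = j' ∧ c.base = cnt u ∧ c.j = j ∧ c.k = m ∧ c.l = m' := by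
  have h1 := c.hjk
  have h2 := c.hkl
  have h3 := c.hjl
  have hb := (Cube.mem_bottom_iff hjm).1 (h.sdiff_subset ⟨hα, hα'⟩)
  have ht := (Cube.mem_top_iff hjm').1 (h.sdiff_subset_top ⟨hβ, hβ'⟩)
  -- The destroyed rhombus is a bottom face and the created one a top face. The bases of these faces
  -- are compared with the positions of the ascents in the word, the cases being separated by which
  -- ascent comes first.
  rcases List.append_eq_append_iff.1 hw with ⟨x, hx, hx'⟩ | ⟨x, hx, hx'⟩
  · cases x with
    | nil =>
      rw [List.append_nil] at hx
      rw [List.nil_append, List.cons.injEq, List.cons.injEq] at hx'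
      rw [hx, ← hx'.1, ← hx'.2.1] at hβ
      exact absurd hβ hα'
    | cons i x =>
      obtain ⟨rfl, hx'⟩ := List.cons.inj hx'
      have e : cnt u' = cnt u + (Pi.single j 1 + cnt x) := by rw [hx, cnt_append, cnt_cons]
      have ej := congrFun e c.j
      have ek := congrFun e c.k
      have el := congrFun e c.l
      obtain ⟨hb, rfl, rfl⟩ | ⟨hb, rfl, rfl⟩ | ⟨hb, rfl, rfl⟩ := hb <;>
      obtain ⟨ht, rfl, rfl⟩ | ⟨ht, rfl, rfl⟩ | ⟨ht, rfl, rfl⟩ := ht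
      · rw [ht, hb, ← add_assoc, left_eq_add] at e
        rw [eq_nil_of_cnt_eq_zero e] at hx
        exact ⟨hx, rfl, hb.symm, rfl, rfl, rfl⟩
      -- In the other eight cases the number of letters in one of the three directions of the cube
      -- comes out wrong.
      all_goals
        exfalso
        rw [ht, hb] at ej ek el
        simp only [Pi.add_apply, Pi.single_eq_same, Pi.single_eq_of_ne h1.ne,
          Pi.single_eq_of_ne h1.ne', Pi.single_eq_of_ne h2.ne, Pi.single_eq_of_ne h2.ne',
          Pi.single_eq_of_ne h3.ne, Pi.single_eq_of_ne h3.ne'] at ej ek el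
        omega
  · cases x with
    | nil =>
      rw [List.append_nil] at hx
      rw [List.nil_append, List.cons.injEq, List.cons.injEq] at hx'
      rw [← hx, hx'.1, hx'.2.1] at hβ
      exact absurd hβ hα'
    | cons i x =>
      obtain ⟨rfl, hx'⟩ := List.cons.inj hx'
      have e : cnt u = cnt u' + (Pi.single j' 1 + cnt x) := by rw [hx, cnt_append, cnt_cons]
      have ej := congrFun e c.j
      have ek := congrFun e c.k
      have el := congrFun e c.l
      exfalso
      obtain ⟨hb, rfl, rfl⟩ | ⟨hb, rfl, rfl⟩ | ⟨hb, rfl, rfl⟩ := hb <;>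
      obtain ⟨ht, rfl, rfl⟩ | ⟨ht, rfl, rfl⟩ | ⟨ht, rfl, rfl⟩ := ht
      all_goals
        rw [ht, hb] at ej ek el
        simp only [Pi.add_apply, Pi.single_eq_same, Pi.single_eq_of_ne h1.ne,
          Pi.single_eq_of_ne h1.ne', Pi.single_eq_of_ne h2.ne, Pi.single_eq_of_ne h2.ne',
          Pi.single_eq_of_ne h3.ne, Pi.single_eq_of_ne h3.ne'] at ej ek el
        omega
end
end Zonogon

/-! ### Gluing potentials of group-valued cochains -/

namespace Zonogon

section Potential

variable {V Γ : Type} [Group Γ] {G : SimpleGraph V} {φ : V → V → Γ}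

/-- Every predicate that is preserved along the edges inside `S` is constant on `S`. -/
def IsConn (G : SimpleGraph V) (S : Set V) : Prop :=
  ∀ P : V → Prop, (∀ u ∈ S, ∀ v ∈ S, G.Adj u v → P u → P v) → ∀ u ∈ S, ∀ v ∈ S, P u → P v

/-- On the edges inside `S`, the cochain `φ` is the coboundary of `g`. -/
def IsPotential (G : SimpleGraph V) (φ : V → V → Γ) (S : Set V) (g : V → Γ) : Prop :=
  ∀ u ∈ S, ∀ v ∈ S, G.Adj u v → g u * φ u v = g v

/-- The potentials `g` on `S` and `g'` on `S'` differ by the constant `h` wherever they can be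
compared. -/
def IsLink (G : SimpleGraph V) (φ : V → V → Γ) (S S' : Set V) (g g' : V → Γ) (h : Γ) : Prop :=
  ∀ u ∈ S, ∀ v ∈ S', (u = v → g u = h * g' v) ∧ (G.Adj u v → g u * φ u v = h * g' v)

/-- The constants comparing three potentials multiply. -/
def IsCocycle (G : SimpleGraph V) (φ : V → V → Γ) (S₁ S₂ S₃ : Set V) (g₁ g₂ g₃ : V → Γ) : Prop :=
  ∀ h₁₂ h₂₃ h₁₃, IsLink G φ S₁ S₂ g₁ g₂ h₁₂ → IsLink G φ S₂ S₃ g₂ g₃ h₂₃ →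
    IsLink G φ S₁ S₃ g₁ g₃ h₁₃ → h₁₂ * h₂₃ = h₁₃

variable {S S' S₁ S₂ S₃ : Set V} {g g' g₁ g₂ g₃ : V → Γ} {h h' : Γ}

theorem IsLink.symm (hφ : ∀ u v, G.Adj u v → φ u v * φ v u = 1) (hl : IsLink G φ S S' g g' h) :
    IsLink G φ S' S g' g h⁻¹ := by
  refine fun v hv u hu => ⟨fun e => ?_, fun e => ?_⟩
  · rw [(hl u hu v hv).1 e.symm, inv_mul_cancel_left]
  · have := (hl u hu v hv).2 e.symm
    rw [eq_inv_mul_iff_mul_eq, ← mul_assoc, ← this, mul_assoc, hφ u v e.symm, mul_one]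

theorem IsLink.unique (hl : IsLink G φ S S' g g' h) (hl' : IsLink G φ S S' g g' h')
    (hne : ∃ u ∈ S, ∃ v ∈ S', u = v ∨ G.Adj u v) : h = h' := by
  obtain ⟨u, hu, v, hv, e | e⟩ := hne
  · exact mul_right_cancel (((hl u hu v hv).1 e).symm.trans ((hl' u hu v hv).1 e))
  · exact mul_right_cancel (((hl u hu v hv).2 e).symm.trans ((hl' u hu v hv).2 e))

theorem IsPotential.isLink_self (hg : IsPotential G φ S g) : IsLink G φ S S g g 1 :=
  fun u hu v hv => ⟨fun e => by rw [e, one_mul], fun e => by rw [hg u hu v hv e, one_mul]⟩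

theorem IsCocycle.swap_left (hφ : ∀ u v, G.Adj u v → φ u v * φ v u = 1)
    (hc : IsCocycle G φ S₁ S₂ S₃ g₁ g₂ g₃) : IsCocycle G φ S₂ S₁ S₃ g₂ g₁ g₃ := by
  intro h₁ h₂ h₃ l₁ l₂ l₃
  rw [← hc _ _ _ (l₁.symm hφ) l₃ l₂, mul_inv_cancel_left]

theorem IsCocycle.swap_right (hφ : ∀ u v, G.Adj u v → φ u v * φ v u = 1)
    (hc : IsCocycle G φ S₁ S₂ S₃ g₁ g₂ g₃) : IsCocycle G φ S₁ S₃ S₂ g₁ g₃ g₂ := by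
  intro h₁ h₂ h₃ l₁ l₂ l₃
  rw [← hc _ _ _ l₃ (l₂.symm hφ) l₁, inv_mul_cancel_right]

theorem IsPotential.isCocycle_self (hg : IsPotential G φ S g) (hS : S.Nonempty)
    (hne : ∃ u ∈ S, ∃ v ∈ S', u = v ∨ G.Adj u v) : IsCocycle G φ S S S' g g g' := by
  intro h₁ h₂ h₃ l₁ l₂ l₃
  obtain ⟨u, hu⟩ := hS
  rw [l₁.unique hg.isLink_self ⟨u, hu, u, hu, Or.inl rfl⟩, one_mul]
  exact l₂.unique l₃ hne

/-- If two pieces can only be compared along their intersection, which is connected, then the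
potentials on them differ by a constant. -/
theorem exists_isLink_of_inter (hg : IsPotential G φ S g) (hg' : IsPotential G φ S' g')
    (hconn : IsConn G (S ∩ S')) (hne : (S ∩ S').Nonempty)
    (hedge : ∀ u ∈ S, ∀ v ∈ S', G.Adj u v → u ∈ S' ∨ v ∈ S) : ∃ h, IsLink G φ S S' g g' h := by
  obtain ⟨x, hx⟩ := hne
  have key : ∀ u ∈ S ∩ S', g u = g x * (g' x)⁻¹ * g' u := by
    intro u hu
    refine hconn (fun u => g u = g x * (g' x)⁻¹ * g' u) (fun u hu v hv e h => ?_) x hx u hu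
      (by group)
    show g v = _
    rw [← hg u hu.1 v hv.1 e, ← hg' u hu.2 v hv.2 e, h, mul_assoc]
  refine ⟨g x * (g' x)⁻¹, fun u hu v hv => ⟨fun e => ?_, fun e => ?_⟩⟩
  · subst e; exact key u ⟨hu, hv⟩
  · rcases hedge u hu v hv e with h | h
    · rw [key u ⟨hu, h⟩, mul_assoc, hg' u h v hv e]
    · rw [hg u hu v h e, key v ⟨h, hv⟩]

/-- Potentials on the pieces of a cover glue if the comparison constants form a cocycle. -/
theorem exists_isPotential_iUnion {ι : Type} {S : ι → Set V} {g : ι → V → Γ} (i₀ : ι)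
    (hlink : ∀ i j, ∃ h, IsLink G φ (S i) (S j) (g i) (g j) h)
    (hcocycle : ∀ i j, IsCocycle G φ (S i₀) (S i) (S j) (g i₀) (g i) (g j)) :
    ∃ f, IsPotential G φ (⋃ i, S i) f := by
  classical
  choose h hh using hlink
  -- Every local potential is normalized by its comparison constant with the piece `i₀`; the value
  -- outside the union is immaterial.
  refine ⟨fun u => if hu : ∃ i, u ∈ S i then h i₀ hu.choose * g hu.choose u else 1, ?_⟩
  intro u hu v hv e
  have hu := Set.mem_iUnion.1 hu
  have hv := Set.mem_iUnion.1 hv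
  simp only [dif_pos hu, dif_pos hv]
  rw [← hcocycle _ _ _ _ _ (hh i₀ hu.choose) (hh hu.choose hv.choose) (hh i₀ hv.choose), mul_assoc,
    mul_assoc, ← ((hh hu.choose hv.choose) u hu.choose_spec v hv.choose_spec).2 e]

/-- The cocycle condition is invariant under permuting the three pieces and automatic when two of
them coincide, so increasing triples suffice. -/
theorem isCocycle_of_sorted {ι : Type} {S : ι → Set V} {g : ι → V → Γ}
    (hφ : ∀ u v, G.Adj u v → φ u v * φ v u = 1) (hg : ∀ i, IsPotential G φ (S i) (g i))
    (hS : ∀ i, (S i).Nonempty) (hne : ∀ i j, ∃ u ∈ S i, ∃ v ∈ S j, u = v ∨ G.Adj u v)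
    (f : ι → ℕ) (hf : Function.Injective f)
    (hcocycle : ∀ i j k, f i < f j → f j < f k →
      IsCocycle G φ (S i) (S j) (S k) (g i) (g j) (g k)) (i j k : ι) :
    IsCocycle G φ (S i) (S j) (S k) (g i) (g j) (g k) := by
  have hself : ∀ i j, IsCocycle G φ (S i) (S i) (S j) (g i) (g i) (g j) := fun i j =>
    (hg i).isCocycle_self (hS i) (hne i j)
  rcases lt_trichotomy (f i) (f j) with hij | hij | hij
  · rcases lt_trichotomy (f j) (f k) with hjk | hjk | hjk
    · exact hcocycle i j k hij hjk
    · obtain rfl := hf hjk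
      exact ((hself j i).swap_right hφ).swap_left hφ
    · rcases lt_trichotomy (f i) (f k) with hik | hik | hik
      · exact (hcocycle i k j hik hjk).swap_right hφ
      · obtain rfl := hf hik
        exact (hself i j).swap_right hφ
      · exact ((hcocycle k i j hik hij).swap_left hφ).swap_right hφ
  · obtain rfl := hf hij
    exact hself i k
  · rcases lt_trichotomy (f i) (f k) with hik | hik | hik
    · exact (hcocycle j i k hij hik).swap_left hφ
    · obtain rfl := hf hik
      exact (hself i j).swap_right hφ
    · rcases lt_trichotomy (f j) (f k) with hjk | hjk | hjk
      · exact ((hcocycle j k i hjk hik).swap_right hφ).swap_left hφ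
      · obtain rfl := hf hjk
        exact ((hself j i).swap_right hφ).swap_left hφ
      · exact (((hcocycle k j i hjk hij).swap_right hφ).swap_left hφ).swap_right hφ

end Potential
end Zonogon

/-! ### The eight tilings of an octagon -/

namespace Zonogon

variable {n : ℕ} {θ : Fin n → ℝ} {a : Fin n → ℕ}

/-- A sweep only permutes the letters `p`, `q`, `r`, `s`, so the letters before the cube and those
of the cube together use each direction at most once. -/
theorem carrier_subset_of_step {c : Cube n} {K : Fin n → ℕ} {p q r s : Fin n} (hpq : p < q)
    (hqr : q < r) (hrs : r < s) {A : Set (Cell n)} {x y : List (Fin n)}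
    (hA : Sweep K [p, q, r, s] A (x ++ [c.j, c.k, c.l] ++ y)) (hb : c.base = K + cnt x) :
    c.cell.carrier ⊆ (⟨K, {p, q, r, s}⟩ : Cell n).carrier := by
  rw [Cell.carrier_subset_iff]
  intro i
  have h1 := c.hjk
  have h2 := c.hkl
  have h3 := c.hjl
  have e := congrFun hA.cnt_eq i
  simp only [cnt_append, cnt_cons, cnt_nil, Pi.add_apply, Pi.zero_apply] at e
  have e4 : (Pi.single p 1 : Fin n → ℕ) i + ((Pi.single q 1 : Fin n → ℕ) i +
      ((Pi.single r 1 : Fin n → ℕ) i + (Pi.single s 1 : Fin n → ℕ) i)) =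
      if i ∈ ({p, q, r, s} : Finset (Fin n)) then 1 else 0 := by
    simp only [Pi.single_apply, Finset.mem_insert, Finset.mem_singleton]
    split_ifs <;> omega
  have e3 : (if i ∈ c.cell.dirs then 1 else 0) ≤ (Pi.single c.j 1 : Fin n → ℕ) i +
      ((Pi.single c.k 1 : Fin n → ℕ) i + (Pi.single c.l 1 : Fin n → ℕ) i) := by
    simp only [Cube.cell, Finset.mem_insert, Finset.mem_singleton]
    split_ifs with h
    · rcases h with rfl | rfl | rfl <;> simp only [Pi.single_eq_same] <;> omega
    · omega
  simp only [add_zero] at e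
  have hb' : c.cell.base i = K i + cnt x i := congrFun hb i
  rw [e4] at e
  constructor
  · show K i ≤ c.cell.base i
    omega
  · show _ ≤ K i + _
    rw [hb']
    show K i + cnt x i + (if i ∈ c.cell.dirs then 1 else 0) ≤
      K i + (if i ∈ ({p, q, r, s} : Finset (Fin n)) then 1 else 0)
    omega

theorem Cell.carrier_eq_of_four {K : Fin n → ℕ} {p q r s : Fin n} (hpq : p < q)
    (hqr : q < r) (hrs : r < s) : (⟨K, {p, q, r, s}⟩ : Cell n).carrier =
      {x | x - toReal K ∈ cbox (cnt [p, q, r, s])} := by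
  ext x
  rw [Set.mem_ofPred_eq, sub_toReal_mem_cbox_add]
  refine forall_congr' fun i => ?_
  have e4 : cnt [p, q, r, s] i = if i ∈ ({p, q, r, s} : Finset (Fin n)) then 1 else 0 := by
    simp only [cnt_cons, cnt_nil, Pi.add_apply, Pi.single_apply, Pi.zero_apply, Finset.mem_insert,
      Finset.mem_singleton]
    split_ifs <;> omega
  have : (cnt [p, q, r, s] i : ℝ) = if i ∈ ({p, q, r, s} : Finset (Fin n)) then 1 else 0 := by
    rw [e4]; split_ifs <;> norm_num
  rw [this]

section
variable {w₀ w w' u v : List (Fin n)} {L M O O' : Set (Cell n)} {c : Cube n}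

/-- A sweep in the middle of a word can be inserted into a sweep of the whole zonogon. -/
theorem Sweep.insert_middle (hL : Sweep 0 w₀ L (u ++ w ++ v)) (hO : Sweep (cnt u) w O w') :
    Sweep 0 w₀ (L ∪ O) (u ++ w' ++ v) :=
  hL.trans (Sweep.append_context u v (by rwa [zero_add]))

/-- Two sweeps of an octagon that differ by a cube give tilings related by a flip. -/
theorem upFlip_of_middle_sweep (hθ : IsAngles θ) (hw₀ : IsRightBoundary a w₀)
    (hL : Sweep 0 w₀ L (u ++ w ++ v)) {w'' : List (Fin n)} (hM : Sweep 0 (u ++ w' ++ v) M w'')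
    {A B : Set (Cell n)} {x y : List (Fin n)}
    (hA : Sweep (cnt u) w A (x ++ [c.j, c.k, c.l] ++ y)) (hb : c.base = cnt u + cnt x)
    (hB : Sweep (cnt u) (x ++ [c.l, c.k, c.j] ++ y) B w')
    (hO : O = A ∪ c.bottom ∪ B) (hO' : O' = A ∪ c.top ∪ B) {T T' : Tiling a θ}
    (hT : T.rhombi = L ∪ O ∪ M) (hT' : T'.rhombi = L ∪ O' ∪ M) : UpFlip c T T' := by
  have h1 : Sweep 0 w₀ (L ∪ A) ((u ++ x) ++ c.j :: c.k :: c.l :: (y ++ v)) := by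
    simpa using hL.insert_middle hA
  have h2 : Sweep 0 ((u ++ x) ++ c.l :: c.k :: c.j :: (y ++ v)) (B ∪ M) w'' := by
    have := (Sweep.refl (K := 0) (w := u ++ (x ++ [c.l, c.k, c.j] ++ y) ++ v)).insert_middle hB
    rw [Set.empty_union] at this
    simpa using this.trans hM
  refine upFlip_of_sweep hθ hw₀ h1 (by rw [hb, cnt_append]) h2 ?_ ?_
  · rw [hT, hO]; simp only [Set.union_assoc]
  · rw [hT', hO']; simp only [Set.union_assoc]

end

/-- The eight sets of rhombi that tile the octagon with base `K` and directions `p`, `q`, `r`,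
`s`. -/
def octagonTiling (K : Fin n → ℕ) (p q r s : Fin n) : Fin 8 → Set (Cell n) :=
  ![{rhombus K p q, rhombus (K + cnt [q]) p r, rhombus K q r, rhombus (K + cnt [q, r]) p s,
      rhombus (K + cnt [r]) q s, rhombus K r s},
    {rhombus (K + cnt [p]) q r, rhombus K p r, rhombus (K + cnt [r]) p q,
      rhombus (K + cnt [q, r]) p s, rhombus (K + cnt [r]) q s, rhombus K r s},
    {rhombus (K + cnt [p]) q r, rhombus K p r, rhombus (K + cnt [p, r]) q s,
      rhombus (K + cnt [r]) p s, rhombus (K + cnt [r, s]) p q, rhombus K r s},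
    {rhombus (K + cnt [p]) q r, rhombus (K + cnt [p, r]) q s, rhombus (K + cnt [r, s]) p q,
      rhombus (K + cnt [p]) r s, rhombus K p s, rhombus (K + cnt [s]) p r},
    {rhombus (K + cnt [r, s]) p q, rhombus K p s, rhombus (K + cnt [s]) p r,
      rhombus (K + cnt [p, q]) r s, rhombus (K + cnt [p]) q s, rhombus (K + cnt [p, s]) q r},
    {rhombus K p s, rhombus (K + cnt [p, q]) r s, rhombus (K + cnt [p]) q s,
      rhombus (K + cnt [s]) p q, rhombus (K + cnt [q, s]) p r, rhombus (K + cnt [s]) q r},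
    {rhombus (K + cnt [p, q]) r s, rhombus (K + cnt [q, s]) p r, rhombus (K + cnt [s]) q r,
      rhombus K p q, rhombus (K + cnt [q]) p s, rhombus K q s},
    {rhombus (K + cnt [s]) q r, rhombus K p q, rhombus K q s, rhombus (K + cnt [q]) p r,
      rhombus (K + cnt [q, r]) p s, rhombus (K + cnt [q]) r s}]

/-- Sweeping an octagon across the cube `c` in both ways. -/
structure OctagonStep (K : Fin n → ℕ) (p q r s : Fin n) (c : Cube n) (O O' : Set (Cell n)) :
    Prop where
  exists_sweep : ∃ A B x y, Sweep K [p, q, r, s] A (x ++ [c.j, c.k, c.l] ++ y) ∧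
    c.base = K + cnt x ∧ Sweep K (x ++ [c.l, c.k, c.j] ++ y) B [s, r, q, p] ∧
    O = A ∪ c.bottom ∪ B ∧ O' = A ∪ c.top ∪ B

section
variable {K : Fin n → ℕ} {p q r s : Fin n}

theorem Sweep.single {u v : List (Fin n)} {j m : Fin n} (h : j < m) :
    Sweep K (u ++ j :: m :: v) {rhombus (K + cnt u) j m} (u ++ m :: j :: v) := by
  simpa using Sweep.step h (.refl (K := K))

set_option linter.unusedSimpArgs false

/-- Tiling `0` is the lowest and tiling `4` the highest one. The ascent through `1, 2, 3` flips
cubes in the directions `pqr`, `pqs`, `prs`, `qrs`; the ascent through `7, 6, 5` uses the four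
parallel cubes in the reverse order. -/
theorem octagonStep_zero_one (hpq : p < q) (hqr : q < r) (hrs : r < s) :
    OctagonStep K p q r s ⟨K, p, q, r, hpq, hqr⟩ (octagonTiling K p q r s 0)
      (octagonTiling K p q r s 1) := by
  have b1 := Sweep.single (K := K) (u := [r, q]) (v := []) (hpq.trans (hqr.trans hrs))
  have b2 := Sweep.single (K := K) (u := [r]) (v := [p]) (hqr.trans hrs)
  have b3 := Sweep.single (K := K) (u := []) (v := [q, p]) hrs
  refine ⟨_, _, [], [s], .refl, by simp [cnt_nil, cnt_cons], (b1.trans b2).trans b3, ?_, ?_⟩ <;>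
  · simp only [octagonTiling, Cube.bottom_eq, Cube.top_eq, cnt_cons, cnt_nil, add_zero,
      Matrix.cons_val, add_assoc, add_comm (Pi.single q 1) (Pi.single p 1),
      add_comm (Pi.single r 1) (Pi.single p 1), add_comm (Pi.single s 1) (Pi.single p 1),
      add_comm (Pi.single r 1) (Pi.single q 1), add_comm (Pi.single s 1) (Pi.single q 1),
      add_comm (Pi.single s 1) (Pi.single r 1)]
    ext f
    simp only [Set.mem_union, Set.mem_insert_iff, Set.mem_singleton_iff, Set.mem_empty_iff_false]
    tauto

theorem octagonStep_one_two (hpq : p < q) (hqr : q < r) (hrs : r < s) :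
    OctagonStep K p q r s ⟨K + Pi.single r 1, p, q, s, hpq, (hqr.trans hrs)⟩ (octagonTiling K p q r s 1)
      (octagonTiling K p q r s 2) := by
  have a1 := Sweep.single (K := K) (u := [p]) (v := [s]) hqr
  have a2 := Sweep.single (K := K) (u := []) (v := [q, s]) (hpq.trans hqr)
  have b1 := Sweep.single (K := K) (u := []) (v := [q, p]) hrs
  refine ⟨_, _, [r], [], a1.trans a2, by simp [cnt_nil, cnt_cons], b1, ?_, ?_⟩ <;>
  · simp only [octagonTiling, Cube.bottom_eq, Cube.top_eq, cnt_cons, cnt_nil, add_zero,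
      Matrix.cons_val, add_assoc, add_comm (Pi.single q 1) (Pi.single p 1),
      add_comm (Pi.single r 1) (Pi.single p 1), add_comm (Pi.single s 1) (Pi.single p 1),
      add_comm (Pi.single r 1) (Pi.single q 1), add_comm (Pi.single s 1) (Pi.single q 1),
      add_comm (Pi.single s 1) (Pi.single r 1)]
    ext f
    simp only [Set.mem_union, Set.mem_insert_iff, Set.mem_singleton_iff, Set.mem_empty_iff_false]
    tauto

theorem octagonStep_two_three (hpq : p < q) (hqr : q < r) (hrs : r < s) :
    OctagonStep K p q r s ⟨K, p, r, s, (hpq.trans hqr), hrs⟩ (octagonTiling K p q r s 2)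
      (octagonTiling K p q r s 3) := by
  have a1 := Sweep.single (K := K) (u := [p]) (v := [s]) hqr
  have a2 := Sweep.single (K := K) (u := [p, r]) (v := []) (hqr.trans hrs)
  have b1 := Sweep.single (K := K) (u := [s, r]) (v := []) hpq
  refine ⟨_, _, [], [q], a1.trans a2, by simp [cnt_nil, cnt_cons], b1, ?_, ?_⟩ <;>
  · simp only [octagonTiling, Cube.bottom_eq, Cube.top_eq, cnt_cons, cnt_nil, add_zero,
      Matrix.cons_val, add_assoc, add_comm (Pi.single q 1) (Pi.single p 1),
      add_comm (Pi.single r 1) (Pi.single p 1), add_comm (Pi.single s 1) (Pi.single p 1),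
      add_comm (Pi.single r 1) (Pi.single q 1), add_comm (Pi.single s 1) (Pi.single q 1),
      add_comm (Pi.single s 1) (Pi.single r 1)]
    ext f
    simp only [Set.mem_union, Set.mem_insert_iff, Set.mem_singleton_iff, Set.mem_empty_iff_false]
    tauto

theorem octagonStep_three_four (hpq : p < q) (hqr : q < r) (hrs : r < s) :
    OctagonStep K p q r s ⟨K + Pi.single p 1, q, r, s, hqr, hrs⟩ (octagonTiling K p q r s 3)
      (octagonTiling K p q r s 4) := by
  have b1 := Sweep.single (K := K) (u := []) (v := [r, q]) (hpq.trans (hqr.trans hrs))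
  have b2 := Sweep.single (K := K) (u := [s]) (v := [q]) (hpq.trans hqr)
  have b3 := Sweep.single (K := K) (u := [s, r]) (v := []) hpq
  refine ⟨_, _, [p], [], .refl, by simp [cnt_nil, cnt_cons], (b1.trans b2).trans b3, ?_, ?_⟩ <;>
  · simp only [octagonTiling, Cube.bottom_eq, Cube.top_eq, cnt_cons, cnt_nil, add_zero,
      Matrix.cons_val, add_assoc, add_comm (Pi.single q 1) (Pi.single p 1),
      add_comm (Pi.single r 1) (Pi.single p 1), add_comm (Pi.single s 1) (Pi.single p 1),
      add_comm (Pi.single r 1) (Pi.single q 1), add_comm (Pi.single s 1) (Pi.single q 1),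
      add_comm (Pi.single s 1) (Pi.single r 1)]
    ext f
    simp only [Set.mem_union, Set.mem_insert_iff, Set.mem_singleton_iff, Set.mem_empty_iff_false]
    tauto

theorem octagonStep_five_four (hpq : p < q) (hqr : q < r) (hrs : r < s) :
    OctagonStep K p q r s ⟨K + Pi.single s 1, p, q, r, hpq, hqr⟩ (octagonTiling K p q r s 5)
      (octagonTiling K p q r s 4) := by
  have a1 := Sweep.single (K := K) (u := [p, q]) (v := []) hrs
  have a2 := Sweep.single (K := K) (u := [p]) (v := [r]) (hqr.trans hrs)
  have a3 := Sweep.single (K := K) (u := []) (v := [q, r]) (hpq.trans (hqr.trans hrs))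
  refine ⟨_, _, [s], [], (a1.trans a2).trans a3, by simp [cnt_nil, cnt_cons], .refl, ?_, ?_⟩ <;>
  · simp only [octagonTiling, Cube.bottom_eq, Cube.top_eq, cnt_cons, cnt_nil, add_zero,
      Matrix.cons_val, add_assoc, add_comm (Pi.single q 1) (Pi.single p 1),
      add_comm (Pi.single r 1) (Pi.single p 1), add_comm (Pi.single s 1) (Pi.single p 1),
      add_comm (Pi.single r 1) (Pi.single q 1), add_comm (Pi.single s 1) (Pi.single q 1),
      add_comm (Pi.single s 1) (Pi.single r 1)]
    ext f
    simp only [Set.mem_union, Set.mem_insert_iff, Set.mem_singleton_iff, Set.mem_empty_iff_false]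
    tauto

theorem octagonStep_six_five (hpq : p < q) (hqr : q < r) (hrs : r < s) :
    OctagonStep K p q r s ⟨K, p, q, s, hpq, (hqr.trans hrs)⟩ (octagonTiling K p q r s 6)
      (octagonTiling K p q r s 5) := by
  have a1 := Sweep.single (K := K) (u := [p, q]) (v := []) hrs
  have b1 := Sweep.single (K := K) (u := [s, q]) (v := []) (hpq.trans hqr)
  have b2 := Sweep.single (K := K) (u := [s]) (v := [p]) hqr
  refine ⟨_, _, [], [r], a1, by simp [cnt_nil, cnt_cons], b1.trans b2, ?_, ?_⟩ <;>
  · simp only [octagonTiling, Cube.bottom_eq, Cube.top_eq, cnt_cons, cnt_nil, add_zero,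
      Matrix.cons_val, add_assoc, add_comm (Pi.single q 1) (Pi.single p 1),
      add_comm (Pi.single r 1) (Pi.single p 1), add_comm (Pi.single s 1) (Pi.single p 1),
      add_comm (Pi.single r 1) (Pi.single q 1), add_comm (Pi.single s 1) (Pi.single q 1),
      add_comm (Pi.single s 1) (Pi.single r 1)]
    ext f
    simp only [Set.mem_union, Set.mem_insert_iff, Set.mem_singleton_iff, Set.mem_empty_iff_false]
    tauto

theorem octagonStep_seven_six (hpq : p < q) (hqr : q < r) (hrs : r < s) :
    OctagonStep K p q r s ⟨K + Pi.single q 1, p, r, s, (hpq.trans hqr), hrs⟩ (octagonTiling K p q r s 7)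
      (octagonTiling K p q r s 6) := by
  have a1 := Sweep.single (K := K) (u := []) (v := [r, s]) hpq
  have b1 := Sweep.single (K := K) (u := []) (v := [r, p]) (hqr.trans hrs)
  have b2 := Sweep.single (K := K) (u := [s]) (v := [p]) hqr
  refine ⟨_, _, [q], [], a1, by simp [cnt_nil, cnt_cons], b1.trans b2, ?_, ?_⟩ <;>
  · simp only [octagonTiling, Cube.bottom_eq, Cube.top_eq, cnt_cons, cnt_nil, add_zero,
      Matrix.cons_val, add_assoc, add_comm (Pi.single q 1) (Pi.single p 1),
      add_comm (Pi.single r 1) (Pi.single p 1), add_comm (Pi.single s 1) (Pi.single p 1),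
      add_comm (Pi.single r 1) (Pi.single q 1), add_comm (Pi.single s 1) (Pi.single q 1),
      add_comm (Pi.single s 1) (Pi.single r 1)]
    ext f
    simp only [Set.mem_union, Set.mem_insert_iff, Set.mem_singleton_iff, Set.mem_empty_iff_false]
    tauto

theorem octagonStep_zero_seven (hpq : p < q) (hqr : q < r) (hrs : r < s) :
    OctagonStep K p q r s ⟨K, q, r, s, hqr, hrs⟩ (octagonTiling K p q r s 0)
      (octagonTiling K p q r s 7) := by
  have a1 := Sweep.single (K := K) (u := []) (v := [r, s]) hpq
  have a2 := Sweep.single (K := K) (u := [q]) (v := [s]) (hpq.trans hqr)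
  have a3 := Sweep.single (K := K) (u := [q, r]) (v := []) (hpq.trans (hqr.trans hrs))
  refine ⟨_, _, [], [p], (a1.trans a2).trans a3, by simp [cnt_nil, cnt_cons], .refl, ?_, ?_⟩ <;>
  · simp only [octagonTiling, Cube.bottom_eq, Cube.top_eq, cnt_cons, cnt_nil, add_zero,
      Matrix.cons_val, add_assoc, add_comm (Pi.single q 1) (Pi.single p 1),
      add_comm (Pi.single r 1) (Pi.single p 1), add_comm (Pi.single s 1) (Pi.single p 1),
      add_comm (Pi.single r 1) (Pi.single q 1), add_comm (Pi.single s 1) (Pi.single q 1),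
      add_comm (Pi.single s 1) (Pi.single r 1)]
    ext f
    simp only [Set.mem_union, Set.mem_insert_iff, Set.mem_singleton_iff, Set.mem_empty_iff_false]
    tauto

end

end Zonogon

namespace Zonogon

variable {n : ℕ} {θ : Fin n → ℝ} {a : Fin n → ℕ} {K : Fin n → ℕ} {p q r s : Fin n}

section
variable {c : Cube n} {O O' : Set (Cell n)}

theorem OctagonStep.sweep_left (h : OctagonStep K p q r s c O O') :
    Sweep K [p, q, r, s] O [s, r, q, p] := by
  obtain ⟨A, B, x, y, hA, hb, hB, rfl, -⟩ := h.exists_sweep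
  exact (hA.trans (Sweep.append_context x y (hb ▸ c.sweep_bottom))).trans hB

theorem OctagonStep.sweep_right (h : OctagonStep K p q r s c O O') :
    Sweep K [p, q, r, s] O' [s, r, q, p] := by
  obtain ⟨A, B, x, y, hA, hb, hB, -, rfl⟩ := h.exists_sweep
  exact (hA.trans (Sweep.append_context x y (hb ▸ c.sweep_top))).trans hB

theorem OctagonStep.carrier_subset (h : OctagonStep K p q r s c O O') (hpq : p < q) (hqr : q < r)
    (hrs : r < s) : c.cell.carrier ⊆ (⟨K, {p, q, r, s}⟩ : Cell n).carrier := by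
  obtain ⟨A, B, x, y, hA, hb, -⟩ := h.exists_sweep
  exact carrier_subset_of_step hpq hqr hrs hA hb

end

theorem octagonTiling_sweep (hpq : p < q) (hqr : q < r) (hrs : r < s) (i : Fin 8) :
    Sweep K [p, q, r, s] (octagonTiling K p q r s i) [s, r, q, p] := by
  fin_cases i
  · exact (octagonStep_zero_one hpq hqr hrs).sweep_left
  · exact (octagonStep_zero_one hpq hqr hrs).sweep_right
  · exact (octagonStep_one_two hpq hqr hrs).sweep_right
  · exact (octagonStep_two_three hpq hqr hrs).sweep_right
  · exact (octagonStep_three_four hpq hqr hrs).sweep_right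
  · exact (octagonStep_five_four hpq hqr hrs).sweep_left
  · exact (octagonStep_six_five hpq hqr hrs).sweep_left
  · exact (octagonStep_seven_six hpq hqr hrs).sweep_left

set_option linter.unusedSimpArgs false in
theorem octagonTiling_injective (hpq : p < q) (hqr : q < r) (hrs : r < s) :
    Function.Injective (octagonTiling K p q r s) := by
  have hpr := hpq.trans hqr
  have hqs := hqr.trans hrs
  have hps := hpq.trans hqs
  have h1 := hpq.ne
  have h2 := hqr.ne
  have h3 := hrs.ne
  have h4 := hpr.ne
  have h5 := hqs.ne
  have h6 := hps.ne
  -- The position of the `qr` rhombus relative to the directions `p` and `s`, and that of the `ps`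
  -- rhombus relative to `q` and `r`, give four bits that distinguish the eight tilings.
  have hD : ∀ i X, rhombus X q r ∈ octagonTiling K p q r s i →
      X p = K p + ![0, 1, 1, 1, 1, 0, 0, 0] i ∧ X s = K s + ![0, 0, 0, 0, 1, 1, 1, 1] i := by
    intro i X
    fin_cases i <;>
      simp only [octagonTiling, Fin.reduceFinMk, Fin.zero_eta, Fin.mk_one, Matrix.cons_val, Set.mem_insert_iff, Set.mem_singleton_iff,
        rhombus_inj hqr hpq, rhombus_inj hqr hpr, rhombus_inj hqr hps, rhombus_inj hqr hqr,
        rhombus_inj hqr hqs, rhombus_inj hqr hrs, h1.symm, h2, h5, h2.symm, h3, and_false,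
        false_and, or_false, false_or, and_true] <;>
      rintro rfl <;>
      simp [cnt_cons, cnt_nil, h1, h2, h3, h4, h5, h6, h1.symm, h2.symm, h3.symm, h4.symm,
        h5.symm, h6.symm]
  have hD' : ∀ i, ∃ X, rhombus X q r ∈ octagonTiling K p q r s i := by
    intro i
    fin_cases i
    · exact ⟨K, by simp [octagonTiling]⟩
    iterate 3 exact ⟨K + cnt [p], by simp [octagonTiling]⟩
    · exact ⟨K + cnt [p, s], by simp [octagonTiling]⟩
    iterate 3 exact ⟨K + cnt [s], by simp [octagonTiling]⟩
  have hE : ∀ i X, rhombus X p s ∈ octagonTiling K p q r s i →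
      X q = K q + ![1, 1, 0, 0, 0, 0, 1, 1] i ∧ X r = K r + ![1, 1, 1, 0, 0, 0, 0, 1] i := by
    intro i X
    fin_cases i <;>
      simp only [octagonTiling, Fin.reduceFinMk, Fin.zero_eta, Fin.mk_one, Matrix.cons_val, Set.mem_insert_iff, Set.mem_singleton_iff,
        rhombus_inj hps hpq, rhombus_inj hps hpr, rhombus_inj hps hps, rhombus_inj hps hqr,
        rhombus_inj hps hqs, rhombus_inj hps hrs, h1, h4, h3.symm, h5.symm, and_false,
        false_and, or_false, false_or, and_true] <;>
      rintro rfl <;>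
      simp [cnt_cons, cnt_nil, h1, h2, h3, h4, h5, h6, h1.symm, h2.symm, h3.symm, h4.symm,
        h5.symm, h6.symm]
  have hE' : ∀ i, ∃ X, rhombus X p s ∈ octagonTiling K p q r s i := by
    intro i
    fin_cases i
    iterate 2 exact ⟨K + cnt [q, r], by simp [octagonTiling]⟩
    · exact ⟨K + cnt [r], by simp [octagonTiling]⟩
    iterate 3 exact ⟨K, by simp [octagonTiling]⟩
    · exact ⟨K + cnt [q], by simp [octagonTiling]⟩
    · exact ⟨K + cnt [q, r], by simp [octagonTiling]⟩
  intro i j hij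
  obtain ⟨X, hX⟩ := hD' i
  obtain ⟨Y, hY⟩ := hE' i
  obtain ⟨d1, d2⟩ := hD i X hX
  obtain ⟨d3, d4⟩ := hD j X (hij ▸ hX)
  obtain ⟨e1, e2⟩ := hE i Y hY
  obtain ⟨e3, e4⟩ := hE j Y (hij ▸ hY)
  have f1 := add_left_cancel (d1.symm.trans d3)
  have f2 := add_left_cancel (d2.symm.trans d4)
  have f3 := add_left_cancel (e1.symm.trans e3)
  have f4 := add_left_cancel (e2.symm.trans e4)
  clear hD hD' hE hE' hX hY d1 d2 d3 d4 e1 e2 e3 e4 hij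
  revert i j
  decide

/-- Four consecutive increasing steps of a sweep give rise to an octagon in the flip complex. -/
theorem exists_isOctagonCycle (hθ : IsAngles θ) {w₀ u v : List (Fin n)} {L : Set (Cell n)}
    (hw₀ : IsRightBoundary a w₀) (hpq : p < q) (hqr : q < r) (hrs : r < s)
    (hL : Sweep 0 w₀ L (u ++ [p, q, r, s] ++ v)) :
    ∃ w : ZMod 8 → Tiling a θ, IsOctagonCycle w ∧ (∀ j, L ⊆ (w j).rhombi) ∧
      ∀ j : Fin 8, octagonTiling (cnt u) p q r s j ⊆ (w j).rhombi := by
  set σ : Cell n := ⟨cnt u, {p, q, r, s}⟩ with hσ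
  have hO := octagonTiling_sweep (K := cnt u) hpq hqr hrs
  obtain ⟨M, w', hM, hw'⟩ := Sweep.exists_complete 0 (u ++ [s, r, q, p] ++ v)
  -- The eight tilings share the swept part `L` and the completion `M`. Both are disjoint from the
  -- rhombi inside the octagon, which are therefore determined by the tiling.
  let T : Fin 8 → Tiling a θ := fun i => Tiling.ofSweep hθ hw₀ ((hL.insert_middle (hO i)).trans hM) hw'
  have hT : ∀ i, (T i).rhombi = L ∪ octagonTiling (cnt u) p q r s i ∪ M := fun i => rfl
  have hOT : ∀ i, octagonTiling (cnt u) p q r s i ⊆ (T i).rhombi := fun i f hf => Or.inl (Or.inr hf)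
  have hstep : ∀ {c : Cube n} {i j : Fin 8}, OctagonStep (cnt u) p q r s c
      (octagonTiling (cnt u) p q r s i) (octagonTiling (cnt u) p q r s j) →
      c.cell.carrier ⊆ σ.carrier ∧ UpFlip c (T i) (T j) := by
    intro c i j h
    refine ⟨h.carrier_subset hpq hqr hrs, ?_⟩
    obtain ⟨A, B, x, y, hA, hb, hB, hi, hj⟩ := h.exists_sweep
    exact upFlip_of_middle_sweep hθ hw₀ hL hM hA hb hB hi hj (hT i) (hT j)
  have hinj : Function.Injective T := by
    have hsub : ∀ i j, T i = T j →
        octagonTiling (cnt u) p q r s i ⊆ octagonTiling (cnt u) p q r s j := by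
      intro i j hij f hf
      have hOc : Sweep 0 (u ++ [p, q, r, s] ++ v) (octagonTiling (cnt u) p q r s i)
          (u ++ [s, r, q, p] ++ v) := Sweep.append_context u v (by rw [zero_add]; exact hO i)
      have h1 := Set.disjoint_right.1 (hL.disjoint hθ hOc) hf
      have h2 := Set.disjoint_left.1 (hOc.disjoint hθ hM) hf
      have h3 : f ∈ (T j).rhombi := hij ▸ hOT i hf
      rcases h3 with (h3 | h3) | h3
      · exact absurd h3 h1
      · exact h3
      · exact absurd h3 h2
    exact fun i j hij => octagonTiling_injective hpq hqr hrs
      ((hsub i j hij).antisymm (hsub j i hij.symm))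
  have hcnt : cnt u + (cnt [p, q, r, s] + cnt v) = a := by
    rw [← hw₀.cnt_eq, ← hL.cnt_eq, cnt_append, cnt_append, add_assoc]
  have hσeq := Cell.carrier_eq_of_four (K := cnt u) hpq hqr hrs
  refine ⟨T, ⟨hinj, σ, ?_, ?_, fun j => ⟨⟨_, hOT j, ?_, ?_⟩, ?_⟩⟩,
    fun i f hf => Or.inl (Or.inl hf), hOT⟩
  · have hpr := hpq.trans hqr
    have hqs := hqr.trans hrs
    have hps := hpq.trans hqs
    show ({p, q, r, s} : Finset (Fin n)).card = 4
    rw [Finset.card_insert_of_notMem, Finset.card_insert_of_notMem, Finset.card_pair hrs.ne] <;>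
      simp [hpq.ne, hqr.ne, hpr.ne, hqs.ne, hps.ne]
  · rw [hσ, hσeq]
    intro x hx i
    obtain ⟨h1, h2⟩ := sub_toReal_mem_cbox_add (cnt u) |>.1 hx i
    refine ⟨(Nat.cast_nonneg _).trans h1, h2.trans ?_⟩
    rw [← hcnt]
    simp only [Pi.add_apply, Nat.cast_add]
    have : (0 : ℝ) ≤ cnt v i := Nat.cast_nonneg _
    linarith
  · intro f hf x hx
    rw [hσ, hσeq]
    exact (hO j).carrier_subset f hf x hx
  · rw [hσ, hσeq]
    refine (hO j).tiles hθ ?_ ?_ hpq.ne (by simp [cnt]) (by simp [cnt]) <;>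
      simp [hpq.le, hqr.le, hrs.le, (hpq.trans hqr).le, (hqr.trans hrs).le,
        (hpq.trans (hqr.trans hrs)).le]
  · have up : ∀ {c : Cube n} {i j : Fin 8}, OctagonStep (cnt u) p q r s c
        (octagonTiling (cnt u) p q r s i) (octagonTiling (cnt u) p q r s j) →
        ∃ c : Cube n, c.cell.carrier ⊆ σ.carrier ∧ FlipAt c (T i) (T j) :=
      fun h => ⟨_, (hstep h).1, Or.inl (hstep h).2⟩
    have down : ∀ {c : Cube n} {i j : Fin 8}, OctagonStep (cnt u) p q r s c
        (octagonTiling (cnt u) p q r s i) (octagonTiling (cnt u) p q r s j) →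
        ∃ c : Cube n, c.cell.carrier ⊆ σ.carrier ∧ FlipAt c (T j) (T i) :=
      fun h => ⟨_, (hstep h).1, Or.inr (hstep h).2⟩
    fin_cases j
    · exact up (octagonStep_zero_one hpq hqr hrs)
    · exact up (octagonStep_one_two hpq hqr hrs)
    · exact up (octagonStep_two_three hpq hqr hrs)
    · exact up (octagonStep_three_four hpq hqr hrs)
    · exact down (octagonStep_five_four hpq hqr hrs)
    · exact down (octagonStep_six_five hpq hqr hrs)
    · exact down (octagonStep_seven_six hpq hqr hrs)
    · exact down (octagonStep_zero_seven hpq hqr hrs)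

end Zonogon

/-! ### Comparing potentials across a cube and around an octagon -/

namespace Zonogon

variable {n : ℕ} {θ : Fin n → ℝ} {a : Fin n → ℕ} {w₀ w w' : List (Fin n)} {L : Set (Cell n)}

theorem Sweep.weight_lt {K : Fin n → ℕ} (h : Sweep K w L w') :
    weight w' ≤ weight w ∧ (L.Nonempty → weight w' < weight w) := by
  induction h with
  | refl => simp
  | step hjm _ ih =>
    have := weight_swap_lt _ _ hjm |>.trans_le ih.1
    exact ⟨this.le, fun _ => this⟩

theorem Sweep.swap (h : Sweep 0 w₀ L w) {u v : List (Fin n)} {j m : Fin n} (hjm : j < m)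
    (e : w = u ++ j :: m :: v) :
    Sweep 0 w₀ (insert (rhombus (cnt u) j m) L) (u ++ m :: j :: v) := by
  subst e
  simpa using Sweep.step hjm h

/-- The tilings that contain a given set of rhombi. -/
def containing (a : Fin n → ℕ) (θ : Fin n → ℝ) (L : Set (Cell n)) : Set (Tiling a θ) :=
  {T | L ⊆ T.rhombi}

theorem containing_anti {L M : Set (Cell n)} (h : L ⊆ M) :
    containing a θ M ⊆ containing a θ L := fun _ hT => h.trans hT

theorem containing_inter {L M : Set (Cell n)} :
    containing a θ L ∩ containing a θ M = containing a θ (L ∪ M) := by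
  ext T; exact Set.union_subset_iff.symm

theorem Sweep.nonempty_containing (hθ : IsAngles θ) (hw₀ : IsRightBoundary a w₀)
    (h : Sweep 0 w₀ L w) : (containing a θ L).Nonempty := by
  obtain ⟨M, w', hM, hw'⟩ := Sweep.exists_complete 0 w
  exact ⟨Tiling.ofSweep hθ hw₀ (h.trans hM) hw', Set.subset_union_left⟩

/-- A group-valued cochain on the flip graph without holonomy around the squares and octagons. -/
structure IsFlat {Γ : Type} [Group Γ] (φ : Tiling a θ → Tiling a θ → Γ) : Prop where
  inv : ∀ u v, (flipGraph a θ).Adj u v → φ u v * φ v u = 1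
  square : ∀ w : ZMod 4 → Tiling a θ, IsSquareCycle w → Function.Injective w → HasCyclePrimitive φ w
  octagon : ∀ w : ZMod 8 → Tiling a θ, IsOctagonCycle w → HasCyclePrimitive φ w

section
variable {Γ : Type} [Group Γ] {φ : Tiling a θ → Tiling a θ → Γ}

theorem IsFlat.commute (hφ : IsFlat φ) (hθ : IsAngles θ) {c d : Cube n} {T T₁ T₂ T₃ : Tiling a θ}
    (hd : UpFlip d T T₁) (h : UpFlip c T T₂) (h' : UpFlip c T₁ T₃) :
    φ T T₂ * φ T₂ T₃ = φ T T₁ * φ T₁ T₃ := by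
  obtain ⟨hs, hi⟩ := hd.square hθ h h'
  obtain ⟨q, hq⟩ := hφ.square _ hs hi
  have h0 : q 0 * φ T T₂ = q 1 := hq 0
  have h1 : q 1 * φ T₂ T₃ = q 2 := hq 1
  have h2 : q 2 * φ T₃ T₁ = q 3 := hq 2
  have h3 : q 3 * φ T₁ T = q 0 := hq 3
  have e1 := hφ.inv T T₁ ⟨d, Or.inl hd⟩
  have e3 := hφ.inv T₁ T₃ ⟨c, Or.inl h'⟩
  have f1 : q 3 = q 0 * φ T T₁ := by
    rw [← h3, mul_assoc, mul_eq_one_comm.1 e1, mul_one]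
  have f2 : q 2 = q 3 * φ T₁ T₃ := by
    rw [← h2, mul_assoc, mul_eq_one_comm.1 e3, mul_one]
  refine mul_left_cancel (a := q 0) ?_
  rw [← mul_assoc, h0, h1, f2, f1, mul_assoc]

/-- An edge of the flip graph may be an upward or a downward flip. In the second case the square is
read from its other corner and the relation inverted. -/
theorem IsFlat.commute_of_adj (hφ : IsFlat φ) (hθ : IsAngles θ) {c : Cube n}
    {T T₁ T₂ T₃ : Tiling a θ} (hd : (flipGraph a θ).Adj T T₁) (h : UpFlip c T T₂)
    (h' : UpFlip c T₁ T₃) :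
    (flipGraph a θ).Adj T₂ T₃ ∧ φ T T₂ * φ T₂ T₃ = φ T T₁ * φ T₁ T₃ := by
  obtain ⟨d, hd | hd⟩ := hd
  · exact ⟨⟨d, Or.inl (hd.commute hθ h h')⟩, hφ.commute hθ hd h h'⟩
  · have h1 := hd.commute hθ h' h
    refine ⟨⟨d, Or.inr h1⟩, ?_⟩
    have e := hφ.commute hθ hd h' h
    have e1 := hφ.inv _ _ ⟨d, Or.inr hd⟩
    have e2 := hφ.inv T₂ T₃ ⟨d, Or.inr h1⟩
    have f1 : φ T₁ T = (φ T T₁)⁻¹ := (inv_eq_of_mul_eq_one_right e1).symm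
    have f2 : φ T₃ T₂ = (φ T₂ T₃)⁻¹ := (inv_eq_of_mul_eq_one_right e2).symm
    rw [f1, f2] at e
    rw [← inv_mul_eq_iff_eq_mul, ← mul_assoc, ← e, mul_assoc, inv_mul_cancel, mul_one]

theorem Cube.notMem_of_mem (hθ : IsAngles θ) {c : Cube n} {T : Tiling a θ}
    (h : rhombus c.base c.j c.k ∈ T.rhombi) :
    rhombus (c.base + Pi.single c.j 1) c.k c.l ∉ T.rhombi := by
  intro h'
  refine Tiling.adjacent_conflict hθ c.hjk c.hkl h fun t ht => ?_
  have := Tiling.mem_union h' c.hkl.ne (s := 0) (by simp) ht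
  rwa [Pi.single_zero, zero_add] at this

/-- The only edges between the tilings with rhombi at two overlapping ascents are the flips at the
cube spanned by these ascents. -/
theorem Cube.upFlip_of_adj (hθ : IsAngles θ) {c : Cube n} {u : List (Fin n)}
    (hb : c.base = cnt u) {T T' : Tiling a θ} (hadj : (flipGraph a θ).Adj T T')
    (h : rhombus c.base c.j c.k ∈ T.rhombi)
    (h' : rhombus (c.base + Pi.single c.j 1) c.k c.l ∈ T'.rhombi) : UpFlip c T T' := by
  have h1 := c.notMem_of_mem hθ h
  have h2 : rhombus c.base c.j c.k ∉ T'.rhombi := fun h => c.notMem_of_mem hθ h h'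
  rw [hb, ← cnt_append_singleton] at h' h1
  rw [hb] at h h2
  have e : u ++ c.j :: c.k :: [c.l] = (u ++ [c.j]) ++ c.k :: c.l :: [] := by simp
  obtain ⟨d, hd | hd⟩ := hadj
  · obtain ⟨-, -, e1, e2, e3, e4⟩ := hd.eq_of_ascents c.hjk c.hkl e h h2 h' h1
    have : d = c := by
      cases c; cases d
      simp only at e1 e2 e3 e4 hb
      subst e1 e2 e3 e4
      simp [hb]
    rwa [← this]
  · obtain ⟨e1, -⟩ := hd.eq_of_ascents c.hkl c.hjk e.symm h' h1 h h2
    have := congrArg List.length e1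
    simp only [List.length_append, List.length_singleton] at this
    omega

/-- The pieces are disjoint, and the edges between them are the flips at `c`, one for each tiling
containing `L` and the bottom of `c`. Along an edge between two such tilings the flips commute, so
by the squares the comparison constant does not change; the set of these tilings is connected. -/
theorem exists_isLink_of_cube (hφ : IsFlat φ) (hθ : IsAngles θ) (hw₀ : IsRightBoundary a w₀)
    {c : Cube n} {u v : List (Fin n)} (hb : c.base = cnt u)
    (hL : Sweep 0 w₀ L (u ++ c.j :: c.k :: c.l :: v)) {g g' : Tiling a θ → Γ}
    (hg : IsPotential (flipGraph a θ) φ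
      (containing a θ (insert (rhombus c.base c.j c.k) L)) g)
    (hg' : IsPotential (flipGraph a θ) φ
      (containing a θ (insert (rhombus (c.base + Pi.single c.j 1) c.k c.l) L)) g')
    (hconn : IsConn (flipGraph a θ) (containing a θ (L ∪ c.bottom))) :
    ∃ h, IsLink (flipGraph a θ) φ (containing a θ (insert (rhombus c.base c.j c.k) L))
      (containing a θ (insert (rhombus (c.base + Pi.single c.j 1) c.k c.l) L)) g g' h := by
  have hflip : ∀ T ∈ containing a θ (L ∪ c.bottom), ∃ T', UpFlip c T T' ∧
      T' ∈ containing a θ (L ∪ c.top) := fun T hT => exists_upFlip hθ hw₀ hL hb hT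
  have hbot : containing a θ (L ∪ c.bottom) ⊆
      containing a θ (insert (rhombus c.base c.j c.k) L) := by
    refine containing_anti (Set.insert_subset (Or.inr ?_) Set.subset_union_left)
    rw [c.bottom_eq]; exact Set.mem_insert _ _
  have htop : containing a θ (L ∪ c.top) ⊆
      containing a θ (insert (rhombus (c.base + Pi.single c.j 1) c.k c.l) L) := by
    refine containing_anti (Set.insert_subset (Or.inr ?_) Set.subset_union_left)
    rw [c.top_eq]; exact Set.mem_insert _ _
  obtain ⟨x, hx⟩ := (hL.trans (c.sweep_bottom_context hb)).nonempty_containing hθ hw₀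
  obtain ⟨y, hxy, -⟩ := hflip x hx
  refine ⟨g x * φ x y * (g' y)⁻¹, fun T hT T' hT' => ⟨fun e => ?_, fun e => ?_⟩⟩
  · subst e
    exact absurd (hT' (Set.mem_insert _ _)) (c.notMem_of_mem hθ (hT (Set.mem_insert _ _)))
  · have hup := c.upFlip_of_adj hθ hb e (hT (Set.mem_insert _ _))
      (hT' (Set.mem_insert _ _))
    have hTb : T ∈ containing a θ (L ∪ c.bottom) :=
      Set.union_subset ((Set.subset_insert _ _).trans hT) hup.2.1
    refine hconn (fun T => ∀ T', UpFlip c T T' → g T * φ T T' = g x * φ x y * (g' y)⁻¹ * g' T')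
      (fun T₁ h₁ T₂ h₂ e h T₃ h₃ => ?_) x hx T hTb (fun T' h => ?_) T' hup
    · obtain ⟨T₄, h₄, h₄'⟩ := hflip T₁ h₁
      obtain ⟨T₅, h₅, h₅'⟩ := hflip T₂ h₂
      obtain rfl := h₃.unique h₅
      obtain ⟨e1, e2⟩ := hφ.commute_of_adj hθ e h₄ h₃
      rw [← hg T₁ (hbot h₁) T₂ (hbot h₂) e, mul_assoc, ← e2, ← mul_assoc, h T₄ h₄, mul_assoc,
        hg' T₄ (htop h₄') T₃ (htop h₅') e1]
    · rw [hxy.unique h, inv_mul_cancel_right]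

/-- The octagon runs through the three pieces: tilings `6, 7, 0` lie in the first, `1, 2, 3` in the
second, `4, 5, 6` in the third. Divided by a primitive along the octagon, each potential is constant
on its arc. The edges `0 1` and `3 4` and the common tiling `6` then relate the three constants. -/
theorem isCocycle_of_octagon (hφ : IsFlat φ) (hθ : IsAngles θ) (hw₀ : IsRightBoundary a w₀)
    {u v : List (Fin n)} {p q r s : Fin n} (hpq : p < q) (hqr : q < r) (hrs : r < s)
    (hL : Sweep 0 w₀ L (u ++ [p, q, r, s] ++ v)) {g₁ g₂ g₃ : Tiling a θ → Γ}
    (hg₁ : IsPotential (flipGraph a θ) φ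
      (containing a θ (insert (rhombus (cnt u) p q) L)) g₁)
    (hg₂ : IsPotential (flipGraph a θ) φ
      (containing a θ (insert (rhombus (cnt u + cnt [p]) q r) L)) g₂)
    (hg₃ : IsPotential (flipGraph a θ) φ
      (containing a θ (insert (rhombus (cnt u + cnt [p, q]) r s) L)) g₃) :
    IsCocycle (flipGraph a θ) φ (containing a θ (insert (rhombus (cnt u) p q) L))
      (containing a θ (insert (rhombus (cnt u + cnt [p]) q r) L))
      (containing a θ (insert (rhombus (cnt u + cnt [p, q]) r s) L)) g₁ g₂ g₃ := by
  obtain ⟨T, hT, hLT, hOT⟩ := exists_isOctagonCycle hθ hw₀ hpq hqr hrs hL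
  obtain ⟨x, hx⟩ := hφ.octagon T hT
  have hmem : ∀ (j : Fin 8) (f : Cell n), f ∈ octagonTiling (cnt u) p q r s j →
      T j ∈ containing a θ (insert f L) := fun j f hf => Set.insert_subset (hOT j hf) (hLT j)
  have h₁ : ∀ j ∈ ({6, 7, 0} : Set (Fin 8)),
      T j ∈ containing a θ (insert (rhombus (cnt u) p q) L) := by
    rintro j (rfl | rfl | rfl) <;> exact hmem _ _ (by simp [octagonTiling])
  have h₂ : ∀ j ∈ ({1, 2, 3} : Set (Fin 8)),
      T j ∈ containing a θ (insert (rhombus (cnt u + cnt [p]) q r) L) := by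
    rintro j (rfl | rfl | rfl) <;> exact hmem _ _ (by simp [octagonTiling])
  have h₃ : ∀ j ∈ ({4, 5, 6} : Set (Fin 8)),
      T j ∈ containing a θ (insert (rhombus (cnt u + cnt [p, q]) r s) L) := by
    rintro j (rfl | rfl | rfl) <;> exact hmem _ _ (by simp [octagonTiling])
  have key : ∀ {S : Set (Tiling a θ)} {g : Tiling a θ → Γ}, IsPotential (flipGraph a θ) φ S g →
      ∀ j : ZMod 8, T j ∈ S → T (j + 1) ∈ S →
        g (T (j + 1)) * (x (j + 1))⁻¹ = g (T j) * (x j)⁻¹ := by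
    intro S g hg j h h'
    rw [← hg _ h _ h' (hT.adj j), ← hx j]
    group
  have e1 := (key hg₁ 6 (h₁ 6 (by simp)) (h₁ 7 (by simp)))
  have e2 := (key hg₁ 7 (h₁ 7 (by simp)) (h₁ 0 (by simp)))
  have e3 := (key hg₂ 1 (h₂ 1 (by simp)) (h₂ 2 (by simp)))
  have e4 := (key hg₂ 2 (h₂ 2 (by simp)) (h₂ 3 (by simp)))
  have e5 := (key hg₃ 4 (h₃ 4 (by simp)) (h₃ 5 (by simp)))
  have e6 := (key hg₃ 5 (h₃ 5 (by simp)) (h₃ 6 (by simp)))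
  intro h₁₂ h₂₃ h₁₃ l₁₂ l₂₃ l₁₃
  have m₁₂ : g₁ (T 0) * φ (T 0) (T 1) = h₁₂ * g₂ (T 1) :=
    (l₁₂ _ (h₁ 0 (by simp)) _ (h₂ 1 (by simp))).2 (hT.adj 0)
  have m₂₃ : g₂ (T 3) * φ (T 3) (T 4) = h₂₃ * g₃ (T 4) :=
    (l₂₃ _ (h₂ 3 (by simp)) _ (h₃ 4 (by simp))).2 (hT.adj 3)
  have m₁₃ : g₁ (T 6) = h₁₃ * g₃ (T 6) :=
    (l₁₃ _ (h₁ 6 (by simp)) _ (h₃ 6 (by simp))).1 rfl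
  have x0 : x 0 * φ (T 0) (T 1) = x 1 := hx 0
  have x3 : x 3 * φ (T 3) (T 4) = x 4 := hx 3
  have n₁₂ : g₁ (T 0) * (x 0)⁻¹ = h₁₂ * (g₂ (T 1) * (x 1)⁻¹) := by
    rw [← mul_assoc, ← m₁₂, ← x0]; group
  have n₂₃ : g₂ (T 3) * (x 3)⁻¹ = h₂₃ * (g₃ (T 4) * (x 4)⁻¹) := by
    rw [← mul_assoc, ← m₂₃, ← x3]; group
  have n₁₃ : g₁ (T 6) * (x 6)⁻¹ = h₁₃ * (g₃ (T 6) * (x 6)⁻¹) := by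
    rw [← mul_assoc, ← m₁₃]
  have f1 : g₁ (T 0) * (x 0)⁻¹ = g₁ (T 6) * (x 6)⁻¹ := e2.trans e1
  have f2 : g₂ (T 3) * (x 3)⁻¹ = g₂ (T 1) * (x 1)⁻¹ := e4.trans e3
  have f3 : g₃ (T 6) * (x 6)⁻¹ = g₃ (T 4) * (x 4)⁻¹ := e6.trans e5
  rw [← f2, n₂₃, ← f3, f1, n₁₃] at n₁₂
  exact (mul_right_cancel (n₁₂.trans (mul_assoc _ _ _).symm)).symm

end

end Zonogon

/-! ### Ascents and the induction over partial sweeps -/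

namespace Zonogon

variable {n : ℕ} {θ : Fin n → ℝ} {a : Fin n → ℕ} {w₀ w w' : List (Fin n)} {L : Set (Cell n)}

/-- An ascent of a word: two consecutive letters in increasing order. -/
@[ext]
structure Ascent (w : List (Fin n)) where
  left : List (Fin n)
  fst : Fin n
  snd : Fin n
  right : List (Fin n)
  eq : w = left ++ fst :: snd :: right
  lt : fst < snd

namespace Ascent

variable (α β γ : Ascent w)

/-- The rhombus passed when the ascent is swapped. -/
def cell : Cell n := rhombus (cnt α.left) α.fst α.snd

theorem left_length_injective :
    Function.Injective (fun α : Ascent w => α.left.length) := by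
  intro α β h
  have e := α.eq.symm.trans β.eq
  obtain ⟨h1, h2⟩ := List.append_inj e h
  simp only [List.cons.injEq] at h2
  exact Ascent.ext h1 h2.1 h2.2.1 h2.2.2

/-- Two different ascents either share one letter or have no letter in common. In the first case
they span a cube, in the second their swaps are independent. -/
theorem adjacent_or_separated (h : α.left.length < β.left.length) :
    (β.left = α.left ++ [α.fst] ∧ β.fst = α.snd ∧ α.right = β.snd :: β.right) ∨
      ∃ x, β.left = α.left ++ α.fst :: α.snd :: x ∧
        α.right = x ++ β.fst :: β.snd :: β.right := by
  rcases List.append_eq_append_iff.1 (α.eq.symm.trans β.eq) with ⟨x, hx, hx'⟩ | ⟨x, hx, -⟩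
  · match x with
    | [] =>
      rw [hx, List.append_nil] at h
      exact absurd h (lt_irrefl _)
    | [i] =>
      simp only [List.cons_append, List.nil_append, List.cons.injEq] at hx'
      obtain ⟨rfl, e1, e2⟩ := hx'
      exact Or.inl ⟨hx, e1.symm, e2⟩
    | i :: i' :: x =>
      simp only [List.cons_append, List.cons.injEq] at hx'
      obtain ⟨rfl, rfl, e2⟩ := hx'
      exact Or.inr ⟨x, hx, e2⟩
  · rw [hx, List.length_append] at h
    omega

/-- The cube spanned by two overlapping ascents. -/
theorem exists_cube {α β : Ascent w}
    (h : β.left = α.left ++ [α.fst] ∧ β.fst = α.snd ∧ α.right = β.snd :: β.right) :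
    ∃ c : Cube n, c.base = cnt α.left ∧ w = α.left ++ c.j :: c.k :: c.l :: β.right ∧
      α.cell = rhombus c.base c.j c.k ∧ β.cell = rhombus (c.base + Pi.single c.j 1) c.k c.l := by
  obtain ⟨h1, h2, h3⟩ := h
  refine ⟨⟨cnt α.left, α.fst, α.snd, β.snd, α.lt, h2 ▸ β.lt⟩, rfl, ?_, rfl, ?_⟩
  · rw [← h3]; exact α.eq
  · show rhombus (cnt β.left) β.fst β.snd =
      rhombus (cnt α.left + Pi.single α.fst 1) α.snd β.snd
    rw [h1, h2, cnt_append_singleton]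

variable {α β γ}

theorem sweep (hL : Sweep 0 w₀ L w) (α : Ascent w) :
    Sweep 0 w₀ (insert α.cell L) (α.left ++ α.snd :: α.fst :: α.right) := hL.swap α.lt α.eq

theorem weight_lt (α : Ascent w) : weight (α.left ++ α.snd :: α.fst :: α.right) < weight w := by
  conv_rhs => rw [α.eq]
  exact weight_swap_lt _ _ α.lt

/-- Two ascents that do not overlap can be swapped one after the other. -/
theorem exists_sweep_of_separated (hL : Sweep 0 w₀ L w)
    (h : ∃ x, β.left = α.left ++ α.fst :: α.snd :: x ∧ α.right = x ++ β.fst :: β.snd :: β.right) :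
    ∃ w', Sweep 0 w₀ (insert α.cell (insert β.cell L)) w' ∧ weight w' < weight w := by
  obtain ⟨x, hx, -⟩ := h
  have e : β.left ++ β.snd :: β.fst :: β.right =
      α.left ++ α.fst :: α.snd :: (x ++ β.snd :: β.fst :: β.right) := by
    rw [hx]; simp
  refine ⟨_, (β.sweep hL).swap α.lt e, ?_⟩
  have := weight_swap_lt α.left (x ++ β.snd :: β.fst :: β.right) α.lt
  rw [← e] at this
  exact this.trans β.weight_lt

theorem containing_inter_eq : containing a θ (insert α.cell L) ∩ containing a θ (insert β.cell L) =
    containing a θ (insert α.cell (insert β.cell L)) := by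
  rw [containing_inter, Set.insert_union, Set.union_insert, Set.union_self]

end Ascent

section
variable {Γ : Type} [Group Γ] {φ : Tiling a θ → Tiling a θ → Γ}

open Ascent

theorem Cube.exists_upFlip_containing (hθ : IsAngles θ) (hw₀ : IsRightBoundary a w₀) {c : Cube n}
    {u v : List (Fin n)} (hb : c.base = cnt u) (hL : Sweep 0 w₀ L (u ++ c.j :: c.k :: c.l :: v)) :
    ∃ T ∈ containing a θ (insert (rhombus c.base c.j c.k) L),
      ∃ T' ∈ containing a θ (insert (rhombus (c.base + Pi.single c.j 1) c.k c.l) L),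
        (flipGraph a θ).Adj T T' := by
  obtain ⟨T, hT⟩ := (hL.trans (c.sweep_bottom_context hb)).nonempty_containing hθ hw₀
  obtain ⟨T', h, hT'⟩ := exists_upFlip hθ hw₀ hL hb hT
  refine ⟨T, Set.insert_subset (hT (Or.inr ?_)) (Set.subset_union_left.trans hT), T',
    Set.insert_subset (hT' (Or.inr ?_)) (Set.subset_union_left.trans hT'), c, Or.inl h⟩
  · rw [c.bottom_eq]; exact Set.mem_insert _ _
  · rw [c.top_eq]; exact Set.mem_insert _ _

/-- For overlapping ascents a flip at their cube connects the two pieces; for separated ones both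
rhombi can be swept, which gives a common tiling. -/
theorem Ascent.exists_comparable_of_lt (hθ : IsAngles θ) (hw₀ : IsRightBoundary a w₀)
    (hL : Sweep 0 w₀ L w) {α β : Ascent w} (h : α.left.length < β.left.length) :
    ∃ T ∈ containing a θ (insert α.cell L), ∃ T' ∈ containing a θ (insert β.cell L),
      T = T' ∨ (flipGraph a θ).Adj T T' := by
  rcases α.adjacent_or_separated β h with h | h
  · obtain ⟨c, hb, e, hα, hβ⟩ := exists_cube h
    rw [e] at hL
    obtain ⟨T, hT, T', hT', h⟩ := c.exists_upFlip_containing hθ hw₀ hb hL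
    exact ⟨T, hα ▸ hT, T', hβ ▸ hT', Or.inr h⟩
  · obtain ⟨w', hw', -⟩ := exists_sweep_of_separated hL h
    obtain ⟨T, hT⟩ := hw'.nonempty_containing hθ hw₀
    rw [← containing_inter_eq] at hT
    exact ⟨T, hT.1, T, hT.2, Or.inl rfl⟩

theorem Ascent.exists_comparable (hθ : IsAngles θ) (hw₀ : IsRightBoundary a w₀)
    (hL : Sweep 0 w₀ L w) (α β : Ascent w) :
    ∃ T ∈ containing a θ (insert α.cell L), ∃ T' ∈ containing a θ (insert β.cell L),
      T = T' ∨ (flipGraph a θ).Adj T T' := by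
  rcases lt_trichotomy α.left.length β.left.length with h | h | h
  · exact exists_comparable_of_lt hθ hw₀ hL h
  · obtain rfl := left_length_injective h
    obtain ⟨T, hT⟩ := (α.sweep hL).nonempty_containing hθ hw₀
    exact ⟨T, hT, T, hT, Or.inl rfl⟩
  · obtain ⟨T, hT, T', hT', e⟩ := exists_comparable_of_lt hθ hw₀ hL h
    exact ⟨T', hT', T, hT, e.imp Eq.symm SimpleGraph.Adj.symm⟩

/-- The tilings containing the rhombi of a sweep are covered by those that also contain the
rhombus at some ascent. -/
theorem containing_eq_iUnion (hθ : IsAngles θ) (hw₀ : IsRightBoundary a w₀)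
    (hL : Sweep 0 w₀ L w) (α₀ : Ascent w) :
    containing a θ L = ⋃ α : Ascent w, containing a θ (insert α.cell L) := by
  refine Set.Subset.antisymm (fun T hT => Set.mem_iUnion.2 ?_)
    (Set.iUnion_subset fun α => containing_anti (Set.subset_insert _ _))
  have hp := hL.pathIn (union_mono hT) (T.pathIn_of_sorted hθ hw₀.sorted hw₀.cnt_eq)
  have hc := hL.cnt_eq.trans hw₀.cnt_eq
  have h := T.hasAscentRhombus hθ α₀.lt (α₀.eq ▸ hp) (α₀.eq ▸ hc)
  rw [← α₀.eq] at h
  obtain ⟨u, j, m, v, e, hjm, h⟩ := h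
  exact ⟨⟨u, j, m, v, e, hjm⟩, Set.insert_subset h hT⟩

theorem eq_of_mem_containing (hθ : IsAngles θ) (hw₀ : IsRightBoundary a w₀)
    (hL : Sweep 0 w₀ L w) (hw : w.Pairwise (· ≥ ·)) {T T' : Tiling a θ}
    (hT : T ∈ containing a θ L) (hT' : T' ∈ containing a θ L) : T = T' := by
  have key : ∀ T ∈ containing a θ L, T.rhombi = L := fun T hT =>
    Set.Subset.antisymm (fun f hf => T.mem_of_tiles hT (hL.tiles_box hθ hw₀ hw) hf
      ⟨_, T.subset_box f hf f.center_mem, rfl⟩) hT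
  exact Tiling.ext ((key T hT).trans (key T' hT').symm)

/-- Overlapping ascents are compared by the flips at their cube. For separated ascents the
intersection of the pieces belongs to a longer sweep and is connected by hypothesis. An edge with
neither end in it would destroy one of the rhombi and create the other, which by
`UpFlip.eq_of_ascents` requires overlapping ascents. -/
theorem exists_isLink_of_lt (hφ : IsFlat φ) (hθ : IsAngles θ) (hw₀ : IsRightBoundary a w₀)
    (hL : Sweep 0 w₀ L w)
    (hconn : ∀ w' L', Sweep 0 w₀ L' w' → weight w' < weight w →
      IsConn (flipGraph a θ) (containing a θ L')) {α β : Ascent w}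
    (hlt : α.left.length < β.left.length) {g g' : Tiling a θ → Γ}
    (hg : IsPotential (flipGraph a θ) φ (containing a θ (insert α.cell L)) g)
    (hg' : IsPotential (flipGraph a θ) φ (containing a θ (insert β.cell L)) g') :
    ∃ h, IsLink (flipGraph a θ) φ (containing a θ (insert α.cell L))
      (containing a θ (insert β.cell L)) g g' h := by
  rcases α.adjacent_or_separated β hlt with h | h
  · obtain ⟨c, hb, e, hα, hβ⟩ := exists_cube h
    rw [hα] at hg ⊢
    rw [hβ] at hg' ⊢
    rw [e] at hL hconn
    have hs := c.sweep_bottom_context (v := β.right) hb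
    refine exists_isLink_of_cube hφ hθ hw₀ hb hL hg hg' (hconn _ _ (hL.trans hs) (hs.weight_lt.2 ?_))
    rw [c.bottom_eq]; exact Set.insert_nonempty _ _
  · obtain ⟨w', hw', hlt'⟩ := exists_sweep_of_separated hL h
    refine exists_isLink_of_inter hg hg' (by rw [containing_inter_eq]; exact hconn _ _ hw' hlt')
      (by rw [containing_inter_eq]; exact hw'.nonempty_containing hθ hw₀) fun T hT T' hT' e => ?_
    by_contra hc
    rw [not_or] at hc
    obtain ⟨x, hx, -⟩ := h
    have hα : α.cell ∉ T'.rhombi := fun h =>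
      hc.2 (Set.insert_subset h ((Set.subset_insert _ _).trans hT'))
    have hβ : β.cell ∉ T.rhombi := fun h =>
      hc.1 (Set.insert_subset h ((Set.subset_insert _ _).trans hT))
    have hα' : α.cell ∈ T.rhombi := hT (Set.mem_insert _ _)
    have hβ' : β.cell ∈ T'.rhombi := hT' (Set.mem_insert _ _)
    have heq := α.eq.symm.trans β.eq
    obtain ⟨c, hup | hup⟩ := e
    · obtain ⟨e1, -⟩ := hup.eq_of_ascents α.lt β.lt heq hα' hα hβ' hβ
      have := congrArg List.length (hx.symm.trans e1)
      simp only [List.length_append, List.length_cons, List.length_nil] at this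
      omega
    · obtain ⟨e1, -⟩ := hup.eq_of_ascents β.lt α.lt heq.symm hβ' hβ hα' hα
      have := congrArg List.length e1
      simp only [List.length_append, List.length_cons, List.length_nil] at this
      omega

/-- Only a chain of two overlaps needs the octagon. With one overlap, a flip at its cube can be made
between tilings that both contain the rhombus of the third ascent; with none, some tiling contains
all three rhombi. -/
theorem isCocycle_of_lt (hφ : IsFlat φ) (hθ : IsAngles θ) (hw₀ : IsRightBoundary a w₀)
    (hL : Sweep 0 w₀ L w) {α β γ : Ascent w} (hαβ : α.left.length < β.left.length)
    (hβγ : β.left.length < γ.left.length) {g₁ g₂ g₃ : Tiling a θ → Γ}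
    (hg₁ : IsPotential (flipGraph a θ) φ (containing a θ (insert α.cell L)) g₁)
    (hg₂ : IsPotential (flipGraph a θ) φ (containing a θ (insert β.cell L)) g₂)
    (hg₃ : IsPotential (flipGraph a θ) φ (containing a θ (insert γ.cell L)) g₃) :
    IsCocycle (flipGraph a θ) φ (containing a θ (insert α.cell L))
      (containing a θ (insert β.cell L)) (containing a θ (insert γ.cell L)) g₁ g₂ g₃ := by
  rcases α.adjacent_or_separated β hαβ with h | h <;>
    rcases β.adjacent_or_separated γ hβγ with h' | h'
  · obtain ⟨h1, h2, h3⟩ := h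
    obtain ⟨h1', h2', h3'⟩ := h'
    have e : w = α.left ++ [α.fst, α.snd, β.snd, γ.snd] ++ γ.right :=
      α.eq.trans (by rw [h3, h3']; simp)
    have hβc : β.cell = rhombus (cnt α.left + cnt [α.fst]) α.snd β.snd := by
      rw [cell, h1, h2, cnt_append]
    have hγc : γ.cell = rhombus (cnt α.left + cnt [α.fst, α.snd]) β.snd γ.snd := by
      rw [cell, h1', h2', h1, h2, List.append_assoc, cnt_append]; rfl
    have hαc : α.cell = rhombus (cnt α.left) α.fst α.snd := rfl
    rw [hβc] at hg₂ ⊢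
    rw [hγc] at hg₃ ⊢
    rw [hαc] at hg₁ ⊢
    exact isCocycle_of_octagon hφ hθ hw₀ α.lt (h2 ▸ β.lt) (h2' ▸ γ.lt) (e ▸ hL) hg₁ hg₂ hg₃
  · obtain ⟨c, hb, e, hα, hβ⟩ := exists_cube h
    obtain ⟨x, hx, hx'⟩ := h'
    have hw : γ.left ++ γ.snd :: γ.fst :: γ.right =
        α.left ++ c.j :: c.k :: c.l :: (x ++ γ.snd :: γ.fst :: γ.right) := by
      have e1 := β.eq.symm.trans e
      rw [h.1] at e1
      simp only [List.append_assoc, List.cons_append, List.nil_append, List.append_cancel_left_eq,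
        List.cons.injEq, and_true] at e1
      rw [hx, h.1, ← e1.1, ← e1.2.1, ← e1.2.2]
      simp
    -- Swapping `γ` does not touch the three letters of the cube, so both tilings of the flip can be
    -- taken to contain the rhombus of `γ`.
    have hL' := γ.sweep hL
    rw [hw] at hL'
    obtain ⟨T, hT, T', hT', hadj⟩ := c.exists_upFlip_containing hθ hw₀ hb hL'
    rw [← hα, ← containing_inter_eq] at hT
    rw [← hβ, ← containing_inter_eq] at hT'
    intro h₁₂ h₂₃ h₁₃ l₁₂ l₂₃ l₁₃
    have m₁₂ := (l₁₂ T hT.1 T' hT'.1).2 hadj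
    have m₂₃ := (l₂₃ T' hT'.1 T' hT'.2).1 rfl
    have m₁₃ := (l₁₃ T hT.1 T' hT'.2).2 hadj
    rw [m₁₂, m₂₃, ← mul_assoc] at m₁₃
    exact mul_right_cancel m₁₃
  · obtain ⟨c, hb, e, hβ, hγ⟩ := exists_cube h'
    obtain ⟨x, hx, hx'⟩ := h
    have hw : α.left ++ α.snd :: α.fst :: α.right =
        (α.left ++ α.snd :: α.fst :: x) ++ c.j :: c.k :: c.l :: γ.right := by
      have e1 := β.eq.symm.trans e
      simp only [List.append_cancel_left_eq, List.cons.injEq] at e1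
      rw [hx', e1.1, e1.2.1, e1.2.2]
      simp
    -- Swapping `α` permutes the letters before the cube and leaves its base in place.
    have hb' : c.base = cnt (α.left ++ α.snd :: α.fst :: x) := by
      rw [hb, hx]
      simp only [cnt_append, cnt_cons]
      rw [add_left_comm (Pi.single α.fst 1)]
    have hL' := α.sweep hL
    rw [hw] at hL'
    obtain ⟨T, hT, T', hT', hadj⟩ := c.exists_upFlip_containing hθ hw₀ hb' hL'
    rw [← hβ, ← containing_inter_eq] at hT
    rw [← hγ, ← containing_inter_eq] at hT'
    intro h₁₂ h₂₃ h₁₃ l₁₂ l₂₃ l₁₃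
    have m₁₂ := (l₁₂ T hT.2 T hT.1).1 rfl
    have m₂₃ := (l₂₃ T hT.1 T' hT'.1).2 hadj
    have m₁₃ := (l₁₃ T hT.2 T' hT'.1).2 hadj
    rw [m₁₂, mul_assoc, m₂₃, ← mul_assoc] at m₁₃
    exact mul_right_cancel m₁₃
  · obtain ⟨x, hx, -⟩ := h
    obtain ⟨y, hy, -⟩ := h'
    have e1 : γ.left ++ γ.snd :: γ.fst :: γ.right =
        β.left ++ β.fst :: β.snd :: (y ++ γ.snd :: γ.fst :: γ.right) := by rw [hy]; simp
    have e2 : β.left ++ β.snd :: β.fst :: (y ++ γ.snd :: γ.fst :: γ.right) =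
        α.left ++ α.fst :: α.snd :: (x ++ β.snd :: β.fst :: (y ++ γ.snd :: γ.fst :: γ.right)) := by
      rw [hx]; simp
    obtain ⟨T, hT⟩ := (((γ.sweep hL).swap β.lt e1).swap α.lt e2).nonempty_containing hθ hw₀
    have hTL : L ⊆ T.rhombi := (((Set.subset_insert _ _).trans (Set.subset_insert _ _)).trans
      (Set.subset_insert _ _)).trans hT
    have hα : T ∈ containing a θ (insert α.cell L) :=
      Set.insert_subset (hT (Set.mem_insert _ _)) hTL
    have hβ : T ∈ containing a θ (insert β.cell L) :=
      Set.insert_subset (hT (Or.inr (Set.mem_insert _ _))) hTL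
    have hγ : T ∈ containing a θ (insert γ.cell L) :=
      Set.insert_subset (hT (Or.inr (Or.inr (Set.mem_insert _ _)))) hTL
    intro h₁₂ h₂₃ h₁₃ l₁₂ l₂₃ l₁₃
    have m₁₂ := (l₁₂ T hα T hβ).1 rfl
    have m₂₃ := (l₂₃ T hβ T hγ).1 rfl
    have m₁₃ := (l₁₃ T hα T hγ).1 rfl
    rw [m₁₂, m₂₃, ← mul_assoc] at m₁₃
    exact mul_right_cancel m₁₃

/-- Connectedness and potentials are proved together, because comparing potentials on two pieces
needs the connectedness of sets belonging to longer sweeps. A decreasing word leaves one tiling;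
otherwise the pieces of the ascents cover the set, any two of them are comparable, and their
potentials glue. -/
theorem isConn_and_exists_isPotential (hφ : IsFlat φ) (hθ : IsAngles θ)
    (hw₀ : IsRightBoundary a w₀) (hL : Sweep 0 w₀ L w) :
    IsConn (flipGraph a θ) (containing a θ L) ∧
      ∃ g, IsPotential (flipGraph a θ) φ (containing a θ L) g := by
  induction hμ : weight w using Nat.strong_induction_on generalizing w L with
  | _ k ih =>
    subst hμ
    rcases pairwise_ge_or_exists_ascent w with hw | ⟨u, j, m, v, e, hjm⟩
    · have heq : ∀ {T T' : Tiling a θ}, T ∈ containing a θ L → T' ∈ containing a θ L → T = T' :=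
        eq_of_mem_containing hθ hw₀ hL hw
      exact ⟨fun P _ T hT T' hT' h => heq hT hT' ▸ h, fun _ => 1,
        fun T hT T' hT' h => absurd (heq hT hT') h.ne⟩
    · let α₀ : Ascent w := ⟨u, j, m, v, e, hjm⟩
      have hIH := fun α : Ascent w => ih _ α.weight_lt (α.sweep hL) rfl
      have hne := exists_comparable hθ hw₀ hL (a := a)
      have hcover := containing_eq_iUnion hθ hw₀ hL α₀
      constructor
      · intro P hP T hT T' hT' h
        obtain ⟨α, hα⟩ := Set.mem_iUnion.1 (hcover ▸ hT)
        obtain ⟨β, hβ⟩ := Set.mem_iUnion.1 (hcover ▸ hT')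
        obtain ⟨T₁, hT₁, T₂, hT₂, e⟩ := hne α β
        have hsub : ∀ α : Ascent w, containing a θ (insert α.cell L) ⊆ containing a θ L :=
          fun α => containing_anti (Set.subset_insert _ _)
        have hPα : ∀ α : Ascent w, ∀ u ∈ containing a θ (insert α.cell L),
            ∀ v ∈ containing a θ (insert α.cell L), P u → P v := fun α =>
          (hIH α).1 P fun u hu v hv => hP u (hsub α hu) v (hsub α hv)
        have h₁ := hPα α T hα T₁ hT₁ h
        have h₂ : P T₂ := by
          rcases e with rfl | e
          · exact h₁
          · exact hP _ (hsub α hT₁) _ (hsub β hT₂) e h₁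
        exact hPα β T₂ hT₂ T' hβ h₂
      · choose g hg using fun α => (hIH α).2
        rw [hcover]
        have hlink : ∀ α β : Ascent w, α.left.length < β.left.length →
            ∃ h, IsLink (flipGraph a θ) φ (containing a θ (insert α.cell L))
              (containing a θ (insert β.cell L)) (g α) (g β) h := fun α β hlt =>
          exists_isLink_of_lt hφ hθ hw₀ hL (fun w' L' h hlt => (ih _ hlt h rfl).1) hlt (hg α) (hg β)
        refine exists_isPotential_iUnion α₀ (fun α β => ?_) fun α β =>
          isCocycle_of_sorted hφ.inv hg (fun α => (α.sweep hL).nonempty_containing hθ hw₀) hne _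
            left_length_injective (fun α β γ h h' => ?_) _ _ _
        · rcases lt_trichotomy α.left.length β.left.length with h | h | h
          · exact hlink α β h
          · obtain rfl := left_length_injective h
            exact ⟨1, (hg α).isLink_self⟩
          · obtain ⟨x, hx⟩ := hlink β α h
            exact ⟨_, hx.symm hφ.inv⟩
        · exact isCocycle_of_lt hφ hθ hw₀ hL h h' (hg α) (hg β) (hg γ)

end

/-- The word listing each letter `i` with multiplicity `a i` in increasing order. -/
theorem exists_isRightBoundary (hn : 3 ≤ n) (ha : ∀ i, 0 < a i) :
    ∃ w, IsRightBoundary a w := by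
  refine ⟨(List.finRange n).flatMap fun i => List.replicate (a i) i, ⟨?_, ?_, ?_⟩⟩
  · rw [List.pairwise_flatMap]
    refine ⟨fun i _ => List.pairwise_replicate.2 (Or.inr le_rfl), ?_⟩
    refine (List.pairwise_lt_finRange n).imp fun h x hx y hy => ?_
    rw [List.eq_of_mem_replicate hx, List.eq_of_mem_replicate hy]
    exact h.le
  · ext i
    rw [cnt, List.count_flatMap]
    have : (List.map (List.count i ∘ fun j => List.replicate (a j) j) (List.finRange n)).sum =
        ∑ j, if j = i then a j else 0 := by
      rw [← List.sum_ofFn, List.ofFn_eq_map]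
      congr 1
      refine List.map_congr_left fun j _ => ?_
      simp [List.count_replicate]
    rw [this]
    simp
  · exact ⟨⟨0, by omega⟩, ⟨1, by omega⟩, by simp, ha _, ha _⟩

end Zonogon

theorem proposition3p11 (n : ℕ) (hn : 3 ≤ n) (a : Fin n → ℕ) (ha : ∀ i, 0 < a i)
    (θ : Fin n → ℝ) (hθ : StrictMono θ) (hθ_pos : ∀ i, 0 < θ i) (hθ_lt : ∀ i, θ i < Real.pi) :
    SimplyConnectedSpace (Zonogon.flipComplex a θ).Realization := by
  have hθ' : Zonogon.IsAngles θ := ⟨hθ, hθ_pos, hθ_lt⟩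
  obtain ⟨w₀, hw₀⟩ := Zonogon.exists_isRightBoundary hn ha
  have hL : Zonogon.Sweep 0 w₀ ∅ w₀ := .refl
  have hmem : ∀ T, T ∈ Zonogon.containing a θ ∅ := fun T => Set.empty_subset _
  refine Zonogon.simplyConnectedSpace_flipComplex a θ ?_ ?_ ?_
  · obtain ⟨T, -⟩ := hL.nonempty_containing hθ' hw₀
    exact ⟨T⟩
  -- Connectedness does not involve the cochain, so the induction is applied to a trivial one.
  · have hφ : Zonogon.IsFlat (fun _ _ : Zonogon.Tiling a θ => (1 : Multiplicative ℤ)) :=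
      ⟨fun _ _ _ => mul_one 1, fun _ _ _ => ⟨fun _ => 1, fun _ => mul_one 1⟩,
        fun _ _ => ⟨fun _ => 1, fun _ => mul_one 1⟩⟩
    intro T T'
    exact (Zonogon.isConn_and_exists_isPotential hφ hθ' hw₀ hL).1
      (fun S => (Zonogon.flipGraph a θ).Reachable T S)
      (fun u _ v _ e h => h.trans e.reachable) T (hmem T) T' (hmem T')
      (SimpleGraph.Reachable.refl T)
  · intro Γ _ φ h1 h2 h3
    obtain ⟨g, hg⟩ := (Zonogon.isConn_and_exists_isPotential ⟨h1, h2, h3⟩ hθ' hw₀ hL).2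
    exact ⟨g, fun u v => hg u (hmem u) v (hmem v)⟩
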